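/- **Setting.** Let $0<\sigma<R$ and let $\Phi$ be an even pair potential with $\Phi(q)=0$ for $|q|>R$, twice continuously differentiable outside the hard core of length $\sigma$, with $\Phi(q)\to+\infty$ as $q\downarrow\sigma$. Particles on the line, of unit mass, are labelled by $\mathbb Z\setminus\{0\}$ (the right neighbour of $-1$ is $1$) and interact with nearest neighbours only. A *block* is a nonempty finite set $X$ of consecutive labels, e.g. $X=(-s_1,\dots,-1,1,\dots,s_2)$ with $s_1+s_2\ge1$. Put $x_i=(q_i,p_i)\in\mathbb R^2$, $x_X=(x_i)_{i\in X}$, and let $\Gamma_X$ be the set of allowed phase points $x_X$: $\sigma+q_j<q_k$ for all neighbours $j<k$ in $X$. $L^1_X=L^1(\Gamma_X)$, functions being $0$ off $\Gamma_X$. Let $X_i(t,x)$ be the global solution of the Hamilton equations of the particles of $X$ with initial data $x\in\Gamma_X$, and let $(S^*_X(t)f)(x)=f\big((X_i(-t,x))_{i\in X}\big)$ on $\Gamma_X$ and $0$ otherwise. Put $\mathcal L^*(j)=-p_j\partial_{q_j}$, $\mathcal L^*_{\rm int}(j,k)=\Phi'(q_j-q_k)(\partial_{p_j}-\partial_{p_k})$,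 and $\mathcal L^*_X=\sum_{j}\mathcal L^*(j)+\sum_{(j,k)}\mathcal L^*_{\rm int}(j,k)$, the last sum over neighbours $j<k$ in $X$. An *ordered partition* $\mathrm P$ of $X$ is a partition of $X$ into blocks; $|\mathrm P|$ is the number of its parts. Ordered partitions $\mathrm Q$ of the ordered set of clusters $(\{X_1\},\dots,\{X_n\})$ formed by the parts of $\mathrm P$ are identified with the ordered partitions $\mathrm Q$ of $X$ that are coarser than $\mathrm P$. **Liouville hierarchy.** For families $g(t)=(g_X(t))_X$ indexed by all blocks $X$, the Cauchy problem is $$\partial_t g_X(t)=\mathcal L^*_X g_X(t)+\sum_{X=X_1\cup X_2}\mathcal L^*_{\rm int}(\max X_1,\min X_2)\,g_{X_1}(t)\,g_{X_2}(t),\qquad g_X(0)=g^0_X, \tag{1}$$ with the sum over the ordered partitions of $X$ into two parts. A *double sequence* is a family for which $g_X$ depends, up to the order-preserving relabelling of its variables, only on the numbers $n_1,n_2$ of negative and positive labels in $X$. A *weak solution* of (1) is a family of continuous curves $g_X:\mathbb R\to L^1_X$ with $g_X(0)=g^0_X$ such that, for all $X$, all $\varphi\in C^1_c(\Gamma_X)$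 and all $t\in\mathbb R$, $$\frac{d}{dt}\int_{\Gamma_X} g_X(t)\varphi=-\int_{\Gamma_X} g_X(t)\,\mathcal L^*_X\varphi-\sum_{X=X_1\cup X_2}\int_{\Gamma_X} g_{X_1}(t)g_{X_2}(t)\,\mathcal L^*_{\rm int}(\max X_1,\min X_2)\varphi .$$ A *classical solution* is a family of functions $g_X\in C^1(\mathbb R\times\Gamma_X)$ which satisfies (1) pointwise. **Expansions.** Let *generating operators* be given: for every $t\in\mathbb R$, block $X$ and ordered partition $\mathrm P=\{X_1,\dots,X_n\}$ of $X$, a bounded linear operator $\mathfrak A_n(t,\{X_1\},\dots,\{X_n\}):L^1(\Gamma_{X_1}\times\dots\times\Gamma_{X_n})\to L^1_X$. Consider $$g_X(t)=\sum_{\mathrm P:\,X=\bigcup_i X_i}\mathfrak A_{|\mathrm P|}(t,\{X_1\},\dots,\{X_{|\mathrm P|}\})\prod_{X_i\in \mathrm P}g^0_{X_i}(x_{X_i}).\tag{2}$$ **Theorem.** The following are equivalent. 1. The generating operators solve the cluster expansions of the groups $S^*$: for all $t$, $X$ and $\mathrm P=\{X_1,\dots,X_n\}$, on $\Gamma_X$,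 $$S^*_X(t)=\sum_{\mathrm Q:\,(\{X_1\},\dots,\{X_n\})=\bigcup_k Z_k}\ \prod_{Z_k\in\mathrm Q}\mathfrak A_{|Z_k|}(t,Z_k),$$ where $|Z_k|$ is the number of clusters in $Z_k$ and $\mathfrak A_{|Z_k|}(t,Z_k)$ acts on the variables of the particles of $Z_k$; the identity is understood on all products $\prod_i f_i(x_{X_i})$, $f_i\in L^1_{X_i}$ (whose span is dense). 2. The generating operators are the cumulants of the groups $S^*$: for all $t$, $X$ and $\mathrm P=\{X_1,\dots,X_n\}$, on $\Gamma_X$, $$\mathfrak A_n(t,\{X_1\},\dots,\{X_n\})=\sum_{\mathrm Q:\,(\{X_1\},\dots,\{X_n\})=\bigcup_k Z_k}(-1)^{|\mathrm Q|-1}\prod_{Z_k\in\mathrm Q}S^*_{\theta(Z_k)}(t),$$ where $\theta(Z_k)$ is the union of the clusters in $Z_k$. 3. For all initial data $g^0=(g^0_X)_X$, $g^0_X\in L^1_X$, the family (2) is a weak solution of (1). 4. For all initial data $g^0_X\in L^1_X$, every weak solution of (1) is represented by (2). 5. For all initial data $g^0_X\in C^\infty_c(\Gamma_X)$, the family (2)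 is (almost everywhere equal, for each $t$, to) a classical solution of (1). 6. For all initial data $g^0_X\in C^\infty_c(\Gamma_X)$, every classical solution of (1) is, for each $t$, almost everywhere equal to (2). Moreover, if the generating operators solve the cluster expansions and $g^0$ is a double sequence, then (2) is a double sequence for every $t$. -/

import Mathlib

open MeasureTheory Set Filter Topology
open scoped ContDiff

namespace NearestNeighbour

noncomputable section

/-! ### Labels, blocks and ordered partitions -/

/-- The successor of a particle label in `ℤ \ {0}`: the right neighbour of `-1` is `1`. -/
def next (j : ℤ) : ℤ := if j = -1 then 1 else j + 1

/-- A block: a nonempty set of consecutive labels of `ℤ \ {0}`. The index set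
`(-s₁, …, -1, 1, …, s₂)` with `s₁ + s₂ ≥ 1` is a block, and so are all its intervals. -/
def IsBlock (X : Finset ℤ) : Prop :=
  X.Nonempty ∧ (0 : ℤ) ∉ X ∧ ∀ i ∈ X, ∀ k ∈ X, ∀ j : ℤ, i < j → j < k → j ≠ 0 → j ∈ X

open Classical in
/-- The ordered partitions of the linearly ordered set `X`: the partitions of `X` into
nonempty sets of consecutive labels (so a block of `n` labels has `2 ^ (n - 1)` of them). -/
def orderedPartitions (X : Finset ℤ) : Finset (Finpartition X) :=
  Finset.univ.filter fun P => ∀ B ∈ P.parts, IsBlock B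

open Classical in
/-- The ordered partitions of the ordered set of clusters `({X₁}, …, {Xₙ})`, where `X₁, …, Xₙ`
are the parts of `P`: a group of neighbouring clusters is recorded by its union
(declusterization), so these are the ordered partitions of `X` that are coarser than `P`. -/
def clusterPartitions {X : Finset ℤ} (P : Finpartition X) : Finset (Finpartition X) :=
  (orderedPartitions X).filter fun Q => P ≤ Q

/-! ### Phase space -/

/-- Phase points `(x_i)_{i ∈ X}`, `x_i = (q_i, p_i)`, of the particles with labels in `X`. -/
abbrev Phase (X : Finset ℤ) : Type := X → ℝ × ℝ

/-- The part `x_B` of a phase point `x` of the particles of `X ⊇ B`. -/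
def proj {X B : Finset ℤ} (h : B ⊆ X) (x : Phase X) : Phase B := fun i => x ⟨i, h i.2⟩

/-- The allowed phase points: `q_j + σ < q_k` for all neighbours `j`, `k = next j` in `X`. -/
def allowed (σ : ℝ) (X : Finset ℤ) : Set (Phase X) :=
  {x | ∀ j k : X, (k : ℤ) = next j → σ + (x j).1 < (x k).1}

/-- Phase points all of whose restrictions to the parts of `P` are allowed. -/
def allowedParts (σ : ℝ) {X : Finset ℤ} (P : Finpartition X) : Set (Phase X) :=
  {x | ∀ B : P.parts, proj (P.le B.2) x ∈ allowed σ B}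

/-- Lebesgue measure on the allowed phase points. -/
abbrev phaseMeasure (σ : ℝ) (X : Finset ℤ) : Measure (Phase X) :=
  (volume : Measure (Phase X)).restrict (allowed σ X)

/-- Lebesgue measure on the phase points that are allowed for each part of `P`; it is the
product of the measures `phaseMeasure σ B`, `B ∈ P.parts`. -/
abbrev partsMeasure (σ : ℝ) {X : Finset ℤ} (P : Finpartition X) : Measure (Phase X) :=
  (volume : Measure (Phase X)).restrict (allowedParts σ P)

/-- Integrable functions of the particles of `X`, equal to zero on forbidden configurations. -/
abbrev L1 (σ : ℝ) (X : Finset ℤ) : Type := Lp ℝ 1 (phaseMeasure σ X)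

/-- Integrable functions of the particles of `X` which vanish wherever one of the parts of `P`
is in a forbidden configuration: the space that contains the products `∏ f_B(x_B)`, `B ∈ P`. -/
abbrev L1Parts (σ : ℝ) {X : Finset ℤ} (P : Finpartition X) : Type := Lp ℝ 1 (partsMeasure σ P)

/-- The function `∏_{B ∈ P} f_B(x_B)`. -/
def prodFun {X : Finset ℤ} (P : Finpartition X) (f : (B : Finset ℤ) → Phase B → ℝ) :
    Phase X → ℝ :=
  fun x => ∏ B : P.parts, f B (proj (P.le B.2) x)

lemma isOpen_allowed (σ : ℝ) (X : Finset ℤ) : IsOpen (allowed σ X) := by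
  have : allowed σ X = ⋂ j : X, ⋂ k : X, {x | (k : ℤ) = next j → σ + (x j).1 < (x k).1} := by
    ext x; simp [allowed]
  rw [this]
  refine isOpen_iInter_of_finite fun j => isOpen_iInter_of_finite fun k => ?_
  by_cases h : (k : ℤ) = next j
  · simp only [h, forall_const]
    exact isOpen_lt (by fun_prop) (by fun_prop)
  · simp [h]

lemma measurable_proj {X B : Finset ℤ} (h : B ⊆ X) : Measurable (proj h) :=
  measurable_pi_lambda _ fun _ => measurable_pi_apply _

lemma measurableSet_allowedParts (σ : ℝ) {X : Finset ℤ} (P : Finpartition X) :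
    MeasurableSet (allowedParts σ P) := by
  have : allowedParts σ P =
      ⋂ B : P.parts, (proj (P.le B.2)) ⁻¹' (allowed σ B) := by
    ext x; simp [allowedParts]
  rw [this]
  exact MeasurableSet.iInter fun B =>
    measurable_proj _ (isOpen_allowed σ B).measurableSet

/-- Gluing phase points of the parts of `P`. -/
def glue {X : Finset ℤ} (P : Finpartition X) (y : (B : P.parts) → Phase B) : Phase X :=
  fun i => y ⟨P.part i, P.part_mem.2 i.2⟩ ⟨i, P.mem_part_self.2 i.2⟩

lemma proj_glue {X : Finset ℤ} (P : Finpartition X) (y : (B : P.parts) → Phase B)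
    (B : P.parts) : proj (P.le B.2) (glue P y) = y B := by
  funext b
  have key : ∀ (C : P.parts) (hC : (b : ℤ) ∈ (C : Finset ℤ)), C = B → y C ⟨b, hC⟩ = y B b := by
    rintro C hC rfl
    rfl
  exact key _ _ (Subtype.ext (P.part_eq_of_mem B.2 b.2))

lemma measurePreserving_glue {X : Finset ℤ} (P : Finpartition X) :
    MeasurePreserving (glue P) volume volume := by
  have hm : Measurable (glue P) := by
    refine measurable_pi_lambda _ fun i => ?_
    unfold glue
    fun_prop
  refine ⟨hm, ?_⟩
  symm
  refine Measure.pi_eq fun s hs => ?_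
  rw [Measure.map_apply hm (MeasurableSet.univ_pi hs)]
  have : glue P ⁻¹' (Set.univ.pi s) =
      Set.univ.pi fun B : P.parts => Set.univ.pi fun b : (B : Finset ℤ) =>
        s ⟨b, P.le B.2 b.2⟩ := by
    ext y
    simp only [Set.mem_preimage, Set.mem_univ_pi]
    constructor
    · intro h B b
      have := h ⟨b, P.le B.2 b.2⟩
      have e : glue P y ⟨b, P.le B.2 b.2⟩ = y B b := congrFun (proj_glue P y B) b
      rw [← e]; exact this
    · intro h i
      exact h ⟨P.part i, P.part_mem.2 i.2⟩ ⟨i, P.mem_part_self.2 i.2⟩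
  rw [this, volume_pi_pi]
  simp_rw [volume_pi_pi]
  rw [← Fintype.prod_sigma' (fun (B : P.parts) (b : (B : Finset ℤ)) =>
    (volume (s ⟨b, P.le B.2 b.2⟩) : ENNReal))]
  refine (Fintype.prod_equiv P.equivSigmaParts _ _ fun i => ?_).symm
  rfl

lemma integrable_prodFun {X : Finset ℤ} (P : Finpartition X)
    (f : (B : Finset ℤ) → Phase B → ℝ) (hf : ∀ B ∈ P.parts, Integrable (f B) volume) :
    Integrable (prodFun P f) volume := by
  have hp : MeasurePreserving (fun (x : Phase X) (B : P.parts) => proj (P.le B.2) x)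
      volume volume := by
    have hm : Measurable (fun (x : Phase X) (B : P.parts) => proj (P.le B.2) x) :=
      measurable_pi_lambda _ fun B => measurable_proj _
    refine ⟨hm, ?_⟩
    rw [← (measurePreserving_glue P).map_eq, Measure.map_map hm (measurePreserving_glue P).measurable]
    have : (fun (x : Phase X) (B : P.parts) => proj (P.le B.2) x) ∘ glue P = id := by
      funext y B
      exact proj_glue P y B
    rw [this, Measure.map_id]
  have h := Integrable.fintype_prod_dep (μ := fun B : P.parts => (volume : Measure (Phase B)))
    (f := fun B : P.parts => f B) fun B => hf B B.2
  exact hp.integrable_comp_of_integrable h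

lemma integrable_prodFun_L1 (σ : ℝ) {X : Finset ℤ} (P : Finpartition X)
    (f : (B : Finset ℤ) → L1 σ B) :
    Integrable (prodFun P fun B => f B) (partsMeasure σ P) := by
  have h : Integrable (prodFun P fun B => (allowed σ B).indicator (f B)) volume :=
    integrable_prodFun P _ fun B _ =>
      (integrable_indicator_iff (isOpen_allowed σ B).measurableSet).2
        (L1.integrable_coeFn (f B))
  refine (h.integrableOn (s := allowedParts σ P)).congr_fun (fun x hx => ?_)
    (measurableSet_allowedParts σ P)
  exact Finset.prod_congr rfl fun B _ => Set.indicator_of_mem (hx B) _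

/-- The product `∏_{B ∈ P} f_B(x_B)` of integrable functions, as an integrable function. -/
def prodL1 {σ : ℝ} {X : Finset ℤ} (P : Finpartition X) (f : (B : Finset ℤ) → L1 σ B) :
    L1Parts σ P :=
  (integrable_prodFun_L1 σ P f).toL1 _

/-! ### Dynamics -/

/-- The interaction potential: even, of finite range `R`, with a hard core of length `σ` at which
it becomes `+∞`, and twice continuously differentiable outside the core. -/
structure IsPotential (σ R : ℝ) (Φ : ℝ → ℝ) : Prop where
  core_pos : 0 < σ
  core_lt_range : σ < R
  even : ∀ q, Φ (-q) = Φ q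
  finite_range : ∀ q, R < |q| → Φ q = 0
  contDiffOn : ContDiffOn ℝ 2 Φ (Ioi σ)
  hard_core : Tendsto Φ (𝓝[>] σ) atTop

/-- The Hamilton vector field of `∑ p_j² / 2 + ∑ Φ(q_j - q_k)`, where the second sum is over the
neighbours `j`, `k = next j` in `X`: `(q_j)' = p_j` and `(p_j)' = - ∂/∂q_j` of the potential
energy. -/
def hamiltonField (Φ : ℝ → ℝ) (X : Finset ℤ) (x : Phase X) : Phase X := fun j =>
  ((x j).2,
    - (∑ k : X, if (k : ℤ) = next j then deriv Φ ((x j).1 - (x k).1) else 0)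
    + ∑ i : X, if (j : ℤ) = next i then deriv Φ ((x i).1 - (x j).1) else 0)

/-- Global-in-time solutions of the Hamilton equations. -/
def IsTrajectory (σ : ℝ) (Φ : ℝ → ℝ) (X : Finset ℤ) (γ : ℝ → Phase X) : Prop :=
  ∀ t, γ t ∈ allowed σ X ∧ HasDerivAt γ (hamiltonField Φ X (γ t)) t

open Classical in
/-- The phase point `(X_i(t, x))_{i ∈ X}` at time `t` on the solution of the Hamilton equations
with initial data `x`. -/
def flow (σ : ℝ) (Φ : ℝ → ℝ) (X : Finset ℤ) (t : ℝ) (x : Phase X) : Phase X :=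
  if h : ∃ γ, IsTrajectory σ Φ X γ ∧ γ 0 = x then Classical.choose h t else x

open Classical in
/-- The group of operators `S*_X(t)` of the Liouville equation. -/
def liouvilleGroup (σ : ℝ) (Φ : ℝ → ℝ) (X : Finset ℤ) (t : ℝ) (f : Phase X → ℝ) :
    Phase X → ℝ :=
  fun x => if x ∈ allowed σ X then f (flow σ Φ X (-t) x) else 0

open Classical in
/-- The product `∏_{B ∈ Q} S*_B(t)`, in which `S*_B(t)` acts on the variables `x_B` of a function
of the variables `x_X`: each part of `Q` moves along its own trajectory. -/
def groupProduct (σ : ℝ) (Φ : ℝ → ℝ) {X : Finset ℤ} (Q : Finpartition X) (t : ℝ)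
    (f : Phase X → ℝ) : Phase X → ℝ :=
  fun x => if x ∈ allowedParts σ Q then
    f (glue Q fun B => flow σ Φ B (-t) (proj (Q.le B.2) x)) else 0

/-- `∂f/∂q_j`. -/
def dq {X : Finset ℤ} (j : X) (f : Phase X → ℝ) (x : Phase X) : ℝ :=
  fderiv ℝ f x (Pi.single j (1, 0))

/-- `∂f/∂p_j`. -/
def dp {X : Finset ℤ} (j : X) (f : Phase X → ℝ) (x : Phase X) : ℝ :=
  fderiv ℝ f x (Pi.single j (0, 1))

/-- `(L*_int(j, k) f)(x) = Φ'(q_j - q_k) (∂/∂p_j - ∂/∂p_k) f(x)`. -/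
def Lint (Φ : ℝ → ℝ) {X : Finset ℤ} (j k : X) (f : Phase X → ℝ) (x : Phase X) : ℝ :=
  deriv Φ ((x j).1 - (x k).1) * (dp j f x - dp k f x)

/-- The Liouville operator `L*_X = ∑ L*(j) + ∑ L*_int(j, k)`, `L*(j) = - p_j ∂/∂q_j`, where the
second sum is over the neighbours `j`, `k = next j` in `X`. -/
def liouvilleOp (Φ : ℝ → ℝ) (X : Finset ℤ) (f : Phase X → ℝ) (x : Phase X) : ℝ :=
  (∑ j : X, -(x j).2 * dq j f x) +
    ∑ j : X, ∑ k : X, if (k : ℤ) = next j then Lint Φ j k f x else 0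

/-! ### The Cauchy problem for the Liouville hierarchy -/

/-- The labels of `X` up to `j`: the first part of the ordered partition of `X` into two parts
`X₁`, `X₂` with `max X₁ = j`. -/
def lowerPart (X : Finset ℤ) (j : ℤ) : Finset ℤ := X.filter (· ≤ j)

/-- The labels of `X` after `j`: the second part of the ordered partition of `X` into two parts
`X₁`, `X₂` with `max X₁ = j`. -/
def upperPart (X : Finset ℤ) (j : ℤ) : Finset ℤ := X.filter (j < ·)

/-- The product `u_{X₁}(x_{X₁}) u_{X₂}(x_{X₂})`, `X = X₁ ∪ X₂`, `max X₁ = j`. -/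
def cutProduct {X : Finset ℤ} (j : ℤ) (u : (B : Finset ℤ) → Phase B → ℝ) (x : Phase X) : ℝ :=
  u (lowerPart X j) (proj (Finset.filter_subset _ _) x) *
    u (upperPart X j) (proj (Finset.filter_subset _ _) x)

/-- Classical solutions of the Liouville hierarchy with initial data `u₀`: families of functions
`u_X(t, x)` which are continuously differentiable on `ℝ × allowed` and satisfy there
`∂u_X/∂t = L*_X u_X + ∑_{X = X₁ ∪ X₂} L*_int(max X₁, min X₂) u_{X₁} u_{X₂}`. -/
def IsClassicalSolution (σ : ℝ) (Φ : ℝ → ℝ) (u₀ : (X : Finset ℤ) → Phase X → ℝ)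
    (u : ℝ → (X : Finset ℤ) → Phase X → ℝ) : Prop :=
  ∀ X, IsBlock X →
    (∀ x ∈ allowed σ X, u 0 X x = u₀ X x) ∧
    ContDiffOn ℝ 1 (fun z : ℝ × Phase X => u z.1 X z.2) (Set.univ ×ˢ allowed σ X) ∧
    ∀ t, ∀ x ∈ allowed σ X,
      HasDerivAt (fun s => u s X x)
        (liouvilleOp Φ X (u t X) x +
          ∑ j : X, ∑ k : X, if (k : ℤ) = next j then Lint Φ j k (cutProduct j (u t)) x else 0) t

/-- Continuously differentiable functions with compact support in the allowed phase points. -/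
def IsTestFunction (σ : ℝ) (X : Finset ℤ) (φ : Phase X → ℝ) : Prop :=
  ContDiff ℝ 1 φ ∧ HasCompactSupport φ ∧ tsupport φ ⊆ allowed σ X

/-- Weak solutions of the Liouville hierarchy with initial data `g₀`: families of continuous
curves in the spaces of integrable functions which satisfy the hierarchy after multiplication by
a test function and integration over the allowed phase points; the formal adjoints of `L*_X` and
`L*_int(j, k)` are `-L*_X` and `-L*_int(j, k)`. -/
def IsWeakSolution (σ : ℝ) (Φ : ℝ → ℝ) (g₀ : (X : Finset ℤ) → L1 σ X)
    (g : ℝ → (X : Finset ℤ) → L1 σ X) : Prop :=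
  ∀ X, IsBlock X →
    g 0 X = g₀ X ∧
    Continuous (fun t => g t X) ∧
    ∀ φ, IsTestFunction σ X φ → ∀ t,
      HasDerivAt (fun s => ∫ x in allowed σ X, g s X x * φ x)
        (-(∫ x in allowed σ X, g t X x * liouvilleOp Φ X φ x) -
          ∑ j : X, ∑ k : X, if (k : ℤ) = next j then
            ∫ x in allowed σ X, cutProduct j (fun B => g t B) x * Lint Φ j k φ x else 0) t

/-- Infinitely differentiable functions with compact supports in the allowed phase points. -/
def IsSmoothData (σ : ℝ) (f₀ : (X : Finset ℤ) → Phase X → ℝ) : Prop :=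
  ∀ X, IsBlock X → ContDiff ℝ ∞ (f₀ X) ∧ HasCompactSupport (f₀ X) ∧ tsupport (f₀ X) ⊆ allowed σ X

/-- `g₀ X` is the class of the function `f₀ X` for every block `X`. -/
def Represents {σ : ℝ} (g₀ : (X : Finset ℤ) → L1 σ X) (f₀ : (X : Finset ℤ) → Phase X → ℝ) :
    Prop :=
  ∀ X, IsBlock X → g₀ X =ᵐ[phaseMeasure σ X] f₀ X

/-! ### Generating operators -/

/-- A family of generating operators: for every ordered partition `P` of `X` with parts
`X₁, …, Xₙ` a bounded operator `𝔄ₙ(t, {X₁}, …, {Xₙ})`, which acts on functions of the variables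
of all particles of `X`. -/
abbrev GeneratingOperators (σ : ℝ) : Type :=
  ℝ → (X : Finset ℤ) → (P : Finpartition X) → (L1Parts σ P →L[ℝ] L1 σ X)

/-- The expansions
`g_X(t) = ∑_{P : X = ⋃ X_i} 𝔄_{|P|}(t, {X₁}, …, {X_{|P|}}) ∏_{X_i ∈ P} g₀_{X_i}(x_{X_i})`. -/
def expansion {σ : ℝ} (A : GeneratingOperators σ) (g₀ : (X : Finset ℤ) → L1 σ X) (t : ℝ)
    (X : Finset ℤ) : L1 σ X :=
  ∑ P ∈ orderedPartitions X, A t X P (prodL1 P g₀)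

/-- The generating operators are the cumulants of the groups of operators:
`𝔄_{|P|}(t, {X₁}, …, {X_{|P|}}) = ∑_Q (-1)^{|Q| - 1} ∏_{C ∈ Q} S*_C(t)`, where the sum is over the
ordered partitions `Q` of the set of clusters `({X₁}, …, {X_{|P|}})`. -/
def AreCumulants {σ : ℝ} (Φ : ℝ → ℝ) (A : GeneratingOperators σ) : Prop :=
  ∀ t X, IsBlock X → ∀ P ∈ orderedPartitions X, ∀ F : L1Parts σ P,
    A t X P F =ᵐ[phaseMeasure σ X] fun x =>
      ∑ Q ∈ clusterPartitions P, (-1 : ℝ) ^ (Q.parts.card - 1) * groupProduct σ Φ Q t F x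

/-- The generating operators solve the cluster expansions
`S*_X(t) = ∑_Q ∏_{C ∈ Q} 𝔄(t, C)`, where the sum is over the ordered partitions `Q` of the set of
clusters `({X₁}, …, {Xₙ})`, and a group `C` of clusters contributes the generating operator of
the clusters contained in it, acting on the variables `x_C`. A product of operators in separate
groups of variables is given by its values on the products `∏ f_{X_i}(x_{X_i})`, whose linear
span is dense. For one-particle clusters `X_i` these are the cluster expansions of the index set
`X` itself. -/
def SolveClusterExpansions {σ : ℝ} (Φ : ℝ → ℝ) (A : GeneratingOperators σ) : Prop :=
  ∀ t X, IsBlock X → ∀ P ∈ orderedPartitions X, ∀ f : (B : Finset ℤ) → L1 σ B,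
    liouvilleGroup σ Φ X t (prodFun P fun B => f B) =ᵐ[phaseMeasure σ X] fun x =>
      ∑ Q ∈ clusterPartitions P, ∏ C : Q.parts,
        A t C (P.restrict (Q.le C.2)) (prodL1 (P.restrict (Q.le C.2)) f) (proj (Q.le C.2) x)

/-- The family `g` is a double sequence `(g_{n₁+n₂})`: the function of the block `X` depends only
on the numbers of negative and of positive labels in `X`, up to the relabelling of variables. -/
def IsDoubleSequence {σ : ℝ} (g : (X : Finset ℤ) → L1 σ X) : Prop :=
  ∀ X Y, IsBlock X → IsBlock Y → ∀ e : X ≃o Y, (∀ i : X, 0 < (i : ℤ) ↔ 0 < (e i : ℤ)) →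
    g X =ᵐ[phaseMeasure σ X] fun x => g Y fun i => x (e.symm i)

end

end NearestNeighbour

open NearestNeighbour

/-! Algebra. At a fixed phase point a family of functions of blocks becomes a numerical set function
b. The maps b ↦ ∑_P ∏ b_B and b ↦ ∑_P (-1)^{|P|-1} ∏ b_B, summed over the ordered partitions of a
block, are inverse to each other (`signedSum_partitionSum`, `partitionSum_signedSum`). This is why
the cumulants solve the cluster expansions. The expansions are triangular in the number of
particles, because the coarsest partition contributes the generating operator itself and all other
terms involve smaller blocks. So they have no other solution.

Existence. For the cumulants, interchanging the sums over P and Q in the expansion (2) gives ∑_Q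
(-1)^{|Q|-1} ∏_{C ∈ Q} S*_C(t) G_C, where G_C = ∑_P ∏ g⁰_B over the partitions of C
(`expansion_cumulant_ae_eq`). The term of Q is transported by the flow in which the parts of Q move
independently, and its generator is L*_X without the interactions across the cuts of Q. On the other
side, the product g_{X₁} g_{X₂} for the cut after j collects exactly the terms of those Q that have
this cut, with the opposite sign, because one factor -1 is lost (`cutProduct_evolved`). Hence the
quadratic term of the hierarchy restores exactly the missing interactions. At t = 0 the inversion
formula returns the data.

Uniqueness. The quadratic terms in the equation of X involve only strictly smaller blocks. By
induction on the number of particles, the difference of two solutions satisfies the linear Liouville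
equation with zero data. It vanishes by pairing with a test function transported backwards
(`IsGlobalFlow.eq_zero_of_weak`), or, for classical solutions, by constancy along trajectories.

Converse. If the data vanish on all blocks except the parts of one partition P, only the term of P
survives in (2). Products of smooth compactly supported functions span a dense subspace
(`eq_top_of_containsSmoothProducts`), so expansions of smooth data determine bounded generating
operators (`agreeOnBlocks_of_expansion_eq`). Comparison with the solution given by the cumulants
then turns each statement about solutions into the statement that the operators are the cumulants.

Dynamics. All this needs a global, continuously differentiable, measure preserving flow on an open
set. Energy conservation and the hard core confine trajectories to compact sets for bounded times,
and the Hamilton field is divergence free. Double sequences are preserved because an order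
isomorphism of blocks respects neighbours and therefore intertwines the flows. -/

namespace NearestNeighbour

/-! ### Global solutions of ordinary differential equations -/

section Flow

variable {E : Type*} [NormedAddCommGroup E] [NormedSpace ℝ E]

/-- Two-sided Grönwall estimate. -/
lemma norm_le_of_norm_deriv_le {f f' : ℝ → E} {δ K ε T : ℝ} (hK : 1 ≤ K) (hδ : 0 ≤ δ) (hε : 0 ≤ ε)
    (hf : ∀ t ∈ Icc (-T) T, HasDerivWithinAt f (f' t) (Icc (-T) T) t)
    (h0 : ‖f 0‖ ≤ δ) (hb : ∀ t ∈ Icc (-T) T, ‖f' t‖ ≤ K * ‖f t‖ + ε) :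
    ∀ t ∈ Icc (-T) T, ‖f t‖ ≤ (δ + ε) * Real.exp (K * T) := by
  have key : ∀ g g' : ℝ → E, (∀ t ∈ Icc (-T) T, HasDerivWithinAt g (g' t) (Icc (-T) T) t) →
      ‖g 0‖ ≤ δ → (∀ t ∈ Icc (-T) T, ‖g' t‖ ≤ K * ‖g t‖ + ε) → ∀ t ∈ Icc 0 T,
      ‖g t‖ ≤ (δ + ε) * Real.exp (K * T) := by
    intro g g' hg hg0 hgb t ht
    have hT : 0 ≤ T := ht.1.trans ht.2
    have sub : ∀ s, s ∈ Icc 0 T → s ∈ Icc (-T) T := fun s hs => ⟨by linarith [hs.1], hs.2⟩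
    have := norm_le_gronwallBound_of_norm_deriv_right_le (f := g) (f' := g') (δ := δ) (K := K)
      (ε := ε) (a := 0) (b := T)
      (fun s hs => ((hg s (sub s hs)).continuousWithinAt).mono fun s hs => sub s hs)
      (fun s hs => by
        have h1 := hg s (sub s ⟨hs.1, hs.2.le⟩)
        have hst : Icc s T ⊆ Icc (-T) T := fun r hr => ⟨by linarith [hr.1, hs.1], hr.2⟩
        have h2 := h1.mono hst
        exact h2.mono_of_mem_nhdsWithin (Icc_mem_nhdsGE_of_mem ⟨le_refl _, hs.2⟩))
      hg0 (fun s hs => hgb s (sub s ⟨hs.1, hs.2.le⟩)) t ht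
    refine this.trans ?_
    rw [gronwallBound_of_K_ne_0 (by linarith)]
    have h1 : Real.exp (K * (t - 0)) ≤ Real.exp (K * T) := by
      apply Real.exp_le_exp.2; nlinarith [ht.1, ht.2]
    have h2 : 1 ≤ Real.exp (K * (t - 0)) := by
      apply Real.one_le_exp; nlinarith [ht.1, ht.2]
    have h3 : ε / K ≤ ε := div_le_self hε hK
    have h4 : ε / K * (Real.exp (K * (t - 0)) - 1) ≤ ε * Real.exp (K * T) :=
      mul_le_mul h3 (by linarith) (by linarith) hε
    have h5 := mul_le_mul_of_nonneg_left h1 hδ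
    calc _ ≤ δ * Real.exp (K * T) + ε * Real.exp (K * T) := add_le_add h5 h4
      _ = _ := by ring
  intro t ht
  rcases le_total 0 t with h | h
  · exact key f f' hf h0 hb t ⟨h, ht.2⟩
  · have hm : MapsTo (fun s : ℝ => -s) (Icc (-T) T) (Icc (-T) T) := fun s hs =>
      ⟨by linarith [hs.2], by linarith [hs.1]⟩
    have := key (fun s => f (-s)) (fun s => -f' (-s)) (fun s hs => by
      have h1 := (hf (-s) (hm hs)).scomp s (hasDerivAt_neg s).hasDerivWithinAt hm
      simpa [Function.comp_def] using h1) (by simpa using h0)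
      (fun s hs => by simpa using hb (-s) (hm hs)) (-t) ⟨by linarith, by linarith [ht.1]⟩
    simpa using this

/-- A bounded Lipschitz field has a global flow. -/
lemma exists_flow_of_lipschitz [CompleteSpace E] {w : E → E} {K L : NNReal} (hK : LipschitzWith K w)
    (hL : ∀ x, ‖w x‖ ≤ L) :
    ∃ φ : ℝ → E → E, ∀ x, φ 0 x = x ∧ ∀ t, HasDerivAt (fun s => φ s x) (w (φ t x)) t := by
  have loc : ∀ (x : E) (n : ℕ), ∃ α : ℝ → E, α 0 = x ∧
      ∀ t ∈ Ioo (-(n + 1 : ℝ)) (n + 1), HasDerivAt α (w (α t)) t := by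
    intro x n
    have h0 : (0 : ℝ) ∈ Icc (-(n + 1 : ℝ)) (n + 1) := ⟨by linarith [n.cast_nonneg (α := ℝ)],
      by positivity⟩
    -- The speed is at most `L`, so during time `n + 1` a solution cannot leave the ball of radius
    -- `L * (n + 1)`; the local existence theorem therefore covers the whole interval.
    have hp : IsPicardLindelof (fun _ => w) (tmin := -(n + 1 : ℝ)) (tmax := n + 1) ⟨0, h0⟩ x
        (L * (n + 1)) 0 L K := IsPicardLindelof.of_time_independent (fun y _ => hL y)
          hK.lipschitzOnWith (by simp)
    obtain ⟨α, hα, h⟩ := hp.exists_eq_forall_mem_Icc_hasDerivWithinAt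
      (x := x) (Metric.mem_closedBall_self (by simp))
    exact ⟨α, hα, fun t ht => (h t ⟨ht.1.le, ht.2.le⟩).hasDerivAt (Icc_mem_nhds ht.1 ht.2)⟩
  choose α hα0 hα using loc
  have agree : ∀ x (m n : ℕ), m ≤ n → EqOn (α x m) (α x n) (Ioo (-(m + 1 : ℝ)) (m + 1)) := by
    intro x m n hmn
    have hmn' : (m : ℝ) ≤ n := by exact_mod_cast hmn
    refine ODE_solution_unique_of_mem_Ioo (v := fun _ => w) (s := fun _ => univ) (K := K) (t₀ := 0)
      (fun t _ => hK.lipschitzOnWith)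
      ⟨by linarith [m.cast_nonneg (α := ℝ)], by positivity⟩ (fun t ht => ⟨hα x m t ht, trivial⟩)
      (fun t ht => ⟨hα x n t ⟨by linarith [ht.1], by linarith [ht.2]⟩, trivial⟩) ?_
    rw [hα0, hα0]
  -- The index varies with `t`, but the local solutions agree where both are defined, so near `t` it
  -- may be replaced by the fixed index `⌈|t|⌉₊ + 1`.
  refine ⟨fun t x => α x ⌈|t|⌉₊ t, fun x => ⟨hα0 x _, fun t => ?_⟩⟩
  set n := ⌈|t|⌉₊ + 1
  have hn : |t| + 1 ≤ n := by
    have := Nat.le_ceil |t|; push_cast [n]; linarith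
  have hev : (fun s => α x ⌈|s|⌉₊ s) =ᶠ[𝓝 t] α x n := by
    filter_upwards [Ioo_mem_nhds (sub_one_lt t) (lt_add_one t)] with s hs
    have hs1 : |s| < |t| + 1 := by
      have : |s - t| < 1 := abs_lt.2 ⟨by linarith [hs.1], by linarith [hs.2]⟩
      have h2 := abs_sub_abs_le_abs_sub s t
      linarith
    have hle : ⌈|s|⌉₊ ≤ n := Nat.ceil_le.2 (by linarith)
    refine agree x _ n hle ?_
    have := Nat.le_ceil |s|
    have h3 := abs_le.1 (le_refl |s|)
    exact ⟨by linarith [h3.1], by linarith [h3.2]⟩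
  have h3 := abs_le.1 (le_refl |t|)
  have := hα x n t ⟨by linarith [h3.1], by linarith [h3.2]⟩
  have h4 : α x ⌈|t|⌉₊ t = α x n t := hev.eq_of_nhds
  rw [← h4] at this
  exact this.congr_of_eventuallyEq hev

lemma flow_unique_of_lipschitz {w : E → E} {K : NNReal} (hK : LipschitzWith K w) {f g : ℝ → E}
    {a b : ℝ} (h0 : (0 : ℝ) ∈ Ioo a b) (hf : ∀ t ∈ Ioo a b, HasDerivAt f (w (f t)) t)
    (hg : ∀ t ∈ Ioo a b, HasDerivAt g (w (g t)) t) (h : f 0 = g 0) : EqOn f g (Ioo a b) :=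
  ODE_solution_unique_of_mem_Ioo (v := fun _ => w) (s := fun _ => univ) (K := K) (t₀ := 0)
    (fun _ _ => hK.lipschitzOnWith) h0 (fun t ht => ⟨hf t ht, trivial⟩)
    (fun t ht => ⟨hg t ht, trivial⟩) h

/-- The flow of `w` with its defining properties. -/
def IsFlow (w : E → E) (φ : ℝ → E → E) : Prop :=
  ∀ x, φ 0 x = x ∧ ∀ t, HasDerivAt (fun s => φ s x) (w (φ t x)) t

lemma IsFlow.group {w : E → E} {φ : ℝ → E → E} {K : NNReal} (hφ : IsFlow w φ)
    (hK : LipschitzWith K w) (s t : ℝ) (x : E) : φ (s + t) x = φ s (φ t x) := by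
  have h1 : ∀ r, HasDerivAt (fun s => φ (s + t) x) (w (φ (r + t) x)) r := fun r =>
    ((hφ x).2 (r + t)).comp_add_const r t
  exact flow_unique_of_lipschitz (a := -|s| - 1) (b := |s| + 1) hK
    ⟨by linarith [abs_nonneg s], by linarith [abs_nonneg s]⟩ (fun r _ => h1 r)
    (fun r _ => (hφ (φ t x)).2 r) (by simp [(hφ (φ t x)).1])
    ⟨by linarith [neg_abs_le s], by linarith [le_abs_self s]⟩

lemma IsFlow.norm_sub_le {w : E → E} {φ : ℝ → E → E} {K : NNReal} (hφ : IsFlow w φ)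
    (hK : LipschitzWith K w) {T : ℝ} (x y : E) {t : ℝ} (ht : t ∈ Icc (-T) T) :
    ‖φ t x - φ t y‖ ≤ ‖x - y‖ * Real.exp ((K + 1) * T) := by
  -- The Grönwall estimate asks for a constant at least 1, hence `K + 1` here and below.
  have := norm_le_of_norm_deriv_le (f := fun t => φ t x - φ t y)
    (f' := fun t => w (φ t x) - w (φ t y)) (K := K + 1) (δ := ‖x - y‖) (ε := 0) (T := T)
    (by linarith [K.coe_nonneg])
    (norm_nonneg _) le_rfl (fun t _ => (((hφ x).2 t).sub ((hφ y).2 t)).hasDerivWithinAt)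
    (by simp [(hφ x).1, (hφ y).1]) (fun t _ => by
      have := hK.norm_sub_le (φ t x) (φ t y)
      have h2 := norm_nonneg (φ t x - φ t y)
      linarith) t ht
  simpa using this

/-- The variational equation along the flow of a field with bounded derivative, for short times. -/
lemma IsFlow.exists_variational [CompleteSpace E] {w : E → E} {φ : ℝ → E → E} (hφ : IsFlow w φ)
    (hw : ContDiff ℝ 1 w) {M : NNReal} (hM : ∀ x, ‖fderiv ℝ w x‖ ≤ M) {T : ℝ} (hT : 0 < T)
    (hMT : M * 2 * T ≤ 1) :
    ∃ J : ℝ → E → (E →L[ℝ] E), ∀ x, J 0 x = ContinuousLinearMap.id ℝ E ∧ ∀ t ∈ Icc (-T) T,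
      HasDerivWithinAt (fun s => J s x) ((fderiv ℝ w (φ t x)).comp (J t x)) (Icc (-T) T) t := by
  have loc : ∀ x, ∃ α : ℝ → (E →L[ℝ] E), α 0 = ContinuousLinearMap.id ℝ E ∧ ∀ t ∈ Icc (-T) T,
      HasDerivWithinAt α ((fderiv ℝ w (φ t x)).comp (α t)) (Icc (-T) T) t := by
    intro x
    have h0 : (0 : ℝ) ∈ Icc (-T) T := ⟨by linarith, hT.le⟩
    -- The right-hand side is linear in `A` and so not bounded. On the unit ball about the identity
    -- `‖A‖ ≤ 2`, the speed is at most `2 * M`, and the time must be short enough to stay in that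
    -- ball.
    have hp : IsPicardLindelof (fun t (A : E →L[ℝ] E) => (fderiv ℝ w (φ t x)).comp A)
        (tmin := -T) (tmax := T) ⟨0, h0⟩ (ContinuousLinearMap.id ℝ E) 1 0 (M * 2) M := by
      refine ⟨fun t _ => ?_, fun A _ => ?_, fun t _ A hA => ?_, ?_⟩
      · refine LipschitzOnWith.of_dist_le_mul fun A _ B _ => ?_
        rw [dist_eq_norm, dist_eq_norm, ← ContinuousLinearMap.comp_sub]
        exact (ContinuousLinearMap.opNorm_comp_le _ _).trans
          (mul_le_mul_of_nonneg_right (hM _) (norm_nonneg _))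
      · have h1 : Continuous fun t => φ t x :=
          continuous_iff_continuousAt.2 fun t => ((hφ x).2 t).continuousAt
        have h2 : Continuous fun t => fderiv ℝ w (φ t x) :=
          (hw.continuous_fderiv (by simp)).comp h1
        exact (h2.clm_comp continuous_const).continuousOn
      · have h1 : ‖A‖ ≤ 2 := by
          have h2 : ‖A - ContinuousLinearMap.id ℝ E‖ ≤ 1 := by
            simpa [dist_eq_norm] using hA
          calc ‖A‖ = ‖(A - ContinuousLinearMap.id ℝ E) + ContinuousLinearMap.id ℝ E‖ := by simp
            _ ≤ 1 + 1 := (norm_add_le _ _).trans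
              (add_le_add h2 ContinuousLinearMap.norm_id_le)
            _ = 2 := by norm_num
        exact (ContinuousLinearMap.opNorm_comp_le _ _).trans (by
          push_cast; exact mul_le_mul (hM _) h1 (norm_nonneg _) M.coe_nonneg)
      · simpa using hMT
    exact hp.exists_eq_forall_mem_Icc_hasDerivWithinAt (Metric.mem_closedBall_self (by simp))
  choose α hα using loc
  exact ⟨fun t x => α x t, fun x => hα x⟩

/-- The remainder φ_t(x + h) - φ_t(x) - J_t h starts at zero and satisfies the linearized equation
up to the Taylor remainder of `w`. That remainder is o(‖h‖) uniformly along the trajectory, since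
the derivative of `w` is uniformly continuous; Grönwall carries this over to time `t`. -/
lemma IsFlow.hasFDerivAt [CompleteSpace E] {w : E → E} {φ : ℝ → E → E} {K : NNReal}
    (hφ : IsFlow w φ) (hK : LipschitzWith K w)
    (hw : ContDiff ℝ 1 w) (hu : UniformContinuous (fderiv ℝ w)) {T : ℝ} {J : ℝ → E → (E →L[ℝ] E)}
    (hJ : ∀ x, J 0 x = ContinuousLinearMap.id ℝ E ∧ ∀ t ∈ Icc (-T) T,
      HasDerivWithinAt (fun s => J s x) ((fderiv ℝ w (φ t x)).comp (J t x)) (Icc (-T) T) t)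
    {t : ℝ} (ht : t ∈ Icc (-T) T) (x : E) : HasFDerivAt (φ t) (J t x) x := by
  have hT : 0 ≤ T := by linarith [ht.1, ht.2]
  have hM : ∀ x, ‖fderiv ℝ w x‖ ≤ K := fun x => norm_fderiv_le_of_lipschitz ℝ hK
  rw [hasFDerivAt_iff_isLittleO_nhds_zero, Asymptotics.isLittleO_iff]
  intro c hc
  set C := Real.exp ((K + 1) * T) with hC
  have hCpos : 0 < C := Real.exp_pos _
  -- One factor `C` is lost in ‖φ_s(x + h) - φ_s(x)‖ ≤ C‖h‖ and a second one in the Grönwall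
  -- estimate of the remainder.
  obtain ⟨δ, hδ, hδ'⟩ := Metric.uniformContinuous_iff.1 hu (c / (C * C)) (by positivity)
  have hball : ∀ᶠ h : E in 𝓝 0, ‖h‖ < δ / C := by
    have := Metric.ball_mem_nhds (0 : E) (div_pos hδ hCpos)
    filter_upwards [this] with h hh
    simpa using hh
  filter_upwards [hball] with h hh
  have hhC : ‖h‖ * C < δ := by rwa [lt_div_iff₀ hCpos] at hh
  have main := norm_le_of_norm_deriv_le (f := fun t => φ t (x + h) - φ t x - J t x h)
    (f' := fun t => w (φ t (x + h)) - w (φ t x) - (fderiv ℝ w (φ t x)).comp (J t x) h)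
    (K := K + 1) (δ := 0) (ε := c / (C * C) * (‖h‖ * C)) (T := T) (by linarith [K.coe_nonneg])
    le_rfl (by positivity)
    (fun s hs => by
      have h1 := ((hφ (x + h)).2 s).hasDerivWithinAt (s := Icc (-T) T)
      have h2 := ((hφ x).2 s).hasDerivWithinAt (s := Icc (-T) T)
      have h3 := ((hJ x).2 s hs).clm_apply (hasDerivWithinAt_const s (Icc (-T) T) h)
      have h4 := (h1.sub h2).sub h3
      simp only [map_zero, add_zero] at h4
      exact h4)
    (by simp [(hφ (x + h)).1, (hφ x).1, (hJ x).1])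
    (fun s hs => by
      have hd : ‖φ s (x + h) - φ s x‖ ≤ ‖h‖ * C := by
        simpa using hφ.norm_sub_le hK (x + h) x hs
      have hb : ‖w (φ s (x + h)) - w (φ s x) -
          (fderiv ℝ w (φ s x)) (φ s (x + h) - φ s x)‖ ≤
          c / (C * C) * ‖φ s (x + h) - φ s x‖ := by
        refine Convex.norm_image_sub_le_of_norm_fderiv_le' (𝕜 := ℝ)
          (s := Metric.ball (φ s x) δ) (fun y _ => (hw.differentiable (by simp)) y)
          (fun y hy => ?_) (convex_ball _ _) (Metric.mem_ball_self hδ) ?_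
        · have := hδ' (a := y) (b := φ s x) hy
          rw [dist_eq_norm] at this
          exact this.le
        · rw [Metric.mem_ball, dist_eq_norm]; linarith
      have e : w (φ s (x + h)) - w (φ s x) - (fderiv ℝ w (φ s x)).comp (J s x) h =
          (w (φ s (x + h)) - w (φ s x) - (fderiv ℝ w (φ s x)) (φ s (x + h) - φ s x)) +
          (fderiv ℝ w (φ s x)) (φ s (x + h) - φ s x - J s x h) := by
        simp only [ContinuousLinearMap.comp_apply, map_sub]; abel
      rw [e]
      have h2 : ‖(fderiv ℝ w (φ s x)) (φ s (x + h) - φ s x - J s x h)‖ ≤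
          K * ‖φ s (x + h) - φ s x - J s x h‖ :=
        (ContinuousLinearMap.le_opNorm _ _).trans
          (mul_le_mul_of_nonneg_right (hM _) (norm_nonneg _))
      have h3 : c / (C * C) * ‖φ s (x + h) - φ s x‖ ≤ c / (C * C) * (‖h‖ * C) :=
        mul_le_mul_of_nonneg_left hd (by positivity)
      have h4 := norm_nonneg (φ s (x + h) - φ s x - J s x h)
      refine (norm_add_le _ _).trans ?_
      linarith) t ht
  have : (0 + c / (C * C) * (‖h‖ * C)) * Real.exp ((K + 1) * T) = c * ‖h‖ := by
    rw [← hC]; field_simp; ring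
  rw [this] at main
  exact main

/-- In time, `J` is differentiable at fixed `x`. In `x` it is continuous uniformly in time, by
Grönwall applied to J(y) - J(x). Together these give joint continuity. -/
lemma IsFlow.continuousOn_variational {w : E → E} {φ : ℝ → E → E} {K : NNReal}
    (hφ : IsFlow w φ) (hK : LipschitzWith K w)
    (hu : UniformContinuous (fderiv ℝ w)) {T : ℝ} {J : ℝ → E → (E →L[ℝ] E)}
    (hJ : ∀ x, J 0 x = ContinuousLinearMap.id ℝ E ∧ ∀ t ∈ Icc (-T) T,
      HasDerivWithinAt (fun s => J s x) ((fderiv ℝ w (φ t x)).comp (J t x)) (Icc (-T) T) t) :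
    ContinuousOn (fun z : ℝ × E => J z.1 z.2) (Icc (-T) T ×ˢ univ) := by
  have hM : ∀ x, ‖fderiv ℝ w x‖ ≤ K := fun x => norm_fderiv_le_of_lipschitz ℝ hK
  set C := Real.exp ((K + 1) * T) with hC
  have hCpos : 0 < C := Real.exp_pos _
  have hbd : ∀ x, ∀ t ∈ Icc (-T) T, ‖J t x‖ ≤ C := by
    intro x t ht
    have := norm_le_of_norm_deriv_le (f := fun t => J t x)
      (f' := fun t => (fderiv ℝ w (φ t x)).comp (J t x)) (K := K + 1) (δ := 1) (ε := 0) (T := T)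
      (by linarith [K.coe_nonneg]) zero_le_one le_rfl (hJ x).2
      (by rw [(hJ x).1]; exact ContinuousLinearMap.norm_id_le) (fun s _ => by
        have h1 := (ContinuousLinearMap.opNorm_comp_le (fderiv ℝ w (φ s x)) (J s x)).trans
          (mul_le_mul_of_nonneg_right (hM _) (norm_nonneg _))
        linarith [norm_nonneg (J s x)]) t ht
    simpa using this
  rintro ⟨t, x⟩ ⟨ht, -⟩
  have hT : 0 ≤ T := by linarith [ht.1, ht.2]
  rw [Metric.continuousWithinAt_iff]
  intro ε hε
  obtain ⟨δ₁, hδ₁, h₁⟩ := Metric.continuousWithinAt_iff.1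
    ((hJ x).2 t ht).continuousWithinAt (ε / 2) (by positivity)
  obtain ⟨δ₂, hδ₂, h₂⟩ := Metric.uniformContinuous_iff.1 hu (ε / 3 / (C * C)) (by positivity)
  refine ⟨min δ₁ (δ₂ / C), lt_min hδ₁ (by positivity), ?_⟩
  rintro ⟨s, y⟩ ⟨hs, -⟩ hd
  rw [Prod.dist_eq, max_lt_iff, lt_min_iff, lt_min_iff] at hd
  have hyx : ‖y - x‖ * C < δ₂ := by
    rw [← lt_div_iff₀ hCpos, ← dist_eq_norm]; exact hd.2.2
  have main := norm_le_of_norm_deriv_le (f := fun t => J t y - J t x)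
    (f' := fun t => (fderiv ℝ w (φ t y)).comp (J t y) - (fderiv ℝ w (φ t x)).comp (J t x))
    (K := K + 1) (δ := 0) (ε := ε / 3 / (C * C) * C) (T := T) (by linarith [K.coe_nonneg])
    le_rfl (by positivity) (fun r hr => ((hJ y).2 r hr).sub ((hJ x).2 r hr))
    (by simp [(hJ y).1, (hJ x).1]) (fun r hr => by
      have e : (fderiv ℝ w (φ r y)).comp (J r y) - (fderiv ℝ w (φ r x)).comp (J r x) =
          (fderiv ℝ w (φ r y) - fderiv ℝ w (φ r x)).comp (J r y) +
          (fderiv ℝ w (φ r x)).comp (J r y - J r x) := by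
        ext v; simp
      rw [e]
      have hd : ‖φ r y - φ r x‖ ≤ ‖y - x‖ * C := hφ.norm_sub_le hK y x hr
      have h3 : ‖fderiv ℝ w (φ r y) - fderiv ℝ w (φ r x)‖ ≤ ε / 3 / (C * C) := by
        rw [← dist_eq_norm]
        exact (h₂ (by rw [dist_eq_norm]; linarith)).le
      have h4 := (ContinuousLinearMap.opNorm_comp_le (fderiv ℝ w (φ r y) - fderiv ℝ w (φ r x))
        (J r y)).trans (mul_le_mul h3 (hbd y r hr) (norm_nonneg _) (by positivity))
      have h5 := (ContinuousLinearMap.opNorm_comp_le (fderiv ℝ w (φ r x))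
        (J r y - J r x)).trans (mul_le_mul_of_nonneg_right (hM _) (norm_nonneg _))
      refine (norm_add_le _ _).trans ?_
      linarith [norm_nonneg (J r y - J r x)]) s hs
  have e : (0 + ε / 3 / (C * C) * C) * Real.exp ((K + 1) * T) = ε / 3 := by
    rw [← hC]; field_simp; ring
  rw [e, ← dist_eq_norm] at main
  calc dist (J s y) (J t x) ≤ dist (J s y) (J s x) + dist (J s x) (J t x) := dist_triangle _ _ _
    _ < ε / 3 + ε / 2 + ε / 6 := by linarith [h₁ hs hd.1.1]
    _ = ε := by ring

lemma contDiffOn_one_of_hasFDerivAt {F G : Type*} [NormedAddCommGroup F] [NormedSpace ℝ F]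
    [NormedAddCommGroup G] [NormedSpace ℝ G] {f : F → G} {f' : F → F →L[ℝ] G} {s : Set F}
    (hs : IsOpen s) (h : ∀ x ∈ s, HasFDerivAt f (f' x) x) (hc : ContinuousOn f' s) :
    ContDiffOn ℝ 1 f s := by
  have := (contDiffOn_succ_iff_fderiv_of_isOpen (𝕜 := ℝ) (f := f) (n := 0) hs).2
    ⟨fun x hx => (h x hx).differentiableAt.differentiableWithinAt, by simp, by
      rw [contDiffOn_zero]; exact hc.congr fun x hx => (h x hx).fderiv⟩
  simpa using this

/-- The flow of a compactly supported continuously differentiable field is continuously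
differentiable, and the derivative of its differential at time zero is that of the field. -/
lemma IsFlow.contDiff [CompleteSpace E] {w : E → E} {φ : ℝ → E → E} (hφ : IsFlow w φ)
    (hw : ContDiff ℝ 1 w) (hc : HasCompactSupport w) :
    ContDiff ℝ 1 (fun z : ℝ × E => φ z.1 z.2) ∧
      ∀ x, HasDerivAt (fun s => fderiv ℝ (φ s) x) (fderiv ℝ w x) 0 := by
  obtain ⟨K, hK⟩ := ContDiff.lipschitzWith_of_hasCompactSupport hc hw one_ne_zero
  have hM : ∀ x, ‖fderiv ℝ w x‖ ≤ K := fun x => norm_fderiv_le_of_lipschitz ℝ hK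
  have hu : UniformContinuous (fderiv ℝ w) :=
    (hc.fderiv ℝ).uniformContinuous_of_continuous (hw.continuous_fderiv (by simp))
  -- This length depends only on the Lipschitz constant and serves all starting points at once, so
  -- the short-time result can be iterated.
  set T : ℝ := 1 / (2 * (K + 1)) with hTdef
  have hT : 0 < T := by positivity
  have hMT : (K : ℝ) * 2 * T ≤ 1 := by
    rw [hTdef, mul_one_div, div_le_one (by positivity)]; linarith
  obtain ⟨J, hJ⟩ := hφ.exists_variational hw hM hT hMT
  have hd : ∀ t ∈ Icc (-T) T, ∀ x, HasFDerivAt (φ t) (J t x) x := fun t ht x =>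
    hφ.hasFDerivAt hK hw hu hJ ht x
  have hφc : Continuous fun z : ℝ × E => φ z.1 z.2 := by
    rw [continuous_iff_continuousAt]
    rintro ⟨t, x⟩
    rw [Metric.continuousAt_iff]
    intro ε hε
    obtain ⟨δ, hδ, h⟩ := Metric.continuousAt_iff.1 ((hφ x).2 t).continuousAt (ε / 2) (by positivity)
    set C := Real.exp ((K + 1) * (|t| + 1)) with hC
    have hCpos : 0 < C := Real.exp_pos _
    refine ⟨min (min δ 1) (ε / 2 / C), by positivity, ?_⟩
    rintro ⟨s, y⟩ hd
    rw [Prod.dist_eq, max_lt_iff, lt_min_iff, lt_min_iff, lt_min_iff] at hd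
    have hs : s ∈ Icc (-(|t| + 1)) (|t| + 1) := by
      have h1 := hd.1.1.2
      rw [Real.dist_eq, abs_lt] at h1
      exact ⟨by linarith [neg_abs_le t], by linarith [le_abs_self t]⟩
    have h2 := hφ.norm_sub_le hK y x hs
    rw [← hC, ← dist_eq_norm, ← dist_eq_norm] at h2
    have h3 : dist y x * C < ε / 2 := by rw [← lt_div_iff₀ hCpos]; exact hd.2.2
    calc dist (φ s y) (φ t x) ≤ dist (φ s y) (φ s x) + dist (φ s x) (φ t x) := dist_triangle _ _ _
      _ < ε / 2 + ε / 2 := by linarith [h hd.1.1.1]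
      _ = ε := by ring
  have hJc := hφ.continuousOn_variational hK hu hJ
  have hopen : ∀ S : ℝ, IsOpen (Ioo (-S) S ×ˢ (univ : Set E)) := fun S => isOpen_Ioo.prod isOpen_univ
  have hloc : ContDiffOn ℝ 1 (fun z : ℝ × E => φ z.1 z.2) (Ioo (-T) T ×ˢ univ) := by
    have hJc' : ContinuousOn (fun z : ℝ × E => J z.1 z.2) (Ioo (-T) T ×ˢ univ) :=
      hJc.mono (prod_mono_left Ioo_subset_Icc_self)
    have hwc : Continuous fun z : ℝ × E =>
        ContinuousLinearMap.toSpanSingleton ℝ (w (φ z.1 z.2)) :=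
      (ContinuousLinearMap.toSpanSingletonCLE (𝕜 := ℝ) (E := E)).continuous.comp
        (hw.continuous.comp hφc)
    refine contDiffOn_one_of_hasFDerivAt (hopen T)
      (f' := fun z => (ContinuousLinearMap.toSpanSingleton ℝ (w (φ z.1 z.2))).coprod (J z.1 z.2))
      (fun z hz => ?_) ?_
    · refine (hasStrictFDerivAt_uncurry_coprod (𝕜 := ℝ) (u := z) (f := φ)
        (f₁ := fun t x => ContinuousLinearMap.toSpanSingleton ℝ (w (φ t x))) (f₂ := J)
        ?_ ?_ ?_ ?_).hasFDerivAt
      · exact Eventually.of_forall fun v => ((hφ v.2).2 v.1).hasFDerivAt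
      · filter_upwards [(hopen T).mem_nhds hz] with v hv
        exact hd v.1 (Ioo_subset_Icc_self hv.1) v.2
      · exact hwc.continuousAt
      · exact hJc'.continuousAt ((hopen T).mem_nhds hz)
    · simp only [← ContinuousLinearMap.comp_fst_add_comp_snd]
      exact (hwc.continuousOn.clm_comp continuousOn_const).add
        (hJc'.clm_comp continuousOn_const)
  -- The group law extends regularity from short times to all times: the time t is split as t/(n+2),
  -- which is short, plus t(n+1)/(n+2), which the induction hypothesis covers.
  have hall : ∀ n : ℕ, ContDiffOn ℝ 1 (fun z : ℝ × E => φ z.1 z.2)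
      (Ioo (-((n + 1 : ℝ) * T)) ((n + 1) * T) ×ˢ univ) := by
    intro n
    induction n with
    | zero => simpa using hloc
    | succ n ih =>
      have e : (fun z : ℝ × E => φ z.1 z.2) = fun z : ℝ × E =>
          (fun z : ℝ × E => φ z.1 z.2) (z.1 / (n + 2), (fun z : ℝ × E => φ z.1 z.2)
            (z.1 * ((n + 1) / (n + 2)), z.2)) := by
        funext z
        simp only
        rw [← hφ.group hK]
        congr 1
        field_simp
        ring
      have hn : (0 : ℝ) < n + 2 := by positivity
      rw [e]
      refine hloc.comp (ContDiffOn.prodMk (by fun_prop) (ih.comp (by fun_prop) ?_)) ?_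
      · rintro ⟨t, x⟩ ⟨ht, -⟩
        simp only [Nat.cast_add, Nat.cast_one] at ht
        refine ⟨⟨?_, ?_⟩, trivial⟩
        · simp only [← mul_div_assoc]
          rw [lt_div_iff₀ hn]; nlinarith [ht.1, ht.2]
        · simp only [← mul_div_assoc]
          rw [div_lt_iff₀ hn]; nlinarith [ht.1, ht.2]
      · rintro ⟨t, x⟩ ⟨ht, -⟩
        simp only [Nat.cast_add, Nat.cast_one] at ht
        refine ⟨⟨?_, ?_⟩, trivial⟩
        · simp only
          rw [lt_div_iff₀ hn]; nlinarith [ht.1, ht.2]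
        · simp only
          rw [div_lt_iff₀ hn]; nlinarith [ht.1, ht.2]
  refine ⟨contDiff_iff_contDiffAt.2 fun z => ?_, fun x => ?_⟩
  · obtain ⟨n, hn⟩ := exists_nat_gt (|z.1| / T)
    have h1 : |z.1| < n * T := by rwa [div_lt_iff₀ hT] at hn
    have h2 := abs_lt.1 h1
    exact (hall n).contDiffAt ((isOpen_Ioo.prod isOpen_univ).mem_nhds
      ⟨⟨by nlinarith [h2.1], by nlinarith [h2.2]⟩, trivial⟩)
  · have h0 : (0 : ℝ) ∈ Icc (-T) T := ⟨by linarith, hT.le⟩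
    have h1 := ((hJ x).2 0 h0).hasDerivAt (Icc_mem_nhds (by linarith) hT)
    rw [(hφ x).1, (hJ x).1, ContinuousLinearMap.comp_id] at h1
    refine h1.congr_of_eventuallyEq ?_
    filter_upwards [Icc_mem_nhds (neg_lt_zero.2 hT) hT] with t ht
    exact (hd t ht x).fderiv

end Flow

end NearestNeighbour


namespace NearestNeighbour

/-! ### Global flows of continuously differentiable fields on an open set, and Liouville's theorem.
-/

section OpenFlow

variable {E : Type*} [NormedAddCommGroup E] [NormedSpace ℝ E] [FiniteDimensional ℝ E]

/-- Multiplication by `χ` replaces a field that is regular only on `U` by a compactly supported,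
hence Lipschitz, field without changing it near `K`. -/
lemma exists_cutoff {K U : Set E} (hK : IsCompact K) (hU : IsOpen U) (hKU : K ⊆ U) :
    ∃ χ : E → ℝ, ContDiff ℝ ∞ χ ∧ HasCompactSupport χ ∧ tsupport χ ⊆ U ∧
      (∀ᶠ x in 𝓝ˢ K, χ x = 1) ∧ ∀ x, χ x ∈ Icc (0 : ℝ) 1 := by
  have : ProperSpace E := FiniteDimensional.proper_real E
  obtain ⟨L, hL, hKL, hLU⟩ := exists_compact_between hK hU hKU
  obtain ⟨f, h1, h2, h3⟩ := exists_contMDiffMap_one_nhds_of_subset_interior (n := ⊤)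
    (modelWithCornersSelf ℝ E) (s := K) (t := L) hK.isClosed hKL
  have hs : tsupport f ⊆ L := closure_minimal
    (fun x hx => by by_contra h; exact hx (h2 x h)) hL.isClosed
  exact ⟨f, f.contMDiff.contDiff, hL.of_isClosed_subset (isClosed_tsupport _) hs,
    hs.trans hLU, h1, h3⟩

omit [FiniteDimensional ℝ E] in
lemma contDiff_of_contDiffOn_of_tsupport_subset {F : Type*} [NormedAddCommGroup F]
    [NormedSpace ℝ F] {n : WithTop ℕ∞} {f : E → F} {U : Set E}
    (hU : IsOpen U) (hf : ContDiffOn ℝ n f U) (hs : tsupport f ⊆ U) : ContDiff ℝ n f := by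
  rw [contDiff_iff_contDiffAt]
  intro x
  by_cases hx : x ∈ U
  · exact hf.contDiffAt (hU.mem_nhds hx)
  · have : f =ᶠ[𝓝 x] fun _ => 0 := by
      have h : x ∈ (tsupport f)ᶜ := fun h => hx (hs h)
      filter_upwards [(isClosed_tsupport f).isOpen_compl.mem_nhds h] with y hy
      exact image_eq_zero_of_notMem_tsupport hy
    exact contDiffAt_const.congr_of_eventuallyEq this

omit [FiniteDimensional ℝ E] in
lemma contDiff_cutoff_smul {v : E → E} {χ : E → ℝ} {U : Set E} (hU : IsOpen U)
    (hv : ContDiffOn ℝ 1 v U) (hχ : ContDiff ℝ ∞ χ) (hχU : tsupport χ ⊆ U) :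
    ContDiff ℝ 1 (fun x => χ x • v x) :=
  contDiff_of_contDiffOn_of_tsupport_subset hU
    ((hχ.of_le (by simp)).contDiffOn.smul hv)
    ((closure_mono fun x hx => by
      simp only [Function.mem_support] at hx ⊢
      exact fun h => hx (by simp [h])).trans hχU)

/-- The field is only locally Lipschitz. On a compact time interval both curves stay in a compact
subset of `U`, where the field agrees with a cut off, globally Lipschitz one. -/
lemma trajectory_unique {v : E → E} {U : Set E} (hU : IsOpen U) (hv : ContDiffOn ℝ 1 v U)
    {f g : ℝ → E} {T : ℝ} (hf : ∀ t ∈ Ioo (-T) T, f t ∈ U ∧ HasDerivAt f (v (f t)) t)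
    (hg : ∀ t ∈ Ioo (-T) T, g t ∈ U ∧ HasDerivAt g (v (g t)) t) (h : f 0 = g 0) :
    EqOn f g (Ioo (-T) T) := by
  intro t ht
  set S := (|t| + T) / 2
  have htT : |t| < T := abs_lt.2 ht
  have hS1 : |t| < S := by simp only [S]; linarith
  have hS2 : S < T := by simp only [S]; linarith
  have hsub : Icc (-S) S ⊆ Ioo (-T) T := fun s hs => ⟨by linarith [hs.1], by linarith [hs.2]⟩
  have hfc : ContinuousOn f (Icc (-S) S) := fun s hs =>
    (hf s (hsub hs)).2.continuousAt.continuousWithinAt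
  have hgc : ContinuousOn g (Icc (-S) S) := fun s hs =>
    (hg s (hsub hs)).2.continuousAt.continuousWithinAt
  obtain ⟨χ, h1, h2, h3, h4, -⟩ := exists_cutoff
    ((isCompact_Icc.image_of_continuousOn hfc).union (isCompact_Icc.image_of_continuousOn hgc)) hU
    (union_subset (image_subset_iff.2 fun s hs => (hf s (hsub hs)).1)
      (image_subset_iff.2 fun s hs => (hg s (hsub hs)).1))
  obtain ⟨K, hK⟩ := ContDiff.lipschitzWith_of_hasCompactSupport (f := fun x => χ x • v x)
    h2.smul_right (contDiff_cutoff_smul hU hv h1 h3) one_ne_zero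
  have h5 : ∀ x ∈ f '' Icc (-S) S ∪ g '' Icc (-S) S, χ x • v x = v x := fun x hx => by
    rw [h4.self_of_nhdsSet x hx, one_smul]
  refine flow_unique_of_lipschitz hK (a := -S) (b := S)
    ⟨by linarith [abs_nonneg t], by linarith [abs_nonneg t]⟩ (fun s hs => ?_) (fun s hs => ?_) h
    (abs_lt.1 hS1)
  · rw [h5 _ (Or.inl ⟨s, Ioo_subset_Icc_self hs, rfl⟩)]
    exact (hf s (hsub (Ioo_subset_Icc_self hs))).2
  · rw [h5 _ (Or.inr ⟨s, Ioo_subset_Icc_self hs, rfl⟩)]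
    exact (hg s (hsub (Ioo_subset_Icc_self hs))).2

lemma trajectory_unique_global {v : E → E} {U : Set E} (hU : IsOpen U) (hv : ContDiffOn ℝ 1 v U)
    {f g : ℝ → E} (hf : ∀ t, f t ∈ U ∧ HasDerivAt f (v (f t)) t)
    (hg : ∀ t, g t ∈ U ∧ HasDerivAt g (v (g t)) t) (h : f 0 = g 0) : f = g := by
  funext t
  exact trajectory_unique hU hv (T := |t| + 1) (fun t _ => hf t) (fun t _ => hg t) h
    (abs_lt.1 (lt_add_one _))

/-- Global solvability from a priori bounds for the solutions of the cut off equations. -/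
lemma exists_global_trajectory {v : E → E} {U : Set E} (hU : IsOpen U) (hv : ContDiffOn ℝ 1 v U)
    {x₀ : E} (hx₀ : x₀ ∈ U)
    (H : ∀ T : ℝ, ∃ K, IsCompact K ∧ K ⊆ U ∧ ∀ (χ : E → ℝ) (γ : ℝ → E), (∀ x, χ x ∈ Icc (0 : ℝ) 1) →
      γ 0 = x₀ → (∀ t, γ t ∈ U ∧ HasDerivAt γ (χ (γ t) • v (γ t)) t) → ∀ t ∈ Ioo (-T) T, γ t ∈ K) :
    ∃ γ : ℝ → E, γ 0 = x₀ ∧ ∀ t, γ t ∈ U ∧ HasDerivAt γ (v (γ t)) t := by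
  have loc : ∀ n : ℕ, ∃ γ : ℝ → E, γ 0 = x₀ ∧
      ∀ t ∈ Ioo (-(n + 1 : ℝ)) (n + 1), γ t ∈ U ∧ HasDerivAt γ (v (γ t)) t := by
    intro n
    obtain ⟨K, hK, hKU, hγ⟩ := H (n + 1)
    obtain ⟨χ, h1, h2, h3, h4, h5⟩ := exists_cutoff hK hU hKU
    have hw := contDiff_cutoff_smul hU hv h1 h3
    have hwc : HasCompactSupport (fun x => χ x • v x) := h2.smul_right
    obtain ⟨L, hL⟩ := ContDiff.lipschitzWith_of_hasCompactSupport hwc hw one_ne_zero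
    obtain ⟨C, hC⟩ := hwc.exists_bound_of_continuous hw.continuous
    obtain ⟨φ, hφ⟩ : ∃ φ, IsFlow (fun x => χ x • v x) φ := exists_flow_of_lipschitz hL (L := C.toNNReal)
      (fun x => (hC x).trans (Real.le_coe_toNNReal C))
    -- Outside `U` the cut off field vanishes, so every point there is an equilibrium. A trajectory
    -- reaching such a point would be constant, against `x₀ ∈ U`.
    have hmem : ∀ t, φ t x₀ ∈ U := by
      intro t
      by_contra hout
      have hz : χ (φ t x₀) = 0 := by
        by_contra h
        exact hout (h3 (subset_tsupport _ h))
      have hst : ∀ s, HasDerivAt (fun _ : ℝ => φ t x₀) (χ (φ t x₀) • v (φ t x₀)) s := fun s => by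
        rw [hz, zero_smul]; exact hasDerivAt_const _ _
      have h6 : φ (-t) (φ t x₀) = φ t x₀ :=
        flow_unique_of_lipschitz (a := -|t| - 1) (b := |t| + 1) hL
          ⟨by linarith [abs_nonneg t], by linarith [abs_nonneg t]⟩
          (fun s _ => (hφ (φ t x₀)).2 s) (fun s _ => hst s) (hφ (φ t x₀)).1
          ⟨by linarith [le_abs_self t], by linarith [neg_abs_le t]⟩
      rw [← IsFlow.group hφ hL, neg_add_cancel, (hφ x₀).1] at h6
      exact hout (h6 ▸ hx₀)
    refine ⟨fun t => φ t x₀, (hφ x₀).1, fun t ht => ⟨hmem t, ?_⟩⟩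
    -- No circularity arises: `K` was fixed before `χ`, and the a priori bound holds for every cut
    -- off equation. It confines this solution to `K`, where `χ = 1`, so it solves the original
    -- equation.
    have h6 := hγ χ (fun t => φ t x₀) h5 (hφ x₀).1 (fun t => ⟨hmem t, (hφ x₀).2 t⟩) t ht
    have h7 := (hφ x₀).2 t
    simpa [h4.self_of_nhdsSet _ h6] using h7
  choose α hα0 hα using loc
  have agree : ∀ (m n : ℕ), m ≤ n → EqOn (α m) (α n) (Ioo (-(m + 1 : ℝ)) (m + 1)) := by
    intro m n hmn
    have hmn' : (m : ℝ) ≤ n := by exact_mod_cast hmn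
    exact trajectory_unique hU hv (hα m)
      (fun t ht => hα n t ⟨by linarith [ht.1], by linarith [ht.2]⟩) (by rw [hα0, hα0])
  refine ⟨fun t => α ⌈|t|⌉₊ t, hα0 _, fun t => ?_⟩
  set n := ⌈|t|⌉₊ + 1
  have hn : |t| + 1 ≤ n := by
    have := Nat.le_ceil |t|; push_cast [n]; linarith
  have hev : (fun s => α ⌈|s|⌉₊ s) =ᶠ[𝓝 t] α n := by
    filter_upwards [Ioo_mem_nhds (sub_one_lt t) (lt_add_one t)] with s hs
    have hs1 : |s| < |t| + 1 := by
      have : |s - t| < 1 := abs_lt.2 ⟨by linarith [hs.1], by linarith [hs.2]⟩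
      have h2 := abs_sub_abs_le_abs_sub s t
      linarith
    have hle : ⌈|s|⌉₊ ≤ n := Nat.ceil_le.2 (by linarith)
    refine agree _ n hle ?_
    have := Nat.le_ceil |s|
    have h3 := abs_le.1 (le_refl |s|)
    exact ⟨by linarith [h3.1], by linarith [h3.2]⟩
  have h3 := abs_le.1 (le_refl |t|)
  have := hα n t ⟨by linarith [h3.1], by linarith [h3.2]⟩
  have h4 : α ⌈|t|⌉₊ t = α n t := hev.eq_of_nhds
  rw [← h4] at this
  exact ⟨this.1, this.2.congr_of_eventuallyEq hev⟩

/-- `ψ` is the global flow of the field `v` on `U`, continued by the identity. -/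
structure IsGlobalFlow (U : Set E) (v : E → E) (ψ : ℝ → E → E) : Prop where
  isOpen : IsOpen U
  contDiffOn_field : ContDiffOn ℝ 1 v U
  zero : ∀ x, ψ 0 x = x
  off : ∀ t, ∀ x ∉ U, ψ t x = x
  mem : ∀ t, ∀ x ∈ U, ψ t x ∈ U
  deriv : ∀ t, ∀ x ∈ U, HasDerivAt (fun s => ψ s x) (v (ψ t x)) t

namespace IsGlobalFlow

variable {U : Set E} {v : E → E} {ψ : ℝ → E → E}

omit [FiniteDimensional ℝ E] in
lemma mem_iff (h : IsGlobalFlow U v ψ) (t : ℝ) (x : E) : ψ t x ∈ U ↔ x ∈ U :=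
  ⟨fun hx => by by_contra h'; rw [h.off t x h'] at hx; exact h' hx, h.mem t x⟩

lemma group (h : IsGlobalFlow U v ψ) (s t : ℝ) (x : E) : ψ (s + t) x = ψ s (ψ t x) := by
  by_cases hx : x ∈ U
  · have := trajectory_unique_global h.isOpen h.contDiffOn_field (f := fun s => ψ (s + t) x)
      (g := fun s => ψ s (ψ t x))
      (fun r => ⟨h.mem _ _ hx, (h.deriv (r + t) x hx).comp_add_const r t⟩)
      (fun r => ⟨h.mem _ _ (h.mem _ _ hx), h.deriv r _ (h.mem _ _ hx)⟩) (by simp [h.zero])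
    exact congrFun this s
  · rw [h.off _ _ hx, h.off _ _ hx, h.off _ _ hx]

lemma neg_apply (h : IsGlobalFlow U v ψ) (t : ℝ) (x : E) : ψ (-t) (ψ t x) = x := by
  rw [← h.group, neg_add_cancel, h.zero]

lemma apply_neg (h : IsGlobalFlow U v ψ) (t : ℝ) (x : E) : ψ t (ψ (-t) x) = x := by
  rw [← h.group, add_neg_cancel, h.zero]

/-- Near a given point the flow coincides with that of a compactly supported field. -/
lemma exists_eventuallyEq (h : IsGlobalFlow U v ψ) (t : ℝ) {x : E} (hx : x ∈ U) :
    ∃ (w : E → E) (φ : ℝ → E → E), ContDiff ℝ 1 w ∧ HasCompactSupport w ∧ IsFlow w φ ∧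
      w =ᶠ[𝓝 x] v ∧ ∀ᶠ z : ℝ × E in 𝓝 (t, x), ψ z.1 z.2 = φ z.1 z.2 := by
  set T : ℝ := |t| + 1
  have hT : 0 < T := by positivity
  have hcont : Continuous fun s => ψ s x :=
    continuous_iff_continuousAt.2 fun s => (h.deriv s x hx).continuousAt
  set K := (fun s => ψ s x) '' Icc (-T) T
  have hKc : IsCompact K := isCompact_Icc.image hcont
  have hKU : K ⊆ U := image_subset_iff.2 fun s _ => h.mem s x hx
  obtain ⟨χ, h1, h2, h3, h4, -⟩ := exists_cutoff hKc h.isOpen hKU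
  have hw := contDiff_cutoff_smul h.isOpen h.contDiffOn_field h1 h3
  have hwc : HasCompactSupport (fun x => χ x • v x) := h2.smul_right
  obtain ⟨L, hL⟩ := ContDiff.lipschitzWith_of_hasCompactSupport hwc hw one_ne_zero
  obtain ⟨C, hC⟩ := hwc.exists_bound_of_continuous hw.continuous
  obtain ⟨φ, hφ⟩ : ∃ φ, IsFlow (fun x => χ x • v x) φ := exists_flow_of_lipschitz hL (L := C.toNNReal)
    (fun x => (hC x).trans (Real.le_coe_toNNReal C))
  rw [eventually_nhdsSet_iff_exists] at h4
  obtain ⟨N, hNo, hKN, hN⟩ := h4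
  have hNU : N ⊆ U := fun y hy => h3 (subset_tsupport _ (by
    rw [Function.mem_support, hN y hy]; exact one_ne_zero))
  have hwN : ∀ y ∈ N, χ y • v y = v y := fun y hy => by rw [hN y hy, one_smul]
  have hxK : x ∈ K := ⟨0, ⟨by linarith, hT.le⟩, h.zero x⟩
  -- A tube of width `δ` about the orbit lies in the region where `χ = 1`. Initial points within `δ
  -- / Real.exp ((L + 1) * T)` of `x` stay in the tube up to time `T`, by Grönwall.
  obtain ⟨δ, hδ, hδN⟩ := hKc.exists_cthickening_subset_open hNo hKN
  have hbase : ∀ s ∈ Ioo (-T) T, ψ s x = φ s x := by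
    refine flow_unique_of_lipschitz hL ⟨by linarith, hT⟩ (fun s hs => ?_)
      (fun s _ => (hφ x).2 s) (by rw [h.zero, (hφ x).1])
    rw [hwN _ (hKN ⟨s, Ioo_subset_Icc_self hs, rfl⟩)]
    exact h.deriv s x hx
  refine ⟨fun x => χ x • v x, φ, hw, hwc, hφ, ?_, ?_⟩
  · filter_upwards [hNo.mem_nhds (hKN hxK)] with y hy using hwN y hy
  · have hball : Metric.ball x (δ / Real.exp ((L + 1) * T)) ∈ 𝓝 x :=
      Metric.ball_mem_nhds _ (by positivity)
    have hI : Ioo (-T) T ∈ 𝓝 t := Ioo_mem_nhds (by simp only [T]; linarith [neg_abs_le t])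
      (by simp only [T]; linarith [le_abs_self t])
    filter_upwards [prod_mem_nhds hI hball] with z hz
    have hstay : ∀ s ∈ Ioo (-T) T, φ s z.2 ∈ N := by
      intro s hs
      refine hδN (Metric.mem_cthickening_of_dist_le _ (φ s x) _ _ ?_ ?_)
      · rw [← hbase s hs]; exact ⟨s, Ioo_subset_Icc_self hs, rfl⟩
      · have h5 := IsFlow.norm_sub_le hφ hL z.2 x (Ioo_subset_Icc_self hs)
        have h6 : dist z.2 x < δ / Real.exp ((L + 1) * T) := hz.2
        rw [lt_div_iff₀ (Real.exp_pos _), dist_eq_norm] at h6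
        rw [dist_eq_norm]; linarith
    have hz0 : z.2 ∈ U := by
      have := hNU (hstay 0 ⟨by linarith, hT⟩)
      rwa [(hφ z.2).1] at this
    refine trajectory_unique h.isOpen h.contDiffOn_field (T := T)
      (fun s _ => ⟨h.mem s _ hz0, h.deriv s _ hz0⟩) (fun s hs => ⟨hNU (hstay s hs), ?_⟩)
      (by rw [h.zero, (hφ z.2).1]) hz.1
    rw [← hwN _ (hstay s hs)]
    exact (hφ z.2).2 s

lemma contDiffOn (h : IsGlobalFlow U v ψ) :
    ContDiffOn ℝ 1 (fun z : ℝ × E => ψ z.1 z.2) (univ ×ˢ U) := by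
  rintro ⟨t, x⟩ ⟨-, hx⟩
  obtain ⟨w, φ, hw, hwc, hφ, -, he⟩ := h.exists_eventuallyEq t hx
  exact (((hφ.contDiff hw hwc).1.contDiffAt).congr_of_eventuallyEq he).contDiffWithinAt

lemma contDiffOn_apply (h : IsGlobalFlow U v ψ) (t : ℝ) : ContDiffOn ℝ 1 (ψ t) U :=
  h.contDiffOn.comp (f := fun x => (t, x)) (by fun_prop) fun x hx => ⟨trivial, hx⟩

lemma hasFDerivAt (h : IsGlobalFlow U v ψ) (t : ℝ) {x : E} (hx : x ∈ U) :
    HasFDerivAt (ψ t) (fderiv ℝ (ψ t) x) x :=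
  (((h.contDiffOn_apply t).contDiffAt (h.isOpen.mem_nhds hx)).differentiableAt
    one_ne_zero).hasFDerivAt

lemma hasDerivAt_fderiv_zero (h : IsGlobalFlow U v ψ) {x : E} (hx : x ∈ U) :
    HasDerivAt (fun s => fderiv ℝ (ψ s) x) (fderiv ℝ v x) 0 := by
  obtain ⟨w, φ, hw, hwc, hφ, hwv, he⟩ := h.exists_eventuallyEq 0 hx
  rw [← hwv.fderiv_eq]
  refine ((hφ.contDiff hw hwc).2 x).congr_of_eventuallyEq ?_
  have := he.curry_nhds
  filter_upwards [this] with s hs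
  exact Filter.EventuallyEq.fderiv_eq hs

end IsGlobalFlow

/-- The derivative at the identity of the determinant is the trace. -/
lemma hasDerivAt_det_zero {A : ℝ → E →L[ℝ] E} {B : E →L[ℝ] E} (h0 : A 0 = ContinuousLinearMap.id ℝ E)
    (hA : HasDerivAt A B 0) :
    HasDerivAt (fun s => (A s).det) (LinearMap.trace ℝ E B) 0 := by
  classical
  set b := Module.finBasis ℝ E
  set Lm : (E →L[ℝ] E) →ₗ[ℝ] Matrix (Fin (Module.finrank ℝ E)) (Fin (Module.finrank ℝ E)) ℝ :=
    (LinearMap.toMatrix b b).toLinearMap ∘ₗ (ContinuousLinearMap.coeLM ℝ)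
  have hentry : ∀ i j, HasDerivAt (fun s => Lm (A s) i j) (Lm B i j) 0 := by
    intro i j
    let ℓ : (E →L[ℝ] E) →ₗ[ℝ] ℝ := (Matrix.entryLinearMap ℝ ℝ i j) ∘ₗ Lm
    exact (LinearMap.toContinuousLinearMap ℓ).hasFDerivAt.comp_hasDerivAt 0 hA
  have e1 : (fun s => (A s).det) = fun s => (Lm (A s)).det := by
    funext s
    exact (LinearMap.det_toMatrix b (A s : E →ₗ[ℝ] E)).symm
  have e0 : Lm (A 0) = 1 := by
    rw [h0]; exact LinearMap.toMatrix_one b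
  have e2 : LinearMap.trace ℝ E B = (Lm B).trace := LinearMap.trace_eq_matrix_trace ℝ b _
  rw [e1, e2]
  simp only [Matrix.det_apply']
  have hprod : ∀ σ : Equiv.Perm (Fin (Module.finrank ℝ E)),
      HasDerivAt (fun s => ((Equiv.Perm.sign σ : ℤ) : ℝ) * ∏ i, Lm (A s) (σ i) i)
        (((Equiv.Perm.sign σ : ℤ) : ℝ) * ∑ i, (∏ j ∈ Finset.univ.erase i, Lm (A 0) (σ j) j) •
          Lm B (σ i) i) 0 := fun σ =>
    (HasDerivAt.fun_finsetProd fun i _ => hentry (σ i) i).const_mul _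
  have hsum := HasDerivAt.fun_sum (u := Finset.univ) fun σ _ => hprod σ
  refine hsum.congr_deriv ?_
  -- A permutation other than the identity moves at least two indices. Every term of the product
  -- rule then keeps an off-diagonal entry of the identity matrix, which is zero.
  rw [Finset.sum_eq_single 1]
  · simp [e0, Matrix.trace]
  · intro σ _ hσ
    have : ∀ i, ∃ j, j ≠ i ∧ σ j ≠ j := by
      intro i
      by_contra hcon
      push Not at hcon
      apply hσ
      ext k
      by_cases hk : k = i
      · subst hk
        by_contra hne
        have h1 : σ k ≠ k := fun h => hne (by simp [h])
        have h2 := hcon (σ k) h1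
        exact h1 (σ.injective h2)
      · simp [hcon k hk]
    rw [Finset.sum_eq_zero, mul_zero]
    intro i _
    obtain ⟨j, hji, hj⟩ := this i
    rw [Finset.prod_eq_zero (Finset.mem_erase.2 ⟨hji, Finset.mem_univ j⟩), zero_smul]
    rw [e0, Matrix.one_apply_ne hj]
  · simp

namespace IsGlobalFlow

variable {U : Set E} {v : E → E} {ψ : ℝ → E → E}

/-- By the group law and the chain rule, det Dψ_{s+t}(x) = det Dψ_s(ψ_t x) · det Dψ_t(x). Its
derivative in `s` at 0 is the divergence of `v` at ψ_t x times the last factor, hence zero, and the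
determinant keeps its initial value. -/
lemma det_fderiv_eq_one (h : IsGlobalFlow U v ψ)
    (htr : ∀ x ∈ U, LinearMap.trace ℝ E (fderiv ℝ v x) = 0) (t : ℝ) {x : E} (hx : x ∈ U) :
    (fderiv ℝ (ψ t) x).det = 1 := by
  have hz : ∀ y, fderiv ℝ (ψ 0) y = ContinuousLinearMap.id ℝ E := fun y => by
    have : ψ 0 = id := funext h.zero
    rw [this, fderiv_id]
  have hstep : ∀ s t, (fderiv ℝ (ψ (s + t)) x).det =
      (fderiv ℝ (ψ s) (ψ t x)).det * (fderiv ℝ (ψ t) x).det := by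
    intro s t
    have e : ψ (s + t) = ψ s ∘ ψ t := funext fun y => h.group s t y
    rw [e, fderiv_comp x (h.hasFDerivAt s (h.mem t x hx)).differentiableAt
      (h.hasFDerivAt t hx).differentiableAt]
    exact LinearMap.det_comp _ _
  have hd : ∀ t, HasDerivAt (fun s => (fderiv ℝ (ψ s) x).det) 0 t := by
    intro t
    have h1 := hasDerivAt_det_zero (hz _) (h.hasDerivAt_fderiv_zero (h.mem t x hx))
    rw [htr _ (h.mem t x hx)] at h1
    have h2 := h1.mul_const (fderiv ℝ (ψ t) x).det
    simp only [← hstep, zero_mul] at h2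
    have h3 : HasDerivAt (fun s => (fderiv ℝ (ψ (s + t)) x).det) 0 (t - t) := by simpa using h2
    simpa using h3.comp_sub_const t t
  have := is_const_of_deriv_eq_zero (fun s => (hd s).differentiableAt) (fun s => (hd s).deriv) t 0
  rw [this, hz]
  exact LinearMap.det_id

variable [MeasurableSpace E] [BorelSpace E]

lemma measurable (h : IsGlobalFlow U v ψ) (t : ℝ) : Measurable (ψ t) := by
  classical
  have e : ψ t = U.piecewise (ψ t) id := by
    funext x
    by_cases hx : x ∈ U
    · simp [hx]
    · simp [hx, h.off t x hx]
  rw [e]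
  exact ContinuousOn.measurable_piecewise (h.contDiffOn_apply t).continuousOn
    continuous_id.continuousOn h.isOpen.measurableSet

/-- Within `U`, the preimage under ψ_t is the image under the injective map ψ_{-t}, whose Jacobian
is 1; the change of variables formula does the rest. -/
lemma measurePreserving (h : IsGlobalFlow U v ψ)
    (htr : ∀ x ∈ U, LinearMap.trace ℝ E (fderiv ℝ v x) = 0) (μ : Measure E) [μ.IsAddHaarMeasure]
    (t : ℝ) : MeasurePreserving (ψ t) (μ.restrict U) (μ.restrict U) := by
  refine ⟨h.measurable t, Measure.ext fun s hs => ?_⟩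
  have hs' : MeasurableSet (s ∩ U) := hs.inter h.isOpen.measurableSet
  rw [Measure.map_apply (h.measurable t) hs, Measure.restrict_apply (h.measurable t hs),
    Measure.restrict_apply hs]
  have e : ψ t ⁻¹' s ∩ U = ψ (-t) '' (s ∩ U) := by
    ext x
    constructor
    · rintro ⟨h1, h2⟩
      exact ⟨ψ t x, ⟨h1, h.mem t x h2⟩, h.neg_apply t x⟩
    · rintro ⟨y, ⟨h1, h2⟩, rfl⟩
      exact ⟨by rw [mem_preimage, h.apply_neg]; exact h1, h.mem _ _ h2⟩
  have hinj : InjOn (ψ (-t)) (s ∩ U) := fun y _ z _ hyz => by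
    have := congrArg (ψ t) hyz
    rwa [h.apply_neg, h.apply_neg] at this
  rw [e, ← lintegral_abs_det_fderiv_eq_addHaar_image μ hs'
    (fun x hx => (h.hasFDerivAt (-t) hx.2).hasFDerivWithinAt) hinj]
  rw [setLIntegral_congr_fun hs' (g := fun _ => 1) fun x hx => by
    simp [h.det_fderiv_eq_one htr (-t) hx.2]]
  simp

end IsGlobalFlow

end OpenFlow

end NearestNeighbour


namespace NearestNeighbour

/-! ### The Liouville equation of a global flow: weak form, uniqueness and strong continuity in L¹.
-/

section Transport

variable {E : Type*} [NormedAddCommGroup E] [NormedSpace ℝ E]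

/-- Continuously differentiable functions with compact support in `U`. -/
def IsTest (U : Set E) (φ : E → ℝ) : Prop :=
  ContDiff ℝ 1 φ ∧ HasCompactSupport φ ∧ tsupport φ ⊆ U

/-- The derivative of `φ` along the field `v`. -/
noncomputable def along (v : E → E) (φ : E → ℝ) (x : E) : ℝ := fderiv ℝ φ x (v x)

lemma tsupport_along_subset {φ : E → ℝ} (v : E → E) :
    tsupport (along v φ) ⊆ tsupport φ := by
  refine closure_minimal (fun x hx => ?_) (isClosed_tsupport _)
  refine support_fderiv_subset ℝ (f := φ) ?_
  rw [Function.mem_support] at hx ⊢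
  intro h
  exact hx (by simp [along, h])

lemma IsTest.continuous_along {U : Set E} {φ : E → ℝ} {v : E → E} (hU : IsOpen U)
    (hv : ContDiffOn ℝ 1 v U) (hφ : IsTest U φ) : Continuous (along v φ) := by
  rw [continuous_iff_continuousAt]
  intro x
  by_cases hx : x ∈ U
  · exact ((hφ.1.continuous_fderiv one_ne_zero).continuousAt).clm_apply
      (hv.continuousOn.continuousAt (hU.mem_nhds hx))
  · have h : x ∉ tsupport (along v φ) := fun h =>
      hx (hφ.2.2 (tsupport_along_subset v h))
    have : along v φ =ᶠ[𝓝 x] fun _ => 0 := by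
      filter_upwards [(isClosed_tsupport _).isOpen_compl.mem_nhds h] with y hy
      exact image_eq_zero_of_notMem_tsupport hy
    exact continuousAt_const.congr this.symm

lemma IsTest.hasCompactSupport_along {U : Set E} {φ : E → ℝ} (v : E → E) (hφ : IsTest U φ) :
    HasCompactSupport (along v φ) :=
  hφ.2.1.of_isClosed_subset (isClosed_tsupport _) (tsupport_along_subset v)

lemma IsTest.exists_bound {U : Set E} {φ : E → ℝ} (hφ : IsTest U φ) : ∃ C, ∀ x, ‖φ x‖ ≤ C :=
  hφ.2.1.exists_bound_of_continuous hφ.1.continuous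

lemma integrable_Lp_mul {α : Type*} [MeasurableSpace α] {ν : Measure α} {f g : α → ℝ} {C : ℝ}
    (hf : Integrable f ν) (hg : AEStronglyMeasurable g ν) (hC : ∀ x, ‖g x‖ ≤ C) :
    Integrable (fun x => f x * g x) ν :=
  hf.mul_bdd (c := C) hg (Eventually.of_forall hC)

variable [FiniteDimensional ℝ E] {U : Set E} {v : E → E} {ψ : ℝ → E → E}

namespace IsGlobalFlow

/-- The support is carried to the compact set ψ_{-t}(tsupport φ), which still lies in the invariant
set `U`; regularity off `U` is then trivial. -/
lemma isTest_comp (h : IsGlobalFlow U v ψ) {φ : E → ℝ} (hφ : IsTest U φ) (t : ℝ) :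
    IsTest U (fun x => φ (ψ t x)) := by
  have hK : IsCompact (ψ (-t) '' tsupport φ) :=
    hφ.2.1.isCompact.image_of_continuousOn ((h.contDiffOn_apply (-t)).continuousOn.mono hφ.2.2)
  have hKU : ψ (-t) '' tsupport φ ⊆ U := image_subset_iff.2 fun x hx => h.mem _ x (hφ.2.2 hx)
  have hs : tsupport (fun x => φ (ψ t x)) ⊆ ψ (-t) '' tsupport φ :=
    closure_minimal (fun x hx => ⟨ψ t x, subset_tsupport _ hx, h.neg_apply t x⟩) hK.isClosed
  refine ⟨contDiff_of_contDiffOn_of_tsupport_subset h.isOpen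
    (hφ.1.comp_contDiffOn (h.contDiffOn_apply t)) (hs.trans hKU),
    hK.of_isClosed_subset (isClosed_tsupport _) hs, hs.trans hKU⟩

omit [FiniteDimensional ℝ E] in
lemma hasDerivAt_test (h : IsGlobalFlow U v ψ) {φ : E → ℝ} (hφ : IsTest U φ) (x : E) (t : ℝ) :
    HasDerivAt (fun s => φ (ψ s x)) (along v φ (ψ t x)) t := by
  by_cases hx : x ∈ U
  · exact ((hφ.1.differentiable one_ne_zero) (ψ t x)).hasFDerivAt.comp_hasDerivAt t (h.deriv t x hx)
  · have h0 : along v φ (ψ t x) = 0 := image_eq_zero_of_notMem_tsupport fun hm => hx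
      ((h.mem_iff t x).1 (hφ.2.2 (tsupport_along_subset v hm)))
    have e : (fun s => φ (ψ s x)) = fun _ => φ x := funext fun s => by rw [h.off s x hx]
    rw [h0, e]
    exact hasDerivAt_const _ _

/-- The derivative along the field commutes with the flow. -/
lemma along_comp (h : IsGlobalFlow U v ψ) {f : E → ℝ} (t : ℝ) {x : E} (hx : x ∈ U)
    (hf : DifferentiableAt ℝ f (ψ t x)) :
    along v (fun x => f (ψ t x)) x = along v f (ψ t x) := by
  have h1 : HasDerivAt (fun s => f (ψ s x)) (along v f (ψ t x)) t :=
    hf.hasFDerivAt.comp_hasDerivAt t (h.deriv t x hx)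
  have hd : DifferentiableAt ℝ (fun x => f (ψ t x)) x :=
    hf.comp x (h.hasFDerivAt t hx).differentiableAt
  -- The function s ↦ f(ψ_{t+s} x) is differentiated at 0 in two ways: as the composition of f ∘ ψ_t
  -- with the motion of `x`, and as `f` along the trajectory at time `t`.
  have h2 : HasDerivAt (fun s => f (ψ t (ψ s x))) (along v (fun x => f (ψ t x)) x) 0 := by
    have h3 := h.deriv 0 x hx
    have h4 : HasFDerivAt (fun x => f (ψ t x)) (fderiv ℝ (fun x => f (ψ t x)) x) (ψ 0 x) := by
      rw [h.zero]; exact hd.hasFDerivAt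
    have := h4.comp_hasDerivAt 0 h3
    rwa [h.zero] at this
  have h5 : (fun s => f (ψ t (ψ s x))) = fun s => f (ψ (t + s) x) := by
    funext s; rw [h.group]
  rw [h5] at h2
  have h6 : HasDerivAt (fun s => f (ψ (t + s) x)) (along v f (ψ t x)) 0 := by
    have : HasDerivAt (fun s => f (ψ s x)) (along v f (ψ t x)) (t + 0) := by simpa using h1
    exact this.comp_const_add t 0
  exact h2.unique h6

lemma hasDerivAt_comp_neg (h : IsGlobalFlow U v ψ) {f : E → ℝ} (t : ℝ) {x : E} (hx : x ∈ U)
    (hf : DifferentiableAt ℝ f (ψ (-t) x)) :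
    HasDerivAt (fun s => f (ψ (-s) x)) (-along v (fun x => f (ψ (-t) x)) x) t := by
  rw [h.along_comp _ hx hf]
  have h1 : HasDerivAt (fun s => f (ψ s x)) (along v f (ψ (-t) x)) (-t) :=
    hf.hasFDerivAt.comp_hasDerivAt (-t) (h.deriv (-t) x hx)
  simpa [Function.comp_def] using h1.scomp t (hasDerivAt_neg t)

variable [MeasurableSpace E] [BorelSpace E] {μ : Measure E} [μ.IsAddHaarMeasure]

lemma integral_comp_mul (h : IsGlobalFlow U v ψ)
    (htr : ∀ x ∈ U, LinearMap.trace ℝ E (fderiv ℝ v x) = 0) {F φ : E → ℝ}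
    (hF : Integrable F (μ.restrict U)) (hφ : Continuous φ) (t : ℝ) :
    ∫ x in U, F (ψ (-t) x) * φ x ∂μ = ∫ x in U, F x * φ (ψ t x) ∂μ := by
  have mp := h.measurePreserving htr μ t
  have mp' := h.measurePreserving htr μ (-t)
  have hm : AEStronglyMeasurable (fun x => F (ψ (-t) x) * φ x) (μ.restrict U) :=
    (hF.1.comp_measurePreserving mp').mul hφ.aestronglyMeasurable
  conv_lhs => rw [← mp.map_eq]
  rw [integral_map mp.measurable.aemeasurable (by rw [mp.map_eq]; exact hm)]
  simp only [h.neg_apply]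

/-- The weak form of the Liouville equation. -/
lemma hasDerivAt_integral_comp_neg (h : IsGlobalFlow U v ψ)
    (htr : ∀ x ∈ U, LinearMap.trace ℝ E (fderiv ℝ v x) = 0) {F φ : E → ℝ}
    (hF : Integrable F (μ.restrict U)) (hφ : IsTest U φ) (t : ℝ) :
    HasDerivAt (fun s => ∫ x in U, F (ψ (-s) x) * φ x ∂μ)
      (∫ x in U, F (ψ (-t) x) * along v φ x ∂μ) t := by
  have ha := hφ.continuous_along h.isOpen h.contDiffOn_field
  obtain ⟨C, hC⟩ := (hφ.hasCompactSupport_along v).exists_bound_of_continuous ha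
  obtain ⟨C', hC'⟩ := hφ.exists_bound
  -- `F` is merely integrable, so the motion is moved to the test function, where differentiation
  -- under the integral sign is possible.
  rw [h.integral_comp_mul htr hF ha t]
  simp only [h.integral_comp_mul htr hF hφ.1.continuous]
  have hm : ∀ (g : E → ℝ), Continuous g → ∀ s, AEStronglyMeasurable (fun x => g (ψ s x))
      (μ.restrict U) := fun g hg s =>
    (hg.measurable.comp (h.measurable s)).aestronglyMeasurable
  refine (hasDerivAt_integral_of_dominated_loc_of_deriv_le (s := univ) univ_mem
    (F := fun s x => F x * φ (ψ s x)) (F' := fun s x => F x * along v φ (ψ s x))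
    (bound := fun x => ‖F x‖ * C) (Eventually.of_forall fun s => ?_) ?_ ?_ ?_ ?_ ?_).2
  · exact hF.1.mul (hm _ hφ.1.continuous s)
  · exact integrable_Lp_mul hF (hm _ hφ.1.continuous t) fun x => hC' _
  · exact hF.1.mul (hm _ ha t)
  · refine Eventually.of_forall fun x s _ => ?_
    rw [norm_mul]
    exact mul_le_mul_of_nonneg_left (hC _) (norm_nonneg _)
  · exact hF.norm.mul_const C
  · exact Eventually.of_forall fun x s _ => (h.hasDerivAt_test hφ x s).const_mul _

lemma norm_integral_mul_le {α : Type*} [MeasurableSpace α] {ν : Measure α} (f : Lp ℝ 1 ν)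
    {g : α → ℝ} {C : ℝ} (hC : ∀ x, ‖g x‖ ≤ C) : ‖∫ x, f x * g x ∂ν‖ ≤ ‖f‖ * C := by
  rw [L1.norm_eq_integral_norm, ← integral_mul_const]
  refine norm_integral_le_of_norm_le ((L1.integrable_coeFn f).norm.mul_const C)
    (Eventually.of_forall fun x => ?_)
  rw [norm_mul]
  exact mul_le_mul_of_nonneg_left (hC _) (norm_nonneg _)

omit [μ.IsAddHaarMeasure] in
/-- Uniqueness of weak solutions of the Liouville equation. -/
lemma eq_zero_of_weak (h : IsGlobalFlow U v ψ) {H : ℝ → Lp ℝ 1 (μ.restrict U)}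
    (hH : Continuous H) (h0 : H 0 = 0)
    (hd : ∀ φ, IsTest U φ → ∀ t, HasDerivAt (fun s => ∫ x in U, H s x * φ x ∂μ)
      (∫ x in U, H t x * along v φ x ∂μ) t) (T : ℝ) : H T = 0 := by
  have key : ∀ φ, IsTest U φ → ∫ x in U, H T x * φ x ∂μ = 0 := by
    intro φ hφ
    have ha := hφ.continuous_along h.isOpen h.contDiffOn_field
    obtain ⟨C, hC⟩ := (hφ.hasCompactSupport_along v).exists_bound_of_continuous ha
    obtain ⟨C', hC'⟩ := hφ.exists_bound
    have hm : ∀ (g : E → ℝ), Continuous g → ∀ s, AEStronglyMeasurable (fun x => g (ψ s x))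
        (μ.restrict U) := fun g hg s =>
      (hg.measurable.comp (h.measurable s)).aestronglyMeasurable
    have hint : ∀ s t, Integrable (fun x => H s x * φ (ψ t x)) (μ.restrict U) := fun s t =>
      integrable_Lp_mul (L1.integrable_coeFn _) (hm _ hφ.1.continuous t) fun x => hC' _
    have hderT : ∀ x t, HasDerivAt (fun s => φ (ψ (T - s) x)) (-along v φ (ψ (T - t) x)) t := by
      intro x t
      have := (h.hasDerivAt_test hφ x (T - t)).scomp t ((hasDerivAt_id t).const_sub T)
      simpa [Function.comp_def] using this
    -- The pairing of H(s) with the backward transported test function φ ∘ ψ_{T-s} is constant. At s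
    -- = T it is the integral to be computed, at s = 0 it vanishes. The product rule is split into
    -- the variation of each factor separately (`h1`, `h2`) and a cross term (`h3`).
    have hM : ∀ t, HasDerivAt (fun s => ∫ x in U, H s x * φ (ψ (T - s) x) ∂μ) 0 t := by
      intro t
      have h1 := hd _ (h.isTest_comp hφ (T - t)) t
      have e1 : ∫ x in U, H t x * along v (fun x => φ (ψ (T - t) x)) x ∂μ =
          ∫ x in U, H t x * along v φ (ψ (T - t) x) ∂μ := by
        refine setIntegral_congr_fun h.isOpen.measurableSet fun x hx => ?_
        rw [h.along_comp (T - t) hx ((hφ.1.differentiable one_ne_zero) _)]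
      rw [e1] at h1
      have h2 : HasDerivAt (fun s => ∫ x in U, H t x * φ (ψ (T - s) x) ∂μ)
          (∫ x in U, H t x * -along v φ (ψ (T - t) x) ∂μ) t := by
        refine (hasDerivAt_integral_of_dominated_loc_of_deriv_le (s := univ) univ_mem
          (F := fun s x => H t x * φ (ψ (T - s) x))
          (F' := fun s x => H t x * -along v φ (ψ (T - s) x))
          (bound := fun x => ‖H t x‖ * C) (Eventually.of_forall fun s => ?_) ?_ ?_ ?_ ?_ ?_).2
        · exact (hint t (T - s)).1
        · exact hint t (T - t)
        · exact (L1.integrable_coeFn _).1.mul (hm _ ha (T - t)).neg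
        · refine Eventually.of_forall fun x s _ => ?_
          rw [norm_mul, norm_neg]
          exact mul_le_mul_of_nonneg_left (hC _) (norm_nonneg _)
        · exact (L1.integrable_coeFn _).norm.mul_const C
        · exact Eventually.of_forall fun x s _ => (hderT x s).const_mul _
      -- The cross term is bounded by ‖H(s) - H(t)‖ · C|s - t|, so mere continuity of `H` in L¹
      -- makes it o(|s - t|).
      have h3 : HasDerivAt (fun s => ∫ x in U, (H s - H t) x * (φ (ψ (T - s) x) - φ (ψ (T - t) x)) ∂μ)
          0 t := by
        rw [hasDerivAt_iff_isLittleO, Asymptotics.isLittleO_iff]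
        intro c hc
        have hlim : Tendsto (fun s => ‖H s - H t‖ * C) (𝓝 t) (𝓝 0) := by
          have : Continuous fun s => ‖H s - H t‖ * C := by fun_prop
          simpa using this.tendsto t
        filter_upwards [hlim.eventually_lt_const hc] with s hs
        have hb : ∀ x, ‖φ (ψ (T - s) x) - φ (ψ (T - t) x)‖ ≤ C * ‖s - t‖ := fun x =>
          Convex.norm_image_sub_le_of_norm_hasDerivWithin_le (s := univ)
            (f := fun s => φ (ψ (T - s) x)) (fun r _ => (hderT x r).hasDerivWithinAt)
            (fun r _ => by rw [norm_neg]; exact hC _) convex_univ trivial trivial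
        have h4 := norm_integral_mul_le (H s - H t) hb
        have e : ∫ x in U, (H t - H t) x * (φ (ψ (T - t) x) - φ (ψ (T - t) x)) ∂μ = 0 := by simp
        rw [e, sub_zero, smul_zero, sub_zero]
        refine h4.trans ?_
        rw [← mul_assoc]
        exact mul_le_mul_of_nonneg_right hs.le (norm_nonneg _)
      have h5 := (h1.add h2).add h3
      have e2 : (∫ x in U, H t x * along v φ (ψ (T - t) x) ∂μ) +
          (∫ x in U, H t x * -along v φ (ψ (T - t) x) ∂μ) + 0 = 0 := by
        simp [integral_neg]
      rw [e2] at h5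
      have h6 := h5.sub_const (∫ x in U, H t x * φ (ψ (T - t) x) ∂μ)
      refine h6.congr_of_eventuallyEq (Eventually.of_forall fun s => ?_)
      have e3 : ∫ x in U, (H s - H t) x * (φ (ψ (T - s) x) - φ (ψ (T - t) x)) ∂μ =
          (∫ x in U, H s x * φ (ψ (T - s) x) ∂μ) - (∫ x in U, H s x * φ (ψ (T - t) x) ∂μ) -
          ((∫ x in U, H t x * φ (ψ (T - s) x) ∂μ) - (∫ x in U, H t x * φ (ψ (T - t) x) ∂μ)) := by
        rw [← integral_sub (hint _ _) (hint _ _), ← integral_sub (hint _ _) (hint _ _),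
          ← integral_sub ((hint s _).sub (hint s _) : Integrable (fun x => _ - _) _)
            ((hint t _).sub (hint t _) : Integrable (fun x => _ - _) _)]
        refine integral_congr_ae ?_
        filter_upwards [Lp.coeFn_sub (H s) (H t)] with x hx
        rw [hx, Pi.sub_apply]; ring
      simp only [Pi.add_apply]
      rw [e3]; ring
    have h7 := is_const_of_deriv_eq_zero (fun s => (hM s).differentiableAt)
      (fun s => (hM s).deriv) T 0
    simp only [sub_self, h.zero] at h7
    rw [h7, h0]
    refine integral_eq_zero_of_ae ?_
    filter_upwards [Lp.coeFn_zero ℝ 1 (μ.restrict U)] with x hx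
    rw [hx]; simp
  have hloc : LocallyIntegrableOn (H T) U μ :=
    IntegrableOn.locallyIntegrableOn (L1.integrable_coeFn (H T))
  have hae := h.isOpen.ae_eq_zero_of_integral_contDiff_smul_eq_zero hloc fun g hg hgc hgU => by
    have h1 := key g ⟨hg.of_le (by simp), hgc, hgU⟩
    rw [← setIntegral_eq_integral_of_forall_compl_eq_zero (s := U) (fun x hx => by
      rw [image_eq_zero_of_notMem_tsupport fun hm => hx (hgU hm), zero_smul])]
    simpa [mul_comm] using h1
  rw [Lp.eq_zero_iff_ae_eq_zero]
  exact (ae_restrict_iff' h.isOpen.measurableSet).2 hae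

/-- Translation of a test function along the flow is continuous in the mean. -/
lemma tendsto_integral_comp_sub (h : IsGlobalFlow U v ψ) {φ : E → ℝ} (hφ : IsTest U φ) (t : ℝ) :
    Tendsto (fun s => ∫ x in U, ‖φ (ψ (-s) x) - φ (ψ (-t) x)‖ ∂μ) (𝓝 t) (𝓝 0) := by
  obtain ⟨C, hC⟩ := hφ.exists_bound
  have hφm : ∀ s, Measurable fun x => φ (ψ s x) := fun s =>
    hφ.1.continuous.measurable.comp (h.measurable s)
  -- A compact set containing the supports of φ ∘ ψ_{-s} for all |s - t| ≤ 1, so that twice the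
  -- bound of φ on `W` dominates the integrands.
  set W := (fun z : ℝ × E => ψ z.1 z.2) '' (Icc (t - 1) (t + 1) ×ˢ tsupport φ)
  have hW : IsCompact W := (isCompact_Icc.prod hφ.2.1.isCompact).image_of_continuousOn
    (h.contDiffOn.continuousOn.mono (prod_mono (subset_univ _) hφ.2.2))
  have hz : ∀ s ∈ Icc (t - 1) (t + 1), ∀ x ∉ W, φ (ψ (-s) x) = 0 := by
    intro s hs x hx
    by_contra hne
    exact hx ⟨(s, ψ (-s) x), ⟨hs, subset_tsupport _ hne⟩, h.apply_neg s x⟩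
  have := tendsto_integral_filter_of_dominated_convergence (μ := μ.restrict U) (l := 𝓝 t)
    (F := fun s x => ‖φ (ψ (-s) x) - φ (ψ (-t) x)‖) (f := fun _ => 0)
    (W.indicator fun _ => C + C)
    (Eventually.of_forall fun s => ((hφm _).sub (hφm _)).norm.aestronglyMeasurable)
    (by
      filter_upwards [Icc_mem_nhds (sub_one_lt t) (lt_add_one t)] with s hs
      refine Eventually.of_forall fun x => ?_
      by_cases hx : x ∈ W
      · rw [indicator_of_mem hx, norm_norm]
        exact (norm_sub_le _ _).trans (add_le_add (hC _) (hC _))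
      · rw [indicator_of_notMem hx, hz s hs x hx,
          hz t ⟨by linarith, by linarith⟩ x hx]; simp)
    ((integrable_indicator_iff hW.measurableSet).2 (integrableOn_const
      (by
        refine ne_top_of_le_ne_top hW.measure_lt_top.ne (Measure.restrict_apply_le _ _))))
    (Eventually.of_forall fun x => by
      have hc : ContinuousAt (fun s => φ (ψ (-s) x)) t := by
        have h1 : ContinuousAt (fun s => φ (ψ s x)) (-t) := (h.hasDerivAt_test hφ x (-t)).continuousAt
        exact h1.comp_of_eq continuous_neg.continuousAt rfl
      have : Tendsto (fun s => ‖φ (ψ (-s) x) - φ (ψ (-t) x)‖) (𝓝 t)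
          (𝓝 ‖φ (ψ (-t) x) - φ (ψ (-t) x)‖) := (hc.sub continuousAt_const).norm
      simpa using this)
  simpa using this

/-- The group of operators of the Liouville equation on the integrable functions. -/
noncomputable def groupL1 (h : IsGlobalFlow U v ψ)
    (htr : ∀ x ∈ U, LinearMap.trace ℝ E (fderiv ℝ v x) = 0) (μ : Measure E) [μ.IsAddHaarMeasure]
    (t : ℝ) : Lp ℝ 1 (μ.restrict U) →ₗᵢ[ℝ] Lp ℝ 1 (μ.restrict U) :=
  Lp.compMeasurePreservingₗᵢ ℝ (ψ (-t)) (h.measurePreserving htr μ (-t))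

lemma coeFn_groupL1 (h : IsGlobalFlow U v ψ)
    (htr : ∀ x ∈ U, LinearMap.trace ℝ E (fderiv ℝ v x) = 0) (t : ℝ) (F : Lp ℝ 1 (μ.restrict U)) :
    h.groupL1 htr μ t F =ᵐ[μ.restrict U] fun x => F (ψ (-t) x) :=
  Lp.coeFn_compMeasurePreserving F _

/-- The integrable functions with continuous orbits. -/
noncomputable def continuousOrbit (h : IsGlobalFlow U v ψ)
    (htr : ∀ x ∈ U, LinearMap.trace ℝ E (fderiv ℝ v x) = 0) (μ : Measure E) [μ.IsAddHaarMeasure] :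
    Submodule ℝ (Lp ℝ 1 (μ.restrict U)) where
  carrier := {F | Continuous fun t => h.groupL1 htr μ t F}
  add_mem' := fun {F G} hF hG => by
    simp only [Set.mem_ofPred_eq, map_add] at *
    exact hF.add hG
  zero_mem' := by simp only [Set.mem_ofPred_eq, map_zero]; exact continuous_const
  smul_mem' := fun c F hF => by
    simp only [Set.mem_ofPred_eq, map_smul] at *
    exact hF.const_smul c

/-- An ε/3 argument: the operators are isometries, so approximating `F` by `G` approximates the
whole orbit uniformly in time. -/
lemma isClosed_continuousOrbit (h : IsGlobalFlow U v ψ)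
    (htr : ∀ x ∈ U, LinearMap.trace ℝ E (fderiv ℝ v x) = 0) :
    IsClosed (h.continuousOrbit htr μ : Set (Lp ℝ 1 (μ.restrict U))) := by
  refine isClosed_of_closure_subset fun F hF => ?_
  change Continuous fun t => h.groupL1 htr μ t F
  rw [continuous_iff_continuousAt]
  intro t
  rw [Metric.continuousAt_iff]
  intro ε hε
  obtain ⟨G, hG, hFG⟩ := Metric.mem_closure_iff.1 hF (ε / 3) (by positivity)
  have hG' : Continuous fun t => h.groupL1 htr μ t G := hG
  obtain ⟨δ, hδ, hd⟩ := Metric.continuousAt_iff.1 (hG'.continuousAt (x := t)) (ε / 3) (by positivity)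
  refine ⟨δ, hδ, fun {s} hs => ?_⟩
  have h1 : ∀ r, dist (h.groupL1 htr μ r F) (h.groupL1 htr μ r G) < ε / 3 := fun r => by
    rw [(h.groupL1 htr μ r).isometry.dist_eq]; exact hFG
  calc dist (h.groupL1 htr μ s F) (h.groupL1 htr μ t F) ≤
      dist (h.groupL1 htr μ s F) (h.groupL1 htr μ s G) +
      dist (h.groupL1 htr μ s G) (h.groupL1 htr μ t G) +
      dist (h.groupL1 htr μ t G) (h.groupL1 htr μ t F) := dist_triangle4 _ _ _ _
    _ < ε / 3 + ε / 3 + ε / 3 := by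
      have h2 := h1 t
      rw [dist_comm] at h2
      linarith [h1 s, hd hs]
    _ = ε := by ring

lemma mem_continuousOrbit_of_isTest (h : IsGlobalFlow U v ψ)
    (htr : ∀ x ∈ U, LinearMap.trace ℝ E (fderiv ℝ v x) = 0) {φ : E → ℝ} (hφ : IsTest U φ)
    {F : Lp ℝ 1 (μ.restrict U)} (hF : F =ᵐ[μ.restrict U] φ) : F ∈ h.continuousOrbit htr μ := by
  change Continuous fun t => h.groupL1 htr μ t F
  rw [continuous_iff_continuousAt]
  intro t
  rw [ContinuousAt, tendsto_iff_norm_sub_tendsto_zero]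
  refine (h.tendsto_integral_comp_sub (μ := μ) hφ t).congr fun s => ?_
  rw [L1.norm_eq_integral_norm]
  refine integral_congr_ae ?_
  filter_upwards [Lp.coeFn_sub (h.groupL1 htr μ s F) (h.groupL1 htr μ t F),
    h.coeFn_groupL1 htr s F, h.coeFn_groupL1 htr t F,
    (h.measurePreserving htr μ (-s)).quasiMeasurePreserving.ae_eq_comp hF,
    (h.measurePreserving htr μ (-t)).quasiMeasurePreserving.ae_eq_comp hF] with x h1 h2 h3 h4 h5
  simp only [Function.comp_apply] at h4 h5
  rw [h1, Pi.sub_apply, h2, h3, h4, h5]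

end IsGlobalFlow

end Transport

end NearestNeighbour


namespace NearestNeighbour

section Dynamics

/-! ### Fields of pair forces -/

/-- The Hamilton field of the particles of `X` in which the pairs `(j, k)` with `r j k` interact. -/
noncomputable def bondField (Φ : ℝ → ℝ) {X : Finset ℤ} (r : X → X → Prop) [DecidableRel r] (x : Phase X) :
    Phase X := fun j =>
  ((x j).2,
    - (∑ k : X, if r j k then deriv Φ ((x j).1 - (x k).1) else 0)
    + ∑ i : X, if r i j then deriv Φ ((x i).1 - (x j).1) else 0)

/-- The configurations in which the pairs `(j, k)` with `r j k` are allowed. -/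
def bondAllowed (σ : ℝ) {X : Finset ℤ} (r : X → X → Prop) : Set (Phase X) :=
  {x | ∀ j k : X, r j k → σ + (x j).1 < (x k).1}

lemma isOpen_bondAllowed (σ : ℝ) {X : Finset ℤ} (r : X → X → Prop) :
    IsOpen (bondAllowed σ r) := by
  have : bondAllowed σ r = ⋂ j : X, ⋂ k : X, {x | r j k → σ + (x j).1 < (x k).1} := by
    ext x; simp [bondAllowed]
  rw [this]
  refine isOpen_iInter_of_finite fun j => isOpen_iInter_of_finite fun k => ?_
  by_cases h : r j k
  · simp only [h, forall_const]
    exact isOpen_lt (by fun_prop) (by fun_prop)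
  · simp [h]

/-- The forces are evaluated at q_j - q_k with `j` to the left of `k`, that is, below -σ; evenness
carries the regularity to that half-line. -/
lemma IsPotential.contDiffOn_neg {σ R : ℝ} {Φ : ℝ → ℝ} (hΦ : IsPotential σ R Φ) :
    ContDiffOn ℝ 2 Φ (Iio (-σ)) := by
  have e : Φ = fun q => Φ (-q) := funext fun q => (hΦ.even q).symm
  rw [e]
  exact hΦ.contDiffOn.comp (g := Φ) (by fun_prop) fun q hq => by
    simp only [mem_Iio, mem_Ioi] at *; linarith

lemma IsPotential.contDiffOn_deriv {σ R : ℝ} {Φ : ℝ → ℝ} (hΦ : IsPotential σ R Φ) :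
    ContDiffOn ℝ 1 (deriv Φ) (Iio (-σ)) :=
  hΦ.contDiffOn_neg.deriv_of_isOpen isOpen_Iio (by norm_num)

lemma contDiffOn_bondField {σ R : ℝ} {Φ : ℝ → ℝ} (hΦ : IsPotential σ R Φ) {X : Finset ℤ}
    (r : X → X → Prop) [DecidableRel r] : ContDiffOn ℝ 1 (bondField Φ r) (bondAllowed σ r) := by
  have hF : ∀ j k : X, r j k →
      ContDiffOn ℝ 1 (fun x : Phase X => deriv Φ ((x j).1 - (x k).1)) (bondAllowed σ r) :=
    fun j k h => hΦ.contDiffOn_deriv.comp (f := fun x : Phase X => (x j).1 - (x k).1)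
      (by fun_prop) fun x hx => by
        have := hx j k h
        simp only [mem_Iio]; linarith
  refine contDiffOn_pi.2 fun j => ContDiffOn.prodMk (by fun_prop) (ContDiffOn.add
    (ContDiffOn.neg (ContDiffOn.sum fun k _ => ?_)) (ContDiffOn.sum fun k _ => ?_))
  · by_cases h : r j k
    · simp only [h, if_true]; exact hF j k h
    · simp only [h, if_false]; exact contDiffOn_const
  · by_cases h : r k j
    · simp only [h, if_true]; exact hF k j h
    · simp only [h, if_false]; exact contDiffOn_const

/-- A field whose first components are the momenta and whose second components do not depend on
the momenta is divergence free. -/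
lemma trace_fderiv_eq_zero {ι : Type*} [Fintype ι] {v : (ι → ℝ × ℝ) → ι → ℝ × ℝ}
    {x : ι → ℝ × ℝ} (hd : DifferentiableAt ℝ v x) (h1 : ∀ y i, (v y i).1 = (y i).2)
    (h2 : ∀ y z, (∀ i, (y i).1 = (z i).1) → ∀ i, (v y i).2 = (v z i).2) :
    LinearMap.trace ℝ (ι → ℝ × ℝ) (fderiv ℝ v x) = 0 := by
  set A := fderiv ℝ v x
  have hA : HasFDerivAt v A x := hd.hasFDerivAt
  have hA1 : ∀ ξ i, (A ξ i).1 = (ξ i).2 := by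
    intro ξ i
    have e1 : HasFDerivAt (fun y => (v y i).1)
        ((ContinuousLinearMap.fst ℝ ℝ ℝ).comp ((ContinuousLinearMap.proj i).comp A)) x :=
      ((ContinuousLinearMap.fst ℝ ℝ ℝ).hasFDerivAt).comp x
        ((ContinuousLinearMap.proj (R := ℝ) (φ := fun _ : ι => ℝ × ℝ) i).hasFDerivAt.comp x hA)
    have e2 : HasFDerivAt (fun y : ι → ℝ × ℝ => (y i).2)
        ((ContinuousLinearMap.snd ℝ ℝ ℝ).comp
          (ContinuousLinearMap.proj (R := ℝ) (φ := fun _ : ι => ℝ × ℝ) i)) x :=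
      ((ContinuousLinearMap.snd ℝ ℝ ℝ).comp
          (ContinuousLinearMap.proj (R := ℝ) (φ := fun _ : ι => ℝ × ℝ) i)).hasFDerivAt
    simp only [h1] at e1
    have := congrArg (fun L => L ξ) (e1.unique e2)
    simpa using this
  have hA2 : ∀ ξ : ι → ℝ × ℝ, (∀ i, (ξ i).1 = 0) → ∀ i, (A ξ i).2 = 0 := by
    intro ξ hξ i
    have e1 : HasDerivAt (fun s : ℝ => x + s • ξ) ξ 0 := by
      simpa using ((hasDerivAt_id (0 : ℝ)).smul_const ξ).const_add x
    have e2 : HasDerivAt (fun s : ℝ => v (x + s • ξ)) (A ξ) 0 := by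
      have : HasFDerivAt v A (x + (0 : ℝ) • ξ) := by simpa using hA
      exact this.comp_hasDerivAt 0 e1
    have e3 : HasDerivAt (fun s : ℝ => (v (x + s • ξ) i).2) (A ξ i).2 0 :=
      (hasDerivAt_pi.1 e2 i).snd
    have e4 : (fun s : ℝ => (v (x + s • ξ) i).2) = fun _ => (v x i).2 := by
      funext s
      exact h2 _ _ (fun k => by simp [hξ k]) i
    rw [e4] at e3
    exact e3.unique (hasDerivAt_const _ _)
  -- With the projections to positions and to momenta, A = A Pq + A Pp. Both summands square to
  -- zero: the position part of Aξ is the momentum part of ξ, and the momentum part of Aξ does not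
  -- see momenta. Nilpotent maps have trace zero.
  let Pq : (ι → ℝ × ℝ) →ₗ[ℝ] (ι → ℝ × ℝ) :=
    LinearMap.pi fun i => (LinearMap.inl ℝ ℝ ℝ ∘ₗ LinearMap.fst ℝ ℝ ℝ) ∘ₗ LinearMap.proj i
  let Pp : (ι → ℝ × ℝ) →ₗ[ℝ] (ι → ℝ × ℝ) :=
    LinearMap.pi fun i => (LinearMap.inr ℝ ℝ ℝ ∘ₗ LinearMap.snd ℝ ℝ ℝ) ∘ₗ LinearMap.proj i
  have hq : ∀ ξ i, Pq ξ i = ((ξ i).1, 0) := fun ξ i => rfl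
  have hp : ∀ ξ i, Pp ξ i = (0, (ξ i).2) := fun ξ i => rfl
  have hsum : (A : (ι → ℝ × ℝ) →ₗ[ℝ] (ι → ℝ × ℝ)) =
      (A : (ι → ℝ × ℝ) →ₗ[ℝ] (ι → ℝ × ℝ)) * Pq + (A : (ι → ℝ × ℝ) →ₗ[ℝ] (ι → ℝ × ℝ)) * Pp := by
    rw [← mul_add]
    have : Pq + Pp = 1 := by
      refine LinearMap.ext fun ξ => funext fun i => ?_
      simp [hq, hp]
    rw [this, mul_one]
  have n1 : IsNilpotent ((A : (ι → ℝ × ℝ) →ₗ[ℝ] (ι → ℝ × ℝ)) * Pq) := by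
    refine ⟨2, LinearMap.ext fun ξ => ?_⟩
    have : Pq (A (Pq ξ)) = 0 := by
      funext i
      rw [hq, hA1, hq]; rfl
    simp [pow_two, this]
  have n2 : IsNilpotent ((A : (ι → ℝ × ℝ) →ₗ[ℝ] (ι → ℝ × ℝ)) * Pp) := by
    refine ⟨2, LinearMap.ext fun ξ => ?_⟩
    have : Pp (A (Pp ξ)) = 0 := by
      funext i
      rw [hp, hA2 _ fun i => by rw [hp]]; rfl
    simp [pow_two, this]
  rw [hsum, map_add, (LinearMap.isNilpotent_trace_of_isNilpotent n1).eq_zero,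
    (LinearMap.isNilpotent_trace_of_isNilpotent n2).eq_zero, add_zero]

lemma trace_fderiv_bondField {σ R : ℝ} {Φ : ℝ → ℝ} (hΦ : IsPotential σ R Φ) {X : Finset ℤ}
    (r : X → X → Prop) [DecidableRel r] : ∀ x ∈ bondAllowed σ r,
    LinearMap.trace ℝ (Phase X) (fderiv ℝ (bondField Φ r) x) = 0 := fun x hx =>
  trace_fderiv_eq_zero (((contDiffOn_bondField hΦ r).contDiffAt
    ((isOpen_bondAllowed σ r).mem_nhds hx)).differentiableAt one_ne_zero) (fun _ _ => rfl)
    fun y z h i => by simp only [bondField, h]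

/-! ### Energy -/

/-- The energy of the particles of `X` in which the pairs `(j, k)` with `r j k` interact. -/
noncomputable def energy (Φ : ℝ → ℝ) {X : Finset ℤ} (r : X → X → Prop) [DecidableRel r] (x : Phase X) : ℝ :=
  (∑ j : X, (x j).2 ^ 2 / 2) + ∑ j : X, ∑ k : X, if r j k then Φ ((x j).1 - (x k).1) else 0

/-- The scalar `c` allows for a cut off: multiplying the field by a function only changes the speed
along the trajectory, not the energy surface. This makes the energy bounds available for the cut off
equations. -/
lemma hasDerivAt_energy {σ R : ℝ} {Φ : ℝ → ℝ} (hΦ : IsPotential σ R Φ) {X : Finset ℤ}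
    (r : X → X → Prop) [DecidableRel r] {γ : ℝ → Phase X} {c t : ℝ} (hmem : γ t ∈ bondAllowed σ r)
    (hγ : HasDerivAt γ (c • bondField Φ r (γ t)) t) :
    HasDerivAt (fun s => energy Φ r (γ s)) 0 t := by
  have hj : ∀ j, HasDerivAt (fun s => γ s j) (c • bondField Φ r (γ t) j) t := fun j =>
    hasDerivAt_pi.1 hγ j
  have hq : ∀ j, HasDerivAt (fun s => (γ s j).1) (c * (γ t j).2) t := fun j => (hj j).fst
  have hp : ∀ j, HasDerivAt (fun s => (γ s j).2) (c * (bondField Φ r (γ t) j).2) t :=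
    fun j => (hj j).snd
  have hkin := HasDerivAt.fun_sum (u := Finset.univ) fun (j : X) _ =>
    ((hp j).pow 2).div_const 2
  have hpot : ∀ j k : X, HasDerivAt
      (fun s => if r j k then Φ ((γ s j).1 - (γ s k).1) else 0)
      (if r j k then deriv Φ ((γ t j).1 - (γ t k).1) * (c * (γ t j).2 - c * (γ t k).2) else 0) t := by
    intro j k
    by_cases h : r j k
    · simp only [h, if_true]
      have hd : HasDerivAt Φ (deriv Φ ((γ t j).1 - (γ t k).1)) ((γ t j).1 - (γ t k).1) := by
        have hlt := hmem j k h
        exact ((hΦ.contDiffOn_neg.contDiffAt (Iio_mem_nhds (by linarith))).differentiableAt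
          two_ne_zero).hasDerivAt
      exact hd.comp t ((hq j).sub (hq k))
    · simp only [h, if_false]; exact hasDerivAt_const _ _
  have hpots := HasDerivAt.fun_sum (u := Finset.univ) fun (j : X) _ =>
    HasDerivAt.fun_sum (u := Finset.univ) fun (k : X) _ => hpot j k
  refine (hkin.add hpots).congr_deriv ?_
  have e1 : ∀ j : X, (2 : ℕ) * (γ t j).2 ^ (2 - 1) * (c * (bondField Φ r (γ t) j).2) / 2 =
      -(∑ k : X, if r j k then c * (γ t j).2 * deriv Φ ((γ t j).1 - (γ t k).1) else 0) +
      ∑ i : X, if r i j then c * (γ t j).2 * deriv Φ ((γ t i).1 - (γ t j).1) else 0 := by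
    intro j
    have : ∀ (p : X → Prop) [DecidablePred p] (a : X → ℝ),
        (∑ k : X, if p k then c * (γ t j).2 * a k else 0) =
        c * (γ t j).2 * ∑ k : X, if p k then a k else 0 := by
      intro p _ a
      rw [Finset.mul_sum]
      exact Finset.sum_congr rfl fun k _ => by split_ifs <;> simp
    rw [this, this]
    simp only [bondField]
    push_cast
    ring
  simp only [e1]
  rw [Finset.sum_add_distrib, Finset.sum_neg_distrib]
  conv_lhs => enter [1, 2]; rw [Finset.sum_comm]
  rw [← Finset.sum_neg_distrib, ← Finset.sum_add_distrib, ← Finset.sum_add_distrib]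
  refine Finset.sum_eq_zero fun j _ => ?_
  rw [← Finset.sum_neg_distrib, ← Finset.sum_add_distrib, ← Finset.sum_add_distrib]
  refine Finset.sum_eq_zero fun k _ => ?_
  split_ifs <;> ring

/-- Near the core Φ is nonnegative since it tends to +∞, beyond the range it is zero, and the
remaining distances form a compact interval on which it is continuous. -/
lemma IsPotential.exists_lower_bound {σ R : ℝ} {Φ : ℝ → ℝ} (hΦ : IsPotential σ R Φ) :
    ∃ C, 0 ≤ C ∧ ∀ q, q < -σ → -C ≤ Φ q := by
  have h1 : ∀ᶠ q in 𝓝[>] σ, 0 ≤ Φ q := hΦ.hard_core.eventually_ge_atTop 0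
  obtain ⟨s, hs, h⟩ := mem_nhdsGT_iff_exists_Ioo_subset.1 h1
  have hs' : σ < s := hs
  have hc : ContinuousOn Φ (Icc s (max s R)) := hΦ.contDiffOn.continuousOn.mono fun q hq =>
    lt_of_lt_of_le hs' hq.1
  obtain ⟨C, hC⟩ := isCompact_Icc.exists_bound_of_continuousOn hc
  refine ⟨max C 0, le_max_right _ _, fun q hq => ?_⟩
  rw [← hΦ.even q]
  have hq' : σ < -q := by linarith
  rcases lt_or_ge (-q) s with h2 | h2
  · have : 0 ≤ Φ (-q) := h ⟨hq', h2⟩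
    linarith [le_max_right C 0]
  · rcases le_or_gt (-q) (max s R) with h3 | h3
    · have := neg_le_of_abs_le (hC (-q) ⟨h2, h3⟩)
      linarith [le_max_left C 0]
    · rw [hΦ.finite_range (-q) (lt_of_lt_of_le (lt_of_le_of_lt (le_max_right _ _) h3)
        (le_abs_self _))]
      linarith [le_max_right C 0]

/-- All pair energies are bounded below, so a bound on the total energy bounds every momentum and
every pair energy from above. Since Φ blows up at the core, neighbours then keep a distance bounded
away from σ. The momentum bound `C` is independent of the size `L` of the configuration, so
positions can be controlled afterwards. -/
lemma exists_compact_of_energy_le {σ R : ℝ} {Φ : ℝ → ℝ} (hΦ : IsPotential σ R Φ) {X : Finset ℤ}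
    (r : X → X → Prop) [DecidableRel r] (e : ℝ) :
    ∃ C : ℝ, 0 ≤ C ∧ ∀ L : ℝ, ∃ K, IsCompact K ∧ K ⊆ bondAllowed σ r ∧
      ∀ x ∈ bondAllowed σ r, energy Φ r x ≤ e →
        (∀ j, |(x j).2| ≤ C) ∧ ((∀ j, |(x j).1| ≤ L) → x ∈ K) := by
  obtain ⟨c, hc0, hc⟩ := hΦ.exists_lower_bound
  set N : ℝ := ∑ _j : X, ∑ _k : X, c
  have hpot_ge : ∀ x ∈ bondAllowed σ r, ∀ j k : X,
      -c ≤ if r j k then Φ ((x j).1 - (x k).1) else 0 := by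
    intro x hx j k
    split_ifs with h
    · exact hc _ (by linarith [hx j k h])
    · linarith
  -- Adding `c` makes every pair term nonnegative at the total cost `N`, after which a single term
  -- is bounded by the whole sum.
  set e' := |e| + N + c
  have hN : 0 ≤ N := Finset.sum_nonneg fun _ _ => Finset.sum_nonneg fun _ _ => hc0
  have hpot_le : ∀ x ∈ bondAllowed σ r, energy Φ r x ≤ e → ∀ j k, r j k →
      Φ ((x j).1 - (x k).1) ≤ e' := by
    intro x hx he j k hjk
    have h1 : (∑ j : X, ∑ k : X, ((if r j k then Φ ((x j).1 - (x k).1) else 0) + c)) ≤ e + N := by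
      simp only [Finset.sum_add_distrib]
      have : 0 ≤ ∑ j : X, (x j).2 ^ 2 / 2 := Finset.sum_nonneg fun _ _ => by positivity
      simp only [energy] at he
      linarith
    have h2 : ((if r j k then Φ ((x j).1 - (x k).1) else 0) + c) ≤
        ∑ j : X, ∑ k : X, ((if r j k then Φ ((x j).1 - (x k).1) else 0) + c) :=
      (Finset.single_le_sum (f := fun k => ((if r j k then Φ ((x j).1 - (x k).1) else 0) + c))
        (fun k _ => by linarith [hpot_ge x hx j k]) (Finset.mem_univ k)).trans
      (Finset.single_le_sum
        (f := fun j => ∑ k : X, ((if r j k then Φ ((x j).1 - (x k).1) else 0) + c))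
        (fun j _ => Finset.sum_nonneg fun k _ => by linarith [hpot_ge x hx j k])
        (Finset.mem_univ j))
    rw [if_pos hjk] at h2
    simp only [e']
    linarith [le_abs_self e]
  have hkin_le : ∀ x ∈ bondAllowed σ r, energy Φ r x ≤ e → ∀ j, (x j).2 ^ 2 ≤ 2 * e' := by
    intro x hx he j
    have h1 : -N ≤ ∑ j : X, ∑ k : X, if r j k then Φ ((x j).1 - (x k).1) else 0 := by
      simp only [N, ← Finset.sum_neg_distrib]
      exact Finset.sum_le_sum fun j _ => Finset.sum_le_sum fun k _ => hpot_ge x hx j k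
    have h2 : (x j).2 ^ 2 / 2 ≤ ∑ j : X, (x j).2 ^ 2 / 2 :=
      Finset.single_le_sum (f := fun j : X => (x j).2 ^ 2 / 2) (fun j _ => by positivity)
        (Finset.mem_univ j)
    simp only [energy] at he
    simp only [e']
    linarith [le_abs_self e]
  have h1 : ∀ᶠ q in 𝓝[>] σ, e' < Φ q := hΦ.hard_core.eventually_gt_atTop e'
  obtain ⟨s, hs, hsub⟩ := mem_nhdsGT_iff_exists_Ioo_subset.1 h1
  have hs' : σ < s := hs
  refine ⟨Real.sqrt (2 * e'), Real.sqrt_nonneg _, fun L => ?_⟩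
  refine ⟨{x | (∀ j, x j ∈ Icc (-L) L ×ˢ Icc (-Real.sqrt (2 * e')) (Real.sqrt (2 * e'))) ∧
    ∀ j k, r j k → s + (x j).1 ≤ (x k).1}, ?_, ?_, ?_⟩
  · have hcl : IsClosed {x : Phase X | ∀ j k, r j k → s + (x j).1 ≤ (x k).1} := by
      simp only [Set.ofPred_forall]
      refine isClosed_iInter fun j => isClosed_iInter fun k => isClosed_iInter fun _ => ?_
      exact isClosed_le (by fun_prop) (by fun_prop)
    have hcp : IsCompact {x : Phase X |
        ∀ j, x j ∈ Icc (-L) L ×ˢ Icc (-Real.sqrt (2 * e')) (Real.sqrt (2 * e'))} := by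
      have := isCompact_univ_pi (X := fun _ : X => ℝ × ℝ)
        (s := fun _ => Icc (-L) L ×ˢ Icc (-Real.sqrt (2 * e')) (Real.sqrt (2 * e')))
        fun _ => isCompact_Icc.prod isCompact_Icc
      simpa [Set.pi] using this
    exact hcp.inter_right hcl
  · rintro x ⟨-, hx⟩ j k hjk
    linarith [hx j k hjk]
  · intro x hx he
    have hp : ∀ j, |(x j).2| ≤ Real.sqrt (2 * e') := fun j =>
      Real.abs_le_sqrt (hkin_le x hx he j)
    refine ⟨hp, fun hL => ⟨fun j => ⟨abs_le.1 (hL j), abs_le.1 (hp j)⟩, fun j k hjk => ?_⟩⟩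
    by_contra hlt
    push Not at hlt
    have h3 : (x k).1 - (x j).1 ∈ Ioo σ s := ⟨by linarith [hx j k hjk], by linarith⟩
    have h4 : e' < Φ ((x k).1 - (x j).1) := hsub h3
    have h5 := hpot_le x hx he j k hjk
    rw [← hΦ.even, neg_sub] at h5
    linarith

/-- The Hamilton equations are globally solvable. -/
lemma exists_trajectory_bondField {σ R : ℝ} {Φ : ℝ → ℝ} (hΦ : IsPotential σ R Φ) {X : Finset ℤ}
    (r : X → X → Prop) [DecidableRel r] {x₀ : Phase X} (hx₀ : x₀ ∈ bondAllowed σ r) :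
    ∃ γ : ℝ → Phase X, γ 0 = x₀ ∧
      ∀ t, γ t ∈ bondAllowed σ r ∧ HasDerivAt γ (bondField Φ r (γ t)) t := by
  refine exists_global_trajectory (isOpen_bondAllowed σ r) (contDiffOn_bondField hΦ r) hx₀
    fun T => ?_
  obtain ⟨C, hC0, hC⟩ := exists_compact_of_energy_le hΦ r (energy Φ r x₀)
  -- The velocities are at most `C`, also after multiplication by a cut off with values in [0, 1],
  -- so up to time `T` the positions stay below `‖x₀‖ + C * T`.
  obtain ⟨K, hK, hKU, hKx⟩ := hC (‖x₀‖ + C * T)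
  refine ⟨K, hK, hKU, fun χ γ hχ hγ0 hγ t ht => ?_⟩
  have hE : ∀ s, energy Φ r (γ s) = energy Φ r x₀ := fun s => by
    have hd := fun s => hasDerivAt_energy hΦ r (hγ s).1 (hγ s).2
    rw [← hγ0]
    exact is_const_of_deriv_eq_zero (fun s => (hd s).differentiableAt) (fun s => (hd s).deriv) s 0
  have hp : ∀ s j, |(γ s j).2| ≤ C := fun s j => (hKx (γ s) (hγ s).1 (hE s).le).1 j
  refine (hKx (γ t) (hγ t).1 (hE t).le).2 fun j => ?_
  have hq : ∀ s, HasDerivAt (fun s => (γ s j).1) (χ (γ s) * (γ s j).2) s := fun s =>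
    (hasDerivAt_pi.1 (hγ s).2 j).fst
  have hmv : ‖(γ t j).1 - (γ 0 j).1‖ ≤ C * ‖t - 0‖ :=
    Convex.norm_image_sub_le_of_norm_hasDerivWithin_le (s := univ)
      (f := fun s => (γ s j).1) (fun s _ => (hq s).hasDerivWithinAt) (fun s _ => by
        rw [norm_mul]
        have h1 : ‖χ (γ s)‖ ≤ 1 := by
          rw [Real.norm_eq_abs, abs_of_nonneg (hχ _).1]; exact (hχ _).2
        calc ‖χ (γ s)‖ * ‖(γ s j).2‖ ≤ 1 * C :=
              mul_le_mul h1 (hp s j) (norm_nonneg _) zero_le_one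
          _ = C := one_mul C) convex_univ trivial trivial
  have h0 : |(x₀ j).1| ≤ ‖x₀‖ := (norm_fst_le (x₀ j)).trans (norm_le_pi_norm x₀ j)
  have htT : ‖t - 0‖ ≤ T := by
    rw [sub_zero]; exact (abs_lt.2 ht).le
  rw [hγ0, Real.norm_eq_abs] at hmv
  have h3 := abs_sub_abs_le_abs_sub (γ t j).1 (x₀ j).1
  have h4 : C * ‖t - 0‖ ≤ C * T := mul_le_mul_of_nonneg_left htT hC0
  linarith

/-! ### The flow of the particles of a set -/

lemma flow_spec {σ R : ℝ} {Φ : ℝ → ℝ} (hΦ : IsPotential σ R Φ) {X : Finset ℤ} {x : Phase X}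
    (hx : x ∈ allowed σ X) :
    IsTrajectory σ Φ X (fun t => flow σ Φ X t x) ∧ flow σ Φ X 0 x = x := by
  have h : ∃ γ, IsTrajectory σ Φ X γ ∧ γ 0 = x := by
    obtain ⟨γ, h0, hγ⟩ := exists_trajectory_bondField hΦ (fun j k : X => (k : ℤ) = next j) hx
    exact ⟨γ, hγ, h0⟩
  have e : (fun t => flow σ Φ X t x) = Classical.choose h := by
    funext t; simp only [flow, dif_pos h]
  have := Classical.choose_spec h
  rw [← e] at this
  exact this

lemma flow_off {σ : ℝ} {Φ : ℝ → ℝ} {X : Finset ℤ} {x : Phase X} (hx : x ∉ allowed σ X) (t : ℝ) :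
    flow σ Φ X t x = x := by
  have h : ¬ ∃ γ, IsTrajectory σ Φ X γ ∧ γ 0 = x := by
    rintro ⟨γ, hγ, rfl⟩
    exact hx (hγ 0).1
  simp only [flow, dif_neg h]

lemma isGlobalFlow_flow {σ R : ℝ} {Φ : ℝ → ℝ} (hΦ : IsPotential σ R Φ) (X : Finset ℤ) :
    IsGlobalFlow (allowed σ X) (hamiltonField Φ X) (flow σ Φ X) where
  isOpen := isOpen_allowed σ X
  contDiffOn_field := contDiffOn_bondField hΦ _
  zero x := by
    by_cases hx : x ∈ allowed σ X
    · exact (flow_spec hΦ hx).2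
    · exact flow_off hx 0
  off t x hx := flow_off hx t
  mem t x hx := ((flow_spec hΦ hx).1 t).1
  deriv t x hx := ((flow_spec hΦ hx).1 t).2

/-! ### The flow in which the parts of a partition move independently -/

/-- Neighbours in the same part of `Q`. -/
def bondIn {X : Finset ℤ} (Q : Finpartition X) (j k : X) : Prop :=
  (k : ℤ) = next j ∧ (k : ℤ) ∈ Q.part j

instance {X : Finset ℤ} (Q : Finpartition X) : DecidableRel (bondIn Q) := fun _ _ =>
  inferInstanceAs (Decidable (_ ∧ _))

lemma mem_part_comm {X : Finset ℤ} (Q : Finpartition X) {j k : ℤ} :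
    k ∈ Q.part j ↔ j ∈ Q.part k := by
  rw [Finpartition.mem_part_iff_exists, Finpartition.mem_part_iff_exists]
  exact ⟨fun ⟨p, h1, h2, h3⟩ => ⟨p, h1, h3, h2⟩, fun ⟨p, h1, h2, h3⟩ => ⟨p, h1, h3, h2⟩⟩

/-- Independent motion of the parts amounts to keeping only the bonds inside the parts. Thus what
was proved for arbitrary sets of bonds applies to partitions. -/
lemma allowedParts_eq (σ : ℝ) {X : Finset ℤ} (Q : Finpartition X) :
    allowedParts σ Q = bondAllowed σ (bondIn Q) := by
  ext x
  constructor
  · rintro h j k ⟨h1, h2⟩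
    exact h ⟨Q.part j, Q.part_mem.2 j.2⟩ ⟨j, Q.mem_part_self.2 j.2⟩ ⟨k, h2⟩ h1
  · intro h B j k hjk
    exact h ⟨j, Q.le B.2 j.2⟩ ⟨k, Q.le B.2 k.2⟩ ⟨hjk, by
      simp only
      rw [Q.part_eq_of_mem B.2 j.2]; exact k.2⟩

lemma isOpen_allowedParts (σ : ℝ) {X : Finset ℤ} (Q : Finpartition X) :
    IsOpen (allowedParts σ Q) := by
  rw [allowedParts_eq]; exact isOpen_bondAllowed _ _

lemma allowed_subset_allowedParts (σ : ℝ) {X : Finset ℤ} (Q : Finpartition X) :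
    allowed σ X ⊆ allowedParts σ Q := by
  intro x hx B j k hjk
  exact hx ⟨j, Q.le B.2 j.2⟩ ⟨k, Q.le B.2 k.2⟩ hjk

lemma proj_mem_allowed {σ : ℝ} {X B : Finset ℤ} (h : B ⊆ X) {x : Phase X} (hx : x ∈ allowed σ X) :
    proj h x ∈ allowed σ B := fun j k hjk => hx ⟨j, h j.2⟩ ⟨k, h k.2⟩ hjk

/-- Each part of `Q` moves along its own trajectory. -/
noncomputable def partFlow (σ : ℝ) (Φ : ℝ → ℝ) {X : Finset ℤ} (Q : Finpartition X) (t : ℝ)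
    (x : Phase X) : Phase X :=
  open Classical in
  if x ∈ allowedParts σ Q then glue Q fun B => flow σ Φ B t (proj (Q.le B.2) x) else x

lemma sum_ite_mem_subset {X B : Finset ℤ} (h : B ⊆ X) (p : ℤ → Prop) [DecidablePred p] (a : X → ℝ) :
    (∑ k : X, if p k ∧ (k : ℤ) ∈ B then a k else 0) =
      ∑ k : B, if p k then a ⟨k, h k.2⟩ else 0 := by
  have h1 : (∑ k : B, if p k then a ⟨k, h k.2⟩ else 0) =
      ∑ k ∈ Finset.univ.image (fun k : B => (⟨k, h k.2⟩ : X)),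
        if p k ∧ (k : ℤ) ∈ B then a k else 0 := by
    rw [Finset.sum_image]
    · exact Finset.sum_congr rfl fun k _ => by simp
    · intro k _ l _ hkl
      exact Subtype.ext (congrArg (fun z : X => (z : ℤ)) hkl)
  rw [h1]
  symm
  refine Finset.sum_subset (Finset.subset_univ _) fun k _ hk => ?_
  rw [if_neg]
  rintro ⟨-, hkB⟩
  exact hk (Finset.mem_image.2 ⟨⟨k, hkB⟩, Finset.mem_univ _, rfl⟩)

lemma bondField_bondIn_apply (Φ : ℝ → ℝ) {X : Finset ℤ} (Q : Finpartition X) (x : Phase X) :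
    bondField Φ (bondIn Q) x = glue Q fun B => hamiltonField Φ B (proj (Q.le B.2) x) := by
  funext i
  have hi := Q.part_mem.2 i.2
  refine Prod.ext rfl ?_
  simp only [bondField, glue, hamiltonField, bondIn]
  congr 1
  · congr 1
    exact sum_ite_mem_subset (Q.le hi) (fun k => k = next i)
      fun k => deriv Φ ((x i).1 - (x k).1)
  · have : ∀ k : X, ((i : ℤ) = next k ∧ (i : ℤ) ∈ Q.part k) ↔
        ((i : ℤ) = next k ∧ (k : ℤ) ∈ Q.part i) := fun k => by rw [mem_part_comm]
    simp only [this]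
    exact sum_ite_mem_subset (Q.le hi) (fun k => (i : ℤ) = next k)
      fun k => deriv Φ ((x k).1 - (x i).1)

lemma glue_proj {X : Finset ℤ} (Q : Finpartition X) (x : Phase X) :
    (glue Q fun B => proj (Q.le B.2) x) = x := rfl

lemma glue_mem_allowedParts {σ : ℝ} {X : Finset ℤ} (Q : Finpartition X)
    {y : (B : Q.parts) → Phase B} (hy : ∀ B : Q.parts, y B ∈ allowed σ B) : glue Q y ∈ allowedParts σ Q :=
  fun B => by rw [proj_glue]; exact hy B

/-- With the bonds across cuts removed, the field is the glueing of the Hamilton fields of the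
parts, so glued trajectories are its trajectories. -/
lemma isGlobalFlow_partFlow {σ R : ℝ} {Φ : ℝ → ℝ} (hΦ : IsPotential σ R Φ) {X : Finset ℤ}
    (Q : Finpartition X) :
    IsGlobalFlow (allowedParts σ Q) (bondField Φ (bondIn Q)) (partFlow σ Φ Q) where
  isOpen := isOpen_allowedParts σ Q
  contDiffOn_field := by rw [allowedParts_eq]; exact contDiffOn_bondField hΦ _
  zero x := by
    simp only [partFlow]
    split_ifs with hx
    · simp only [(isGlobalFlow_flow hΦ _).zero]; rfl
    · rfl
  off t x hx := by simp only [partFlow, if_neg hx]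
  mem t x hx := by
    simp only [partFlow, if_pos hx]
    exact glue_mem_allowedParts Q fun B : Q.parts => (isGlobalFlow_flow hΦ B).mem t _ (hx B)
  deriv t x hx := by
    simp only [partFlow, if_pos hx]
    rw [bondField_bondIn_apply]
    simp only [proj_glue]
    refine hasDerivAt_pi.2 fun i => ?_
    have := (isGlobalFlow_flow hΦ _).deriv t _ (hx ⟨Q.part i, Q.part_mem.2 i.2⟩)
    exact hasDerivAt_pi.1 this ⟨i, Q.mem_part_self.2 i.2⟩

lemma trace_partField {σ R : ℝ} {Φ : ℝ → ℝ} (hΦ : IsPotential σ R Φ) {X : Finset ℤ}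
    (Q : Finpartition X) : ∀ x ∈ allowedParts σ Q,
    LinearMap.trace ℝ (Phase X) (fderiv ℝ (bondField Φ (bondIn Q)) x) = 0 := by
  rw [allowedParts_eq]; exact trace_fderiv_bondField hΦ _

lemma groupProduct_eq {σ : ℝ} {Φ : ℝ → ℝ} {X : Finset ℤ} (Q : Finpartition X) (t : ℝ)
    (f : Phase X → ℝ) {x : Phase X} (hx : x ∈ allowedParts σ Q) :
    groupProduct σ Φ Q t f x = f (partFlow σ Φ Q (-t) x) := by
  simp only [groupProduct, partFlow, if_pos hx]

lemma proj_partFlow {σ : ℝ} {Φ : ℝ → ℝ} {X : Finset ℤ} (Q : Finpartition X) (t : ℝ)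
    {x : Phase X} (hx : x ∈ allowedParts σ Q) (B : Q.parts) :
    proj (Q.le B.2) (partFlow σ Φ Q t x) = flow σ Φ B t (proj (Q.le B.2) x) := by
  simp only [partFlow, if_pos hx]
  exact proj_glue Q _ B

/-! ### The Liouville operator as the derivative along the Hamilton field -/

lemma fderiv_eq_sum {X : Finset ℤ} (φ : Phase X → ℝ) (x ξ : Phase X) :
    fderiv ℝ φ x ξ = ∑ j : X, ((ξ j).1 * dq j φ x + (ξ j).2 * dp j φ x) := by
  have e : ξ = ∑ j : X, ((ξ j).1 • (Pi.single j (1, 0) : Phase X) +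
      (ξ j).2 • (Pi.single j (0, 1) : Phase X)) := by
    conv_lhs => rw [← Finset.univ_sum_single ξ]
    refine Finset.sum_congr rfl fun j _ => ?_
    rw [← Pi.single_smul, ← Pi.single_smul, ← Pi.single_add]
    simp
  conv_lhs => rw [e]
  simp only [map_sum, map_add, map_smul, smul_eq_mul, dq, dp]

/-- The two forces of a bond, on its left and on its right particle, are collected by swapping the
order of summation and together form one `Lint`. The minus sign reflects that S*(t) composes with
the flow at time -t. -/
lemma along_bondField (Φ : ℝ → ℝ) {X : Finset ℤ} (r : X → X → Prop) [DecidableRel r]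
    (φ : Phase X → ℝ) (x : Phase X) :
    along (bondField Φ r) φ x = -((∑ j : X, -(x j).2 * dq j φ x) +
      ∑ j : X, ∑ k : X, if r j k then Lint Φ j k φ x else 0) := by
  rw [along, fderiv_eq_sum, Finset.sum_add_distrib, neg_add, ← Finset.sum_neg_distrib]
  congr 1
  · exact Finset.sum_congr rfl fun j _ => by simp [bondField]
  · simp only [bondField, add_mul, neg_mul, Finset.sum_mul]
    rw [Finset.sum_add_distrib, Finset.sum_neg_distrib]
    conv_lhs => enter [2]; rw [Finset.sum_comm]
    rw [← Finset.sum_neg_distrib, ← Finset.sum_neg_distrib, ← Finset.sum_add_distrib]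
    refine Finset.sum_congr rfl fun j _ => ?_
    rw [← Finset.sum_neg_distrib, ← Finset.sum_neg_distrib, ← Finset.sum_add_distrib]
    refine Finset.sum_congr rfl fun k _ => ?_
    split_ifs
    · simp only [Lint]; ring
    · simp

lemma along_hamiltonField (Φ : ℝ → ℝ) {X : Finset ℤ} (φ : Phase X → ℝ) (x : Phase X) :
    along (hamiltonField Φ X) φ x = -liouvilleOp Φ X φ x := along_bondField Φ _ φ x

/-- The generator of the product of groups lacks the interactions across the cuts. -/
lemma along_partField (Φ : ℝ → ℝ) {X : Finset ℤ} (Q : Finpartition X)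
    (φ : Phase X → ℝ) (x : Phase X) :
    along (bondField Φ (bondIn Q)) φ x = -liouvilleOp Φ X φ x +
      ∑ j : X, ∑ k : X, if (k : ℤ) = next j then
        (if (k : ℤ) ∉ Q.part j then Lint Φ j k φ x else 0) else 0 := by
  rw [along_bondField, liouvilleOp, neg_add, neg_add, add_assoc]
  congr 1
  rw [← Finset.sum_neg_distrib, ← Finset.sum_neg_distrib, ← Finset.sum_add_distrib]
  refine Finset.sum_congr rfl fun j _ => ?_
  rw [← Finset.sum_neg_distrib, ← Finset.sum_neg_distrib, ← Finset.sum_add_distrib]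
  refine Finset.sum_congr rfl fun k _ => ?_
  by_cases h1 : (k : ℤ) = next j
  · rw [if_pos h1, if_pos h1]
    by_cases h2 : (k : ℤ) ∈ Q.part j
    · rw [if_pos (show bondIn Q j k from ⟨h1, h2⟩), if_neg (not_not.2 h2)]; simp
    · rw [if_neg fun h : bondIn Q j k => h2 h.2, if_pos h2]; simp
  · rw [if_neg fun h : bondIn Q j k => h1 h.1, if_neg h1, if_neg h1]; simp

end Dynamics

end NearestNeighbour


namespace NearestNeighbour

section Combinatorics

/-! ### Blocks and ordered partitions -/

lemma lt_next (j : ℤ) : j < next j := by unfold next; split_ifs <;> omega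

lemma next_ne_zero (j : ℤ) : next j ≠ 0 := by unfold next; split_ifs <;> omega

lemma next_le {i j : ℤ} (h : j < i) (hi : i ≠ 0) : next j ≤ i := by
  unfold next; split_ifs <;> omega

lemma mem_orderedPartitions {X : Finset ℤ} {Q : Finpartition X} :
    Q ∈ orderedPartitions X ↔ ∀ B ∈ Q.parts, IsBlock B := by
  simp [orderedPartitions]

lemma mem_clusterPartitions {X : Finset ℤ} {P Q : Finpartition X} :
    Q ∈ clusterPartitions P ↔ Q ∈ orderedPartitions X ∧ P ≤ Q := by
  simp [clusterPartitions]

/-- The labels of `X` whose right neighbour is in `X`. -/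
def cuts (X : Finset ℤ) : Finset ℤ := X.filter fun j => next j ∈ X

lemma mem_cuts {X : Finset ℤ} {j : ℤ} : j ∈ cuts X ↔ j ∈ X ∧ next j ∈ X := by simp [cuts]

lemma mem_lowerPart {X : Finset ℤ} {i j : ℤ} : i ∈ lowerPart X j ↔ i ∈ X ∧ i ≤ j := by
  simp [lowerPart]

lemma mem_upperPart {X : Finset ℤ} {i j : ℤ} : i ∈ upperPart X j ↔ i ∈ X ∧ j < i := by
  simp [upperPart]

lemma lowerPart_subset (X : Finset ℤ) (j : ℤ) : lowerPart X j ⊆ X := Finset.filter_subset _ _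

lemma upperPart_subset (X : Finset ℤ) (j : ℤ) : upperPart X j ⊆ X := Finset.filter_subset _ _

lemma IsBlock.lowerPart {X : Finset ℤ} (hX : IsBlock X) {j : ℤ} (hj : j ∈ X) :
    IsBlock (lowerPart X j) := by
  refine ⟨⟨j, mem_lowerPart.2 ⟨hj, le_rfl⟩⟩, fun h => hX.2.1 (mem_lowerPart.1 h).1, ?_⟩
  intro i hi k hk l h1 h2 h3
  rw [mem_lowerPart] at *
  exact ⟨hX.2.2 i hi.1 k hk.1 l h1 h2 h3, by omega⟩

lemma IsBlock.upperPart {X : Finset ℤ} (hX : IsBlock X) {j : ℤ} (hj : j ∈ cuts X) :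
    IsBlock (upperPart X j) := by
  refine ⟨⟨next j, mem_upperPart.2 ⟨(mem_cuts.1 hj).2, lt_next j⟩⟩,
    fun h => hX.2.1 (mem_upperPart.1 h).1, ?_⟩
  intro i hi k hk l h1 h2 h3
  rw [mem_upperPart] at *
  exact ⟨hX.2.2 i hi.1 k hk.1 l h1 h2 h3, by omega⟩

lemma lowerPart_card_lt {X : Finset ℤ} {j : ℤ} (hj : j ∈ cuts X) :
    (lowerPart X j).card < X.card :=
  Finset.card_lt_card ((Finset.ssubset_iff_of_subset (lowerPart_subset X j)).2
    ⟨next j, (mem_cuts.1 hj).2, fun h => not_le.2 (lt_next j) (mem_lowerPart.1 h).2⟩)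

lemma upperPart_card_lt {X : Finset ℤ} {j : ℤ} (hj : j ∈ cuts X) :
    (upperPart X j).card < X.card :=
  Finset.card_lt_card ((Finset.ssubset_iff_of_subset (upperPart_subset X j)).2
    ⟨j, (mem_cuts.1 hj).1, fun h => lt_irrefl j (mem_upperPart.1 h).2⟩)

lemma cuts_upperPart {X : Finset ℤ} (j : ℤ) :
    cuts (upperPart X j) = (cuts X).filter (j < ·) := by
  ext i
  simp only [mem_cuts, mem_upperPart, Finset.mem_filter]
  have := lt_next i
  constructor
  · rintro ⟨⟨h1, h2⟩, h3, -⟩; exact ⟨⟨h1, h3⟩, h2⟩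
  · rintro ⟨⟨h1, h3⟩, h2⟩; exact ⟨⟨h1, h2⟩, h3, by omega⟩

lemma cuts_lowerPart {X : Finset ℤ} {i : ℤ} (hi : i ≠ 0) :
    cuts (lowerPart X i) = (cuts X).filter (· < i) := by
  ext j
  simp only [mem_cuts, mem_lowerPart, Finset.mem_filter]
  have := lt_next j
  constructor
  · rintro ⟨⟨h1, h2⟩, h3, h4⟩; exact ⟨⟨h1, h3⟩, by omega⟩
  · rintro ⟨⟨h1, h3⟩, h2⟩; exact ⟨⟨h1, h2.le⟩, h3, next_le h2 hi⟩

/-! ### Sums over partitions -/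

/-- `∑_P ∏_{B ∈ P} b_B`, the sum over the ordered partitions of `X`. -/
noncomputable def partitionSum (b : Finset ℤ → ℝ) (X : Finset ℤ) : ℝ :=
  ∑ Q ∈ orderedPartitions X, ∏ C ∈ Q.parts, b C

/-- `∑_P (-1)^{|P| - 1} ∏_{B ∈ P} b_B`, the sum over the ordered partitions of `X`. -/
noncomputable def signedSum (b : Finset ℤ → ℝ) (X : Finset ℤ) : ℝ :=
  ∑ Q ∈ orderedPartitions X, (-1 : ℝ) ^ (Q.parts.card - 1) * ∏ C ∈ Q.parts, b C

/-- There is at least one part, so (-1)^{|Q|-1} = -(-1)^{|Q|}, and the latter sign can be spread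
over the parts. Signed sums thereby become plain sums of -b; nonemptiness excludes the truncated
exponent 0 - 1. -/
lemma neg_one_pow_mul_prod {X : Finset ℤ} (hX : X.Nonempty) (Q : Finpartition X)
    (b : Finset ℤ → ℝ) :
    (-1 : ℝ) ^ (Q.parts.card - 1) * ∏ C ∈ Q.parts, b C = -∏ C ∈ Q.parts, -b C := by
  have h : 0 < Q.parts.card := (Q.parts_nonempty hX.ne_empty).card_pos
  obtain ⟨n, hn⟩ : ∃ n, Q.parts.card = n + 1 := ⟨Q.parts.card - 1, by omega⟩
  rw [Finset.prod_neg, hn]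
  simp [pow_succ]

lemma signedSum_eq {X : Finset ℤ} (hX : X.Nonempty) (b : Finset ℤ → ℝ) :
    signedSum b X = -partitionSum (fun C => -b C) X := by
  rw [signedSum, partitionSum, ← Finset.sum_neg_distrib]
  exact Finset.sum_congr rfl fun Q _ => neg_one_pow_mul_prod hX Q b

/-- Restriction intersects all parts with `C` and drops the empty set. For a finer partition each
intersection is a whole part or empty. -/
lemma parts_restrict_of_le {X : Finset ℤ} {P R : Finpartition X} (h : P ≤ R) {C : Finset ℤ}
    (hC : C ∈ R.parts) : (P.restrict (R.le hC)).parts = P.parts.filter (· ⊆ C) := by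
  ext B
  simp only [Finpartition.restrict, Finset.mem_erase, Finset.mem_image, Finset.mem_filter]
  constructor
  · rintro ⟨h0, A, hA, rfl⟩
    obtain ⟨D, hD, hAD⟩ := h hA
    have hDC : D = C := by
      by_contra hne
      have := R.disjoint hD hC hne
      apply h0
      have h2 : Disjoint A C := Disjoint.mono_left hAD this
      exact Finset.disjoint_iff_inter_eq_empty.1 h2
    subst hDC
    have : A ⊓ D = A := inf_eq_left.2 hAD
    rw [this]
    exact ⟨hA, hAD⟩
  · rintro ⟨hB, hBC⟩
    exact ⟨P.ne_bot hB, B, hB, inf_eq_left.2 hBC⟩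

lemma eq_of_subset_of_mem_parts {X : Finset ℤ} (R : Finpartition X) {B C D : Finset ℤ} (hB : B.Nonempty)
    (hC : C ∈ R.parts) (hD : D ∈ R.parts) (hBC : B ⊆ C) (hBD : B ⊆ D) : C = D := by
  obtain ⟨i, hi⟩ := hB
  exact R.eq_of_mem_parts hC hD (hBC hi) (hBD hi)

lemma prod_parts_of_le {X : Finset ℤ} {P R : Finpartition X} (h : P ≤ R) (b : Finset ℤ → ℝ) :
    ∏ B ∈ P.parts, b B = ∏ C : R.parts, ∏ B ∈ (P.restrict (R.le C.2)).parts, b B := by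
  classical
  have e : P.parts = (Finset.univ : Finset R.parts).biUnion
      fun C => (P.restrict (R.le C.2)).parts := by
    ext B
    simp only [Finset.mem_biUnion, Finset.mem_univ, true_and]
    constructor
    · intro hB
      obtain ⟨C, hC, hBC⟩ := h hB
      refine ⟨⟨C, hC⟩, ?_⟩
      rw [parts_restrict_of_le h hC]
      exact Finset.mem_filter.2 ⟨hB, hBC⟩
    · rintro ⟨C, hC⟩
      rw [parts_restrict_of_le h C.2] at hC
      exact (Finset.mem_filter.1 hC).1
  conv_lhs => rw [e]
  refine Finset.prod_biUnion fun C _ D _ hCD => ?_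
  rw [Function.onFun, Finset.disjoint_left]
  intro B hB hB'
  rw [parts_restrict_of_le h C.2, Finset.mem_filter] at hB
  rw [parts_restrict_of_le h D.2, Finset.mem_filter] at hB'
  exact hCD (Subtype.ext (eq_of_subset_of_mem_parts R (P.nonempty_of_mem_parts hB.1) C.2 D.2 hB.2 hB'.2))

lemma restrict_mem_orderedPartitions {X : Finset ℤ} {P R : Finpartition X} (h : P ≤ R)
    (hP : P ∈ orderedPartitions X) {C : Finset ℤ} (hC : C ∈ R.parts) :
    P.restrict (R.le hC) ∈ orderedPartitions C := by
  rw [mem_orderedPartitions] at *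
  intro B hB
  rw [parts_restrict_of_le h hC] at hB
  exact hP B (Finset.mem_filter.1 hB).1

open Classical in
/-- The partitions finer than `R` are the families of partitions of the parts of `R`. -/
lemma sum_prod_of_le {X : Finset ℤ} (R : Finpartition X) (b : Finset ℤ → ℝ) :
    ∑ P ∈ (orderedPartitions X).filter (· ≤ R), ∏ B ∈ P.parts, b B =
      ∏ C : R.parts, partitionSum b C := by
  classical
  simp only [partitionSum]
  rw [Finset.prod_univ_sum]
  have hbind : ∀ p : (C : R.parts) → Finpartition (C : Finset ℤ),
      R.bind (fun C hC => p ⟨C, hC⟩) ≤ R := by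
    intro p B hB
    obtain ⟨A, hA, hBA⟩ := Finpartition.mem_bind.1 hB
    exact ⟨A, hA, (p ⟨A, hA⟩).le hBA⟩
  have hres : ∀ (p : (C : R.parts) → Finpartition (C : Finset ℤ)) (C : R.parts),
      (R.bind (fun C hC => p ⟨C, hC⟩)).restrict (R.le C.2) = p C := by
    intro p C
    ext B
    rw [parts_restrict_of_le (hbind p) C.2, Finset.mem_filter, Finpartition.mem_bind]
    constructor
    · rintro ⟨⟨A, hA, hB⟩, hBC⟩
      have : A = C := eq_of_subset_of_mem_parts R ((p ⟨A, hA⟩).nonempty_of_mem_parts hB) hA C.2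
        ((p ⟨A, hA⟩).le hB) hBC
      have h2 : (⟨A, hA⟩ : R.parts) = C := Subtype.ext this
      subst h2
      exact hB
    · intro hB
      exact ⟨⟨C, C.2, hB⟩, (p C).le hB⟩
  refine Finset.sum_bij' (fun P _ C => P.restrict (R.le C.2))
    (fun p _ => R.bind fun C hC => p ⟨C, hC⟩) ?_ ?_ ?_ ?_ ?_
  · intro P hP
    rw [Finset.mem_filter] at hP
    exact Fintype.mem_piFinset.2 fun C => restrict_mem_orderedPartitions hP.2 hP.1 C.2
  · intro p hp
    rw [Fintype.mem_piFinset] at hp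
    refine Finset.mem_filter.2 ⟨mem_orderedPartitions.2 fun B hB => ?_, hbind p⟩
    obtain ⟨A, hA, hBA⟩ := Finpartition.mem_bind.1 hB
    exact mem_orderedPartitions.1 (hp ⟨A, hA⟩) B hBA
  · intro P hP
    rw [Finset.mem_filter] at hP
    ext B
    rw [Finpartition.mem_bind]
    constructor
    · rintro ⟨A, hA, hB⟩
      rw [parts_restrict_of_le hP.2 hA] at hB
      exact (Finset.mem_filter.1 hB).1
    · intro hB
      obtain ⟨C, hC, hBC⟩ := hP.2 hB
      refine ⟨C, hC, ?_⟩
      rw [parts_restrict_of_le hP.2 hC]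
      exact Finset.mem_filter.2 ⟨hB, hBC⟩
  · intro p hp
    funext C
    exact hres p C
  · intro P hP
    rw [Finset.mem_filter] at hP
    exact prod_parts_of_le hP.2 b

/-! ### Cutting a block into two -/

/-- The ordered partition of `X` into the labels up to `j` and the labels after `j`. -/
def cutPartition {X : Finset ℤ} {j : ℤ} (hj : j ∈ cuts X) : Finpartition X where
  parts := {lowerPart X j, upperPart X j}
  supIndep := by
    rw [Finset.supIndep_iff_pairwiseDisjoint]
    have hd : Disjoint (lowerPart X j) (upperPart X j) := Finset.disjoint_left.2 fun i h1 h2 => by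
      have := (mem_lowerPart.1 h1).2
      have := (mem_upperPart.1 h2).2
      omega
    intro A hA B hB hAB
    simp only [Finset.coe_insert, Finset.coe_singleton, Set.mem_insert_iff,
      Set.mem_singleton_iff] at hA hB
    rcases hA with rfl | rfl <;> rcases hB with rfl | rfl
    · exact absurd rfl hAB
    · exact hd
    · exact hd.symm
    · exact absurd rfl hAB
  sup_parts := by
    ext i
    simp only [Finset.sup_insert, Finset.sup_singleton, id, Finset.sup_eq_union, Finset.mem_union,
      mem_lowerPart, mem_upperPart]
    constructor
    · rintro (h | h) <;> exact h.1
    · intro h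
      rcases le_or_gt i j with h1 | h1
      · exact Or.inl ⟨h, h1⟩
      · exact Or.inr ⟨h, h1⟩
  bot_notMem := by
    rw [mem_cuts] at hj
    simp only [Finset.mem_insert, Finset.mem_singleton, Finset.bot_eq_empty, not_or]
    exact ⟨fun h => by
      have : j ∈ lowerPart X j := mem_lowerPart.2 ⟨hj.1, le_rfl⟩
      rw [← h] at this; simp at this, fun h => by
      have : next j ∈ upperPart X j := mem_upperPart.2 ⟨hj.2, lt_next j⟩
      rw [← h] at this; simp at this⟩

lemma lowerPart_ne_upperPart {X : Finset ℤ} {j : ℤ} (hj : j ∈ cuts X) :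
    lowerPart X j ≠ upperPart X j := fun h => by
  have h1 : j ∈ lowerPart X j := mem_lowerPart.2 ⟨(mem_cuts.1 hj).1, le_rfl⟩
  rw [h, mem_upperPart] at h1
  exact lt_irrefl _ h1.2

lemma prod_cutPartition {X : Finset ℤ} {j : ℤ} (hj : j ∈ cuts X) (f : Finset ℤ → ℝ) :
    ∏ C : (cutPartition hj).parts, f C = f (lowerPart X j) * f (upperPart X j) := by
  rw [Finset.prod_coe_sort]
  exact Finset.prod_pair (lowerPart_ne_upperPart hj)

/-- A part meeting both sides of the cut consists of consecutive labels, hence contains both `j` and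
its right neighbour. -/
lemma le_cutPartition_iff {X : Finset ℤ} {j : ℤ} (hj : j ∈ cuts X) (hX : IsBlock X) {Q : Finpartition X}
    (hQ : Q ∈ orderedPartitions X) : Q ≤ cutPartition hj ↔ next j ∉ Q.part j := by
  have hj' := mem_cuts.1 hj
  constructor
  · intro h hn
    obtain ⟨C, hC, hsub⟩ := h (Q.part_mem.2 hj'.1)
    have h1 := hsub (Q.mem_part_self.2 hj'.1)
    have h2 := hsub hn
    simp only [cutPartition, Finset.mem_insert, Finset.mem_singleton] at hC
    rcases hC with rfl | rfl
    · have := (mem_lowerPart.1 h2).2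
      have := lt_next j
      omega
    · exact lt_irrefl _ (mem_upperPart.1 h1).2
  · intro hn B hB
    by_cases hlow : B ⊆ lowerPart X j
    · exact ⟨_, Finset.mem_insert_self _ _, hlow⟩
    · refine ⟨upperPart X j, Finset.mem_insert_of_mem (Finset.mem_singleton_self _), ?_⟩
      intro a ha
      have haX := Q.le hB ha
      rw [mem_upperPart]
      refine ⟨haX, ?_⟩
      by_contra hle
      push Not at hle
      obtain ⟨c, hc, hcl⟩ := Finset.not_subset.1 hlow
      have hcX := Q.le hB hc
      have hjc : j < c := by
        by_contra h'
        exact hcl (mem_lowerPart.2 ⟨hcX, by omega⟩)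
      have hb := mem_orderedPartitions.1 hQ B hB
      have hj0 : j ≠ 0 := fun h => hX.2.1 (h ▸ hj'.1)
      have hc0 : c ≠ 0 := fun h => hX.2.1 (h ▸ hcX)
      have hjB : j ∈ B := by
        rcases hle.lt_or_eq with h | rfl
        · exact hb.2.2 a ha c hc j h hjc hj0
        · exact ha
      have hnB : next j ∈ B := by
        rcases (next_le hjc hc0).lt_or_eq with h | h
        · exact hb.2.2 j hjB c hc _ (lt_next j) h (next_ne_zero j)
        · rw [h]; exact hc
      rw [Q.part_eq_of_mem hB hjB] at hn
      exact hn hnB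

/-- The sum over the partitions with a cut after the label `j`. -/
lemma sum_prod_cut {X : Finset ℤ} (hX : IsBlock X) {j : ℤ} (hj : j ∈ cuts X) (b : Finset ℤ → ℝ) :
    ∑ Q ∈ (orderedPartitions X).filter (fun Q => next j ∉ Q.part j), ∏ C ∈ Q.parts, b C =
      partitionSum b (lowerPart X j) * partitionSum b (upperPart X j) := by
  classical
  rw [← prod_cutPartition hj, ← sum_prod_of_le]
  refine Finset.sum_congr (Finset.filter_congr fun Q hQ => ?_) fun _ _ => rfl
  exact (le_cutPartition_iff hj hX hQ).symm

/-- The part containing the least label is an initial segment of `X`, and an initial segment is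
determined by its last label. -/
lemma existsUnique_lowerPart {X : Finset ℤ} (hX : IsBlock X) {Q : Finpartition X}
    (hQ : Q ∈ orderedPartitions X) : ∃! j, j ∈ X ∧ lowerPart X j ∈ Q.parts := by
  set m := X.min' hX.1
  have hm : m ∈ X := X.min'_mem hX.1
  have hB := Q.part_mem.2 hm
  have hmB := Q.mem_part_self.2 hm
  set j := (Q.part m).max' ⟨m, hmB⟩
  have hjB : j ∈ Q.part m := Finset.max'_mem _ _
  have e : lowerPart X j = Q.part m := by
    ext i
    rw [mem_lowerPart]
    constructor
    · rintro ⟨hi, hij⟩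
      have hmi : m ≤ i := X.min'_le i hi
      rcases hmi.lt_or_eq with h1 | h1
      · rcases hij.lt_or_eq with h2 | h2
        · exact (mem_orderedPartitions.1 hQ _ hB).2.2 m hmB j hjB i h1 h2
            fun h => hX.2.1 (h ▸ hi)
        · rw [h2]; exact hjB
      · rw [← h1]; exact hmB
    · intro hi
      exact ⟨Q.le hB hi, Finset.le_max' _ _ hi⟩
  refine ⟨j, ⟨Q.le hB hjB, e ▸ hB⟩, ?_⟩
  rintro i ⟨hi, hiQ⟩
  have hmi : m ∈ lowerPart X i := mem_lowerPart.2 ⟨hm, X.min'_le i hi⟩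
  have e2 : lowerPart X i = lowerPart X j := by
    rw [e]; exact (Q.part_eq_of_mem hiQ hmi).symm
  have h1 : i ∈ lowerPart X j := e2 ▸ mem_lowerPart.2 ⟨hi, le_rfl⟩
  have h2 : j ∈ lowerPart X i := e2 ▸ mem_lowerPart.2 ⟨Q.le hB hjB, le_rfl⟩
  have := (mem_lowerPart.1 h1).2
  have := (mem_lowerPart.1 h2).2
  omega

lemma indiscrete_mem_orderedPartitions {X : Finset ℤ} (hX : IsBlock X) :
    Finpartition.indiscrete hX.1.ne_empty ∈ orderedPartitions X := by
  rw [mem_orderedPartitions]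
  intro B hB
  simp only [Finpartition.indiscrete_parts, Finset.mem_singleton] at hB
  rw [hB]; exact hX

lemma eq_indiscrete_of_mem {X : Finset ℤ} (hX : X ≠ ∅) {Q : Finpartition X} (h : X ∈ Q.parts) :
    Q = Finpartition.indiscrete hX := by
  ext B
  simp only [Finpartition.indiscrete_parts, Finset.mem_singleton]
  constructor
  · intro hB
    exact (eq_of_subset_of_mem_parts Q (Q.nonempty_of_mem_parts hB) hB h subset_rfl (Q.le hB))
  · rintro rfl; exact h

/-- The formula for a cut after `j` is applied to the weight `b'` that vanishes on proper subsets of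
the lower half. Only partitions that leave this half undivided survive, and on their parts `b'`
equals `b`. -/
lemma sum_prod_first {X : Finset ℤ} (hX : IsBlock X) {j : ℤ} (hj : j ∈ cuts X) (b : Finset ℤ → ℝ) :
    ∑ Q ∈ (orderedPartitions X).filter (fun Q => lowerPart X j ∈ Q.parts), ∏ C ∈ Q.parts, b C =
      b (lowerPart X j) * partitionSum b (upperPart X j) := by
  classical
  have hj' := mem_cuts.1 hj
  have hL := hX.lowerPart hj'.1
  set b' : Finset ℤ → ℝ := fun B => if B ⊂ lowerPart X j then 0 else b B
  have h1 := sum_prod_cut hX hj b'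
  have e1 : partitionSum b' (lowerPart X j) = b (lowerPart X j) := by
    rw [partitionSum, Finset.sum_eq_single_of_mem _ (indiscrete_mem_orderedPartitions hL)]
    · simp [b']
    · intro Q _ hne
      have hz : ∃ B ∈ Q.parts, b' B = 0 := by
        obtain ⟨B, hB⟩ := Q.parts_nonempty hL.1.ne_empty
        refine ⟨B, hB, if_pos (Finset.ssubset_iff_subset_ne.2 ⟨Q.le hB, ?_⟩)⟩
        rintro rfl
        exact hne (eq_indiscrete_of_mem _ hB)
      obtain ⟨B, hB, hB0⟩ := hz
      exact Finset.prod_eq_zero hB hB0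
  have e2 : partitionSum b' (upperPart X j) = partitionSum b (upperPart X j) := by
    refine Finset.sum_congr rfl fun Q hQ => Finset.prod_congr rfl fun B hB => if_neg fun h => ?_
    obtain ⟨i, hi⟩ := Q.nonempty_of_mem_parts hB
    have h2 := (mem_upperPart.1 (Q.le hB hi)).2
    have h3 := (mem_lowerPart.1 (h.1 hi)).2
    omega
  rw [e1, e2] at h1
  rw [← h1]
  have hsub : (orderedPartitions X).filter (fun Q => lowerPart X j ∈ Q.parts) ⊆
      (orderedPartitions X).filter (fun Q => next j ∉ Q.part j) := by
    intro Q hQ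
    rw [Finset.mem_filter] at *
    refine ⟨hQ.1, fun hn => ?_⟩
    rw [Q.part_eq_of_mem hQ.2 (mem_lowerPart.2 ⟨hj'.1, le_rfl⟩), mem_lowerPart] at hn
    have := lt_next j
    omega
  rw [← Finset.sum_subset hsub (f := fun Q => ∏ C ∈ Q.parts, b' C)]
  · refine Finset.sum_congr rfl fun Q hQ => Finset.prod_congr rfl fun B hB => ?_
    refine (if_neg fun h => h.2 ?_).symm
    rw [Finset.mem_filter] at hQ
    exact (eq_of_subset_of_mem_parts Q (Q.nonempty_of_mem_parts hB) hQ.2 hB h.1 subset_rfl).le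
  · intro Q hQ hQ'
    rw [Finset.mem_filter] at hQ hQ'
    have hjm := Q.mem_part_self.2 hj'.1
    have hpm := Q.part_mem.2 hj'.1
    refine Finset.prod_eq_zero hpm (if_pos (Finset.ssubset_iff_subset_ne.2 ⟨?_, fun h => ?_⟩))
    · obtain ⟨C, hC, hBC⟩ := (le_cutPartition_iff hj hX hQ.1).2 hQ.2 hpm
      simp only [cutPartition, Finset.mem_insert, Finset.mem_singleton] at hC
      rcases hC with rfl | rfl
      · exact hBC
      · exact absurd (mem_upperPart.1 (hBC hjm)).2 (lt_irrefl _)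
    · exact hQ' ⟨hQ.1, h ▸ hpm⟩

lemma insert_max_cuts {X : Finset ℤ} (hX : IsBlock X) :
    X = insert (X.max' hX.1) (cuts X) ∧ X.max' hX.1 ∉ cuts X := by
  have hm : X.max' hX.1 ∈ X := X.max'_mem hX.1
  constructor
  · ext j
    rw [Finset.mem_insert, mem_cuts]
    constructor
    · intro hj
      rcases (X.le_max' j hj).lt_or_eq with h | h
      · right
        refine ⟨hj, ?_⟩
        rcases (next_le h fun h0 => hX.2.1 (h0 ▸ hm)).lt_or_eq with h1 | h1
        · exact hX.2.2 j hj _ hm _ (lt_next j) h1 (next_ne_zero j)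
        · rw [h1]; exact hm
      · exact Or.inl h
    · rintro (rfl | h)
      · exact hm
      · exact h.1
  · intro h
    have h1 := X.le_max' _ (mem_cuts.1 h).2
    have := lt_next (X.max' hX.1)
    omega

lemma lowerPart_max {X : Finset ℤ} (hX : X.Nonempty) : lowerPart X (X.max' hX) = X :=
  Finset.filter_true_of_mem fun i hi => X.le_max' i hi

/-- Recursion with respect to the first part. -/
lemma partitionSum_first {X : Finset ℤ} (hX : IsBlock X) (b : Finset ℤ → ℝ) :
    partitionSum b X = b X +
      ∑ j ∈ cuts X, b (lowerPart X j) * partitionSum b (upperPart X j) := by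
  classical
  -- Each partition is counted once, at the last label `j` of its first part. The last label of `X`
  -- belongs to the one-part partition; the other labels are the cuts.
  have h1 : partitionSum b X = ∑ Q ∈ orderedPartitions X, ∑ j ∈ X,
      if lowerPart X j ∈ Q.parts then ∏ C ∈ Q.parts, b C else 0 := by
    refine Finset.sum_congr rfl fun Q hQ => ?_
    obtain ⟨j, ⟨hj, hjQ⟩, hu⟩ := existsUnique_lowerPart hX hQ
    rw [Finset.sum_eq_single_of_mem j hj, if_pos hjQ]
    intro i hi hne
    exact if_neg fun h => hne (hu i ⟨hi, h⟩)
  rw [h1, Finset.sum_comm]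
  obtain ⟨hi, hn⟩ := insert_max_cuts hX
  have h2 : ∀ f : ℤ → ℝ, ∑ j ∈ X, f j = f (X.max' hX.1) + ∑ j ∈ cuts X, f j := fun f => by
    conv_lhs => rw [hi]
    rw [Finset.sum_insert hn]
  rw [h2]
  congr 1
  · rw [lowerPart_max hX.1, Finset.sum_eq_single_of_mem _ (indiscrete_mem_orderedPartitions hX)]
    · simp
    · intro Q _ hne
      exact if_neg fun h => hne (eq_indiscrete_of_mem _ h)
  · refine Finset.sum_congr rfl fun j hj => ?_
    rw [← sum_prod_first hX hj, Finset.sum_filter]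

lemma lowerPart_lowerPart {X : Finset ℤ} {i j : ℤ} (h : j ≤ i) :
    lowerPart (lowerPart X i) j = lowerPart X j := by
  ext k; simp only [mem_lowerPart]; grind

lemma upperPart_upperPart {X : Finset ℤ} {i j : ℤ} (h : j ≤ i) :
    upperPart (upperPart X j) i = upperPart X i := by
  ext k; simp only [mem_upperPart]; grind

lemma upperPart_lowerPart {X : Finset ℤ} (i j : ℤ) :
    upperPart (lowerPart X i) j = lowerPart (upperPart X j) i := by
  ext k; simp only [mem_upperPart, mem_lowerPart]; grind

/-- Recursion with respect to the last part. -/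
lemma partitionSum_last (b : Finset ℤ → ℝ) {X : Finset ℤ} (hX : IsBlock X) :
    partitionSum b X = b X +
      ∑ j ∈ cuts X, partitionSum b (lowerPart X j) * b (upperPart X j) := by
  induction hn : X.card using Nat.strong_induction_on generalizing X with
  | _ n ih =>
    subst hn
    rw [partitionSum_first hX]
    congr 1
    -- Splitting off the last part of the upper half, or in `e2` the first part of the lower half,
    -- leads to the same double sum over cuts j < i of first part, partitions of the middle, last
    -- part.
    have e1 : ∀ j ∈ cuts X, b (lowerPart X j) * partitionSum b (upperPart X j) =
        b (lowerPart X j) * b (upperPart X j) + ∑ i ∈ cuts X, if j < i then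
          b (lowerPart X j) * partitionSum b (lowerPart (upperPart X j) i) * b (upperPart X i)
          else 0 := by
      intro j hj
      rw [ih _ (upperPart_card_lt hj) (hX.upperPart hj) rfl, mul_add, cuts_upperPart,
        Finset.mul_sum, Finset.sum_filter]
      congr 1
      refine Finset.sum_congr rfl fun i _ => ?_
      split_ifs with h
      · rw [upperPart_upperPart h.le]; ring
      · rfl
    have e2 : ∀ i ∈ cuts X, partitionSum b (lowerPart X i) * b (upperPart X i) =
        b (lowerPart X i) * b (upperPart X i) + ∑ j ∈ cuts X, if j < i then
          b (lowerPart X j) * partitionSum b (lowerPart (upperPart X j) i) * b (upperPart X i)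
          else 0 := by
      intro i hi
      have hiX := (mem_cuts.1 hi).1
      rw [partitionSum_first (hX.lowerPart hiX), add_mul,
        cuts_lowerPart (fun h => hX.2.1 (h ▸ hiX)), Finset.sum_mul, Finset.sum_filter]
      congr 1
      refine Finset.sum_congr rfl fun j _ => ?_
      split_ifs with h
      · rw [lowerPart_lowerPart h.le, upperPart_lowerPart]
      · rfl
    rw [Finset.sum_congr rfl e1, Finset.sum_congr rfl e2, Finset.sum_add_distrib,
      Finset.sum_add_distrib, Finset.sum_comm]

lemma partitionSum_congr {b c : Finset ℤ → ℝ} {X : Finset ℤ}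
    (h : ∀ B, IsBlock B → B ⊆ X → b B = c B) : partitionSum b X = partitionSum c X :=
  Finset.sum_congr rfl fun Q hQ => Finset.prod_congr rfl fun B hB =>
    h B (mem_orderedPartitions.1 hQ B hB) (Q.le hB)

lemma signedSum_congr {b c : Finset ℤ → ℝ} {X : Finset ℤ}
    (h : ∀ B, IsBlock B → B ⊆ X → b B = c B) : signedSum b X = signedSum c X :=
  Finset.sum_congr rfl fun Q hQ => by
    congr 1
    exact Finset.prod_congr rfl fun B hB => h B (mem_orderedPartitions.1 hQ B hB) (Q.le hB)

/-- Inversion of sums over ordered partitions. -/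
lemma signedSum_partitionSum (b : Finset ℤ → ℝ) {X : Finset ℤ} (hX : IsBlock X) :
    signedSum (partitionSum b) X = b X := by
  induction hn : X.card using Nat.strong_induction_on generalizing X with
  | _ n ih =>
    subst hn
    rw [signedSum_eq hX.1, partitionSum_first hX]
    -- By induction the signed sum over the upper half is already inverted. The recursion by first
    -- part thus becomes partitionSum minus the sum in the recursion by last part, which leaves b_X.
    have e : ∀ j ∈ cuts X, -partitionSum b (lowerPart X j) *
        partitionSum (fun C => -partitionSum b C) (upperPart X j) =
        partitionSum b (lowerPart X j) * b (upperPart X j) := by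
      intro j hj
      have := ih _ (upperPart_card_lt hj) (hX.upperPart hj) rfl
      rw [signedSum_eq (hX.upperPart hj).1] at this
      rw [← this]; ring
    rw [Finset.sum_congr rfl e, partitionSum_last b hX]
    ring

/-- Signed sums of b are minus the plain sums of -b, so the other order of inversion is the previous
identity applied to -b. -/
lemma partitionSum_signedSum (b : Finset ℤ → ℝ) {X : Finset ℤ} (hX : IsBlock X) :
    partitionSum (signedSum b) X = b X := by
  have h := signedSum_partitionSum (fun C => -b C) hX
  rw [signedSum_eq hX.1] at h
  have e : partitionSum (signedSum b) X =
      partitionSum (fun C => -partitionSum (fun C => -b C) C) X :=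
    partitionSum_congr fun B hB _ => signedSum_eq hB.1 b
  rw [e]
  linarith

/-- The signed sum over the partitions with a cut after the label `j`. -/
lemma signedSum_cut {X : Finset ℤ} (hX : IsBlock X) {j : ℤ} (hj : j ∈ cuts X) (b : Finset ℤ → ℝ) :
    ∑ Q ∈ (orderedPartitions X).filter (fun Q => next j ∉ Q.part j),
      (-1 : ℝ) ^ (Q.parts.card - 1) * ∏ C ∈ Q.parts, b C =
      -(signedSum b (lowerPart X j) * signedSum b (upperPart X j)) := by
  rw [signedSum_eq (hX.lowerPart (mem_cuts.1 hj).1).1, signedSum_eq (hX.upperPart hj).1,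
    neg_mul_neg, ← sum_prod_cut hX hj, ← Finset.sum_neg_distrib]
  exact Finset.sum_congr rfl fun Q _ => neg_one_pow_mul_prod hX.1 Q b

end Combinatorics

end NearestNeighbour



namespace NearestNeighbour

/-! ### Density of the products of smooth functions -/

section Represented

variable {α : Type*} [MeasurableSpace α] {μ : Measure α}

/-- The function `f` represents an element of `V`. -/
def RepresentedIn (V : Submodule ℝ (Lp ℝ 1 μ)) (f : α → ℝ) : Prop :=
  ∃ F ∈ V, F =ᵐ[μ] f

variable {V : Submodule ℝ (Lp ℝ 1 μ)} {f g : α → ℝ}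

lemma RepresentedIn.mem (h : RepresentedIn V f) {F : Lp ℝ 1 μ} (hF : F =ᵐ[μ] f) : F ∈ V := by
  obtain ⟨G, hG, hGf⟩ := h
  have : F = G := Lp.ext (hF.trans hGf.symm)
  rwa [this]

lemma RepresentedIn.congr (h : RepresentedIn V f) (hfg : f =ᵐ[μ] g) : RepresentedIn V g := by
  obtain ⟨G, hG, hGf⟩ := h
  exact ⟨G, hG, hGf.trans hfg⟩

lemma RepresentedIn.integrable (h : RepresentedIn V f) : Integrable f μ := by
  obtain ⟨F, -, hF⟩ := h
  exact (integrable_congr hF).1 (L1.integrable_coeFn F)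

lemma RepresentedIn.zero : RepresentedIn V (fun _ => (0 : ℝ)) := ⟨0, V.zero_mem, Lp.coeFn_zero _ _ _⟩

lemma RepresentedIn.add (hf : RepresentedIn V f) (hg : RepresentedIn V g) :
    RepresentedIn V (fun x => f x + g x) := by
  obtain ⟨F, hF, hFf⟩ := hf
  obtain ⟨G, hG, hGg⟩ := hg
  refine ⟨F + G, V.add_mem hF hG, ?_⟩
  filter_upwards [Lp.coeFn_add F G, hFf, hGg] with x h1 h2 h3
  rw [h1, Pi.add_apply, h2, h3]

lemma RepresentedIn.sub (hf : RepresentedIn V f) (hg : RepresentedIn V g) :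
    RepresentedIn V (fun x => f x - g x) := by
  obtain ⟨F, hF, hFf⟩ := hf
  obtain ⟨G, hG, hGg⟩ := hg
  refine ⟨F - G, V.sub_mem hF hG, ?_⟩
  filter_upwards [Lp.coeFn_sub F G, hFf, hGg] with x h1 h2 h3
  rw [h1, Pi.sub_apply, h2, h3]

lemma RepresentedIn.smul (hf : RepresentedIn V f) (c : ℝ) :
    RepresentedIn V (fun x => c * f x) := by
  obtain ⟨F, hF, hFf⟩ := hf
  refine ⟨c • F, V.smul_mem c hF, ?_⟩
  filter_upwards [Lp.coeFn_smul c F, hFf] with x h1 h2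
  rw [h1, Pi.smul_apply, h2, smul_eq_mul]

/-- Dominated convergence gives convergence in L¹, and a closed subspace keeps the limit. -/
lemma RepresentedIn.of_tendsto (hV : IsClosed (V : Set (Lp ℝ 1 μ))) {u : ℕ → α → ℝ}
    (hu : ∀ n, RepresentedIn V (u n)) {bound : α → ℝ} (hb : Integrable bound μ)
    (hle : ∀ n, ∀ᵐ x ∂μ, ‖u n x‖ ≤ bound x)
    (hlim : ∀ᵐ x ∂μ, Tendsto (fun n => u n x) atTop (𝓝 (f x))) : RepresentedIn V f := by
  choose F hF hFu using hu
  have hfm : AEStronglyMeasurable f μ :=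
    aestronglyMeasurable_of_tendsto_ae atTop
      (fun n => (RepresentedIn.integrable ⟨F n, hF n, hFu n⟩).aestronglyMeasurable) hlim
  have hfle : ∀ᵐ x ∂μ, ‖f x‖ ≤ bound x := by
    filter_upwards [ae_all_iff.2 hle, hlim] with x h1 h2
    exact le_of_tendsto h2.norm (Eventually.of_forall h1)
  have hfi : Integrable f μ := hb.mono' hfm hfle
  refine ⟨hfi.toL1 f, ?_, hfi.coeFn_toL1⟩
  refine hV.mem_of_tendsto (f := F) (b := atTop) ?_ (Eventually.of_forall hF)
  rw [tendsto_iff_norm_sub_tendsto_zero]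
  have e : ∀ n, ‖F n - hfi.toL1 f‖ = ∫ x, ‖u n x - f x‖ ∂μ := by
    intro n
    rw [L1.norm_eq_integral_norm]
    refine integral_congr_ae ?_
    filter_upwards [Lp.coeFn_sub (F n) (hfi.toL1 f), hFu n, hfi.coeFn_toL1] with x h1 h2 h3
    rw [h1, Pi.sub_apply, h2, h3]
  simp only [e]
  rw [← integral_zero α ℝ (μ := μ)]
  refine tendsto_integral_of_dominated_convergence (fun x => 2 * bound x) ?_ (hb.const_mul 2) ?_ ?_
  · intro n
    exact ((RepresentedIn.integrable ⟨F n, hF n, hFu n⟩).sub hfi).aestronglyMeasurable.norm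
  · intro n
    filter_upwards [hle n, hfle] with x h1 h2
    rw [norm_norm]
    exact (norm_sub_le _ _).trans (by linarith)
  · filter_upwards [hlim] with x h
    simpa using (h.sub_const (f x)).norm

end Represented

/-! ### Approximation by products of bump functions. -/

section Density

variable {σ : ℝ} {X : Finset ℤ}

/-- The phase points whose restrictions to the parts of `P` belong to the sets `K`. -/
def partsBox (P : Finpartition X) (K : (B : P.parts) → Set (Phase B)) : Set (Phase X) :=
  {x | ∀ B : P.parts, proj (P.le B.2) x ∈ K B}

lemma measurableSet_partsBox (P : Finpartition X) {K : (B : P.parts) → Set (Phase B)}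
    (hK : ∀ B, MeasurableSet (K B)) : MeasurableSet (partsBox P K) := by
  have : partsBox P K = ⋂ B : P.parts, (proj (P.le B.2)) ⁻¹' (K B) := by
    ext x; simp [partsBox]
  rw [this]
  exact MeasurableSet.iInter fun B => measurable_proj _ (hK B)

lemma volume_partsBox_lt_top (P : Finpartition X) {K : (B : P.parts) → Set (Phase B)}
    (hK : ∀ B, Bornology.IsBounded (K B)) : volume (partsBox P K) < ⊤ := by
  choose r hr using fun B => (hK B).subset_closedBall 0
  have hsub : partsBox P K ⊆ Metric.closedBall 0 (∑ B, |r B|) := by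
    intro x hx
    rw [mem_closedBall_zero_iff]
    refine (pi_norm_le_iff_of_nonneg (Finset.sum_nonneg fun B _ => abs_nonneg _)).2 fun i => ?_
    have hB := P.part_mem.2 i.2
    have h1 := mem_closedBall_zero_iff.1 (hr ⟨_, hB⟩ (hx ⟨_, hB⟩))
    have h2 := norm_le_pi_norm (proj (P.le hB) x) ⟨i, P.mem_part_self.2 i.2⟩
    exact h2.trans (h1.trans ((le_abs_self _).trans
      (Finset.single_le_sum (f := fun B => |r B|) (fun B _ => abs_nonneg _)
        (Finset.mem_univ (⟨_, hB⟩ : P.parts)))))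
  exact (measure_mono hsub).trans_lt measure_closedBall_lt_top

lemma integrable_indicator_partsBox (P : Finpartition X) {K : (B : P.parts) → Set (Phase B)}
    (hm : ∀ B, MeasurableSet (K B)) (hK : ∀ B, Bornology.IsBounded (K B)) :
    Integrable ((partsBox P K).indicator fun _ => (1 : ℝ)) (partsMeasure σ P) := by
  refine (integrable_indicator_iff (measurableSet_partsBox P hm)).2 (integrableOn_const ?_)
  exact ((Measure.restrict_apply_le _ _).trans_lt (volume_partsBox_lt_top P hK)).ne

/-- `V` contains the classes of the products of smooth functions with compact supports. -/
def ContainsSmoothProducts (P : Finpartition X) (V : Submodule ℝ (L1Parts σ P)) : Prop :=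
  ∀ f : (B : Finset ℤ) → Phase B → ℝ,
    (∀ B ∈ P.parts, ContDiff ℝ ∞ (f B) ∧ HasCompactSupport (f B) ∧ tsupport (f B) ⊆ allowed σ B) →
    ∀ F : L1Parts σ P, F =ᵐ[partsMeasure σ P] prodFun P f → F ∈ V

lemma integrable_prodFun_of_smooth (P : Finpartition X) {f : (B : Finset ℤ) → Phase B → ℝ}
    (hf : ∀ B ∈ P.parts, ContDiff ℝ ∞ (f B) ∧ HasCompactSupport (f B) ∧
      tsupport (f B) ⊆ allowed σ B) : Integrable (prodFun P f) (partsMeasure σ P) :=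
  (integrable_prodFun P f fun B hB =>
    (hf B hB).1.continuous.integrable_of_hasCompactSupport (hf B hB).2.1).restrict

/-- Products of bump functions that equal 1 on the compact factors and are supported in their
1/(n+1)-thickenings converge pointwise to the indicator of the box. The indicator of the box of unit
thickenings, of finite measure, dominates them. -/
lemma representedIn_partsBox {P : Finpartition X} {V : Submodule ℝ (L1Parts σ P)}
    (hV : IsClosed (V : Set (L1Parts σ P))) (hP : ContainsSmoothProducts P V)
    {K : (B : P.parts) → Set (Phase B)} (hK : ∀ B, IsCompact (K B))
    (hKU : ∀ B, K B ⊆ allowed σ B) :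
    RepresentedIn V ((partsBox P K).indicator fun _ => (1 : ℝ)) := by
  have hpos : ∀ n : ℕ, (0 : ℝ) < 1 / (n + 1) := fun n => by positivity
  have hex : ∀ (n : ℕ) (B : P.parts), ∃ χ : Phase B → ℝ, ContDiff ℝ ∞ χ ∧ HasCompactSupport χ ∧
      tsupport χ ⊆ Metric.thickening (1 / (n + 1)) (K B) ∩ allowed σ B ∧
      (∀ᶠ x in 𝓝ˢ (K B), χ x = 1) ∧ ∀ x, χ x ∈ Icc (0 : ℝ) 1 := fun n B =>
    exists_cutoff (hK B) (Metric.isOpen_thickening.inter (isOpen_allowed σ B))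
      (subset_inter (Metric.self_subset_thickening (hpos n) _) (hKU B))
  choose χ h1 h2 h3 h4 h5 using hex
  let f : ℕ → (B : Finset ℤ) → Phase B → ℝ := fun n B =>
    if hB : B ∈ P.parts then χ n ⟨B, hB⟩ else 0
  have hf : ∀ n (B : P.parts), f n B = χ n B := fun n B => dif_pos B.2
  have hfs : ∀ n, ∀ B ∈ P.parts, ContDiff ℝ ∞ (f n B) ∧ HasCompactSupport (f n B) ∧
      tsupport (f n B) ⊆ allowed σ B := by
    intro n B hB
    rw [hf n ⟨B, hB⟩]
    exact ⟨h1 n _, h2 n _, (h3 n _).trans inter_subset_right⟩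
  have hprod : ∀ n x, prodFun P (f n) x = ∏ B : P.parts, χ n B (proj (P.le B.2) x) := fun n x =>
    Finset.prod_congr rfl fun B _ => by rw [hf n B]
  have hnot : ∀ (n : ℕ) (B : P.parts) (y : Phase B), y ∉ Metric.thickening (1 / (n + 1)) (K B) →
      χ n B y = 0 := fun n B y hy => by
    by_contra h
    exact hy (h3 n B (subset_tsupport _ h)).1
  refine RepresentedIn.of_tendsto (f := (partsBox P K).indicator fun _ => (1 : ℝ)) hV
    (u := fun n => prodFun P (f n)) (fun n => ?_)
    (integrable_indicator_partsBox P (K := fun B => Metric.thickening 1 (K B))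
      (fun B => Metric.isOpen_thickening.measurableSet) fun B => (hK B).isBounded.thickening)
    (fun n => Eventually.of_forall fun x => ?_) (Eventually.of_forall fun x => ?_)
  · have hi := integrable_prodFun_of_smooth P (hfs n)
    exact ⟨hi.toL1 _, hP _ (hfs n) _ hi.coeFn_toL1, hi.coeFn_toL1⟩
  · rw [hprod, Real.norm_of_nonneg (Finset.prod_nonneg fun B _ => (h5 n B _).1)]
    by_cases hx : x ∈ partsBox P fun B => Metric.thickening 1 (K B)
    · rw [indicator_of_mem hx]
      exact Finset.prod_le_one (fun B _ => (h5 n B _).1) fun B _ => (h5 n B _).2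
    · rw [indicator_of_notMem hx]
      simp only [partsBox, Set.mem_ofPred_eq, not_forall] at hx
      obtain ⟨B, hB⟩ := hx
      refine (Finset.prod_eq_zero (Finset.mem_univ B) (hnot n B _ fun h => hB ?_)).le
      refine Metric.thickening_mono ?_ _ h
      rw [div_le_one (by positivity)]
      linarith [(Nat.cast_nonneg n : (0 : ℝ) ≤ n)]
  · simp only [hprod]
    by_cases hx : x ∈ partsBox P K
    · rw [indicator_of_mem hx]
      refine tendsto_const_nhds.congr fun n => ?_
      exact (Finset.prod_eq_one fun B _ => (h4 n B).self_of_nhdsSet _ (hx B)).symm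
    · rw [indicator_of_notMem hx]
      simp only [partsBox, Set.mem_ofPred_eq, not_forall] at hx
      obtain ⟨B, hB⟩ := hx
      have hpos' : 0 < Metric.infEDist (proj (P.le B.2) x) (K B) := by
        rw [pos_iff_ne_zero]
        intro h0
        exact hB ((hK B).isClosed.closure_eq ▸ Metric.mem_closure_iff_infEDist_zero.2 h0)
      have hev : ∀ᶠ n : ℕ in atTop, ENNReal.ofReal (1 / ((n : ℝ) + 1)) <
          Metric.infEDist (proj (P.le B.2) x) (K B) := by
        have : Tendsto (fun n : ℕ => ENNReal.ofReal (1 / ((n : ℝ) + 1))) atTop (𝓝 0) := by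
          rw [← ENNReal.ofReal_zero]
          exact ENNReal.tendsto_ofReal tendsto_one_div_add_atTop_nhds_zero_nat
        exact this.eventually_lt_const hpos'
      refine tendsto_const_nhds.congr' ?_
      filter_upwards [hev] with n hn
      exact (Finset.prod_eq_zero (Finset.mem_univ B)
        (hnot n B _ fun h => absurd (show Metric.infEDist _ _ < _ from h) hn.not_gt)).symm

/-- Induction on Borel sets inside a fixed box. Products of closed sets form a generating π-system,
and their intersection with the box is again a box of compact sets. Complements are differences, and
disjoint unions are limits dominated by the indicator of the box. -/
lemma representedIn_inter_partsBox {P : Finpartition X} {V : Submodule ℝ (L1Parts σ P)}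
    (hV : IsClosed (V : Set (L1Parts σ P))) (hP : ContainsSmoothProducts P V)
    {K : (B : P.parts) → Set (Phase B)} (hK : ∀ B, IsCompact (K B))
    (hKU : ∀ B, K B ⊆ allowed σ B) {s : Set (Phase X)} (hs : MeasurableSet s) :
    RepresentedIn V ((s ∩ partsBox P K).indicator fun _ => (1 : ℝ)) := by
  have hint := integrable_indicator_partsBox (σ := σ) P (fun B => (hK B).measurableSet)
    fun B => (hK B).isBounded
  have hgen : (MeasurableSpace.pi : MeasurableSpace (Phase X)) = MeasurableSpace.generateFrom
      (Set.pi univ '' Set.pi univ fun _ : X => {C : Set (ℝ × ℝ) | IsClosed C}) := by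
    refine (generateFrom_eq_pi (fun _ => ?_) fun _ => ?_).symm
    · rw [← borel_eq_generateFrom_isClosed]
      exact (BorelSpace.measurable_eq (α := ℝ × ℝ)).symm
    · exact ⟨fun _ => univ, fun _ => isClosed_univ, iUnion_const _⟩
  have hpi : IsPiSystem (Set.pi univ '' Set.pi univ fun _ : X => {C : Set (ℝ × ℝ) | IsClosed C}) :=
    IsPiSystem.pi fun _ s hs t ht _ => IsClosed.inter hs ht
  refine MeasurableSpace.induction_on_inter (C := fun s _ =>
    RepresentedIn V ((s ∩ partsBox P K).indicator fun _ => (1 : ℝ))) hgen hpi ?_ ?_ ?_ ?_ s hs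
  · simpa using (RepresentedIn.zero (V := V))
  · rintro _ ⟨C, hC, rfl⟩
    have : Set.pi univ C ∩ partsBox P K = partsBox P fun B =>
        K B ∩ Set.pi univ fun b : (B : Finset ℤ) => C ⟨b, P.le B.2 b.2⟩ := by
      ext x
      simp only [partsBox, mem_inter_iff, mem_univ_pi, Set.mem_ofPred_eq]
      constructor
      · rintro ⟨h1, h2⟩ B
        exact ⟨h2 B, fun b => h1 _⟩
      · intro h
        exact ⟨fun i => (h ⟨_, P.part_mem.2 i.2⟩).2 ⟨i, P.mem_part_self.2 i.2⟩, fun B => (h B).1⟩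
    rw [this]
    exact representedIn_partsBox hV hP
      (fun B => (hK B).inter_right (isClosed_set_pi fun b _ => hC _ (mem_univ _)))
      fun B => inter_subset_left.trans (hKU B)
  · intro t _ ht
    refine ((representedIn_partsBox hV hP hK hKU).sub ht).congr (Eventually.of_forall fun x => ?_)
    by_cases h1 : x ∈ partsBox P K <;> by_cases h2 : x ∈ t <;> simp [h1, h2]
  · intro t hd _ ht
    have hsum : ∀ n, RepresentedIn V
        ((Set.accumulate t n ∩ partsBox P K).indicator fun _ => (1 : ℝ)) := by
      intro n
      induction n with
      | zero => simpa [Set.accumulate_zero_nat] using ht 0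
      | succ n ih =>
        refine (ih.add (ht (n + 1))).congr (Eventually.of_forall fun x => ?_)
        have hdis : x ∈ t (n + 1) → x ∉ Set.accumulate t n := by
          intro hx hx'
          obtain ⟨i, hi, hxi⟩ := Set.mem_accumulate.1 hx'
          exact (Set.disjoint_left.1 (hd (by omega : i ≠ n + 1)) hxi) hx
        have hu : Set.accumulate t (n + 1) = Set.accumulate t n ∪ t (n + 1) :=
          Set.accumulate_succ t n
        rw [hu]
        by_cases h1 : x ∈ partsBox P K <;> by_cases h2 : x ∈ t (n + 1)
        · simp [h1, h2, hdis h2]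
        · by_cases h3 : x ∈ Set.accumulate t n <;> simp [h1, h2, h3]
        · simp [h1]
        · simp [h1]
    refine RepresentedIn.of_tendsto hV hsum hint (fun n => Eventually.of_forall fun x => ?_)
      (Eventually.of_forall fun x => ?_)
    · refine (norm_indicator_le_of_subset inter_subset_right _ x).trans (le_of_eq ?_)
      by_cases h1 : x ∈ partsBox P K <;> simp [h1]
    · have hmono : Monotone fun n => Set.accumulate t n ∩ partsBox P K := fun m n hmn =>
        inter_subset_inter_left _ (Set.monotone_accumulate hmn)
      have := hmono.tendsto_indicator _ (fun _ => (1 : ℝ)) x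
      rw [← iUnion_inter, Set.iUnion_accumulate] at this
      exact this.mono_right (pure_le_nhds _)

lemma exists_compact_exhaustion {E : Type*} [TopologicalSpace E] [LocallyCompactSpace E]
    [SecondCountableTopology E] {U : Set E} (hU : IsOpen U) :
    ∃ K : ℕ → Set E, (∀ n, IsCompact (K n)) ∧ Monotone K ∧ ⋃ n, K n = U := by
  have : LocallyCompactSpace U := hU.locallyCompactSpace
  obtain ⟨K, hK, hU'⟩ := isSigmaCompact_iff_sigmaCompactSpace.2 (inferInstance : SigmaCompactSpace U)
  exact ⟨Set.accumulate K, fun n => isCompact_accumulate hK n, Set.monotone_accumulate,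
    (Set.iUnion_accumulate).trans hU'⟩

/-- The products of smooth functions with compact supports span a dense subspace. -/
theorem eq_top_of_containsSmoothProducts {P : Finpartition X} {V : Submodule ℝ (L1Parts σ P)}
    (hV : IsClosed (V : Set (L1Parts σ P))) (hP : ContainsSmoothProducts P V) : V = ⊤ := by
  have hex := fun B : P.parts => exists_compact_exhaustion (isOpen_allowed σ B)
  choose K hK hmono hU using hex
  -- Exhausting the allowed sets of the parts by compact sets removes the restriction to a box,
  -- since almost every point lies in one of the boxes. Linear combinations of such indicators are
  -- dense in L¹.
  have hind : ∀ {s : Set (Phase X)}, MeasurableSet s → partsMeasure σ P s < ⊤ →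
      RepresentedIn V (s.indicator fun _ => (1 : ℝ)) := by
    intro s hs hfin
    refine RepresentedIn.of_tendsto hV
      (u := fun n => (s ∩ partsBox P fun B => K B n).indicator fun _ => (1 : ℝ))
      (fun n => representedIn_inter_partsBox hV hP (fun B => hK B n)
        (fun B => (subset_iUnion (K B) n).trans (hU B).subset) hs)
      (bound := s.indicator fun _ => (1 : ℝ))
      ((integrable_indicator_iff hs).2 (integrableOn_const hfin.ne))
      (fun n => Eventually.of_forall fun x => ?_) ?_
    · refine (norm_indicator_le_of_subset inter_subset_left _ x).trans (le_of_eq ?_)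
      by_cases h1 : x ∈ s <;> simp [h1]
    · filter_upwards [ae_restrict_mem (measurableSet_allowedParts σ P)] with x hx
      have hm : ∀ B : P.parts, ∃ n, proj (P.le B.2) x ∈ K B n := fun B => by
        have := hx B
        rw [← hU B] at this
        exact mem_iUnion.1 this
      choose n hn using hm
      refine tendsto_const_nhds.congr' ?_
      filter_upwards [eventually_ge_atTop (∑ B, n B)] with m hmm
      have hxm : x ∈ partsBox P fun B => K B m := fun B =>
        hmono B ((Finset.single_le_sum (f := n) (fun _ _ => Nat.zero_le _)
          (Finset.mem_univ B)).trans hmm) (hn B)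
      by_cases h1 : x ∈ s <;> simp [h1, hxm]
  rw [Submodule.eq_top_iff']
  intro F
  refine Lp.induction (by simp) (motive := fun F : Lp ℝ 1 (partsMeasure σ P) => F ∈ V) ?_ ?_ hV F
  · intro c s hs hfin
    refine ((hind hs hfin).smul c).mem ?_
    rw [Lp.simpleFunc.coe_indicatorConst]
    filter_upwards [indicatorConstLp_coeFn (p := 1) (hs := hs) (hμs := hfin.ne) (c := c)] with x hx
    rw [hx]
    by_cases h1 : x ∈ s <;> simp [h1]
  · intro f g hf hg _ h1 h2
    exact V.add_mem h1 h2

end Density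

end NearestNeighbour



namespace NearestNeighbour

/-! ### The cumulants as bounded operators -/

section Restriction

variable {α : Type*} [MeasurableSpace α] {μ ν : Measure α}

/-- Restriction of integrable functions to a smaller measure. -/
noncomputable def restrictL1 (h : μ ≤ ν) : Lp ℝ 1 ν →L[ℝ] Lp ℝ 1 μ :=
  LinearMap.mkContinuous
    { toFun := fun F => ((Lp.memLp F).mono_measure h).toLp F
      map_add' := fun F G => by
        refine Lp.ext ?_
        have hac : μ ≪ ν := Measure.absolutelyContinuous_of_le h
        filter_upwards [((Lp.memLp (F + G)).mono_measure h).coeFn_toLp,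
          ((Lp.memLp F).mono_measure h).coeFn_toLp, ((Lp.memLp G).mono_measure h).coeFn_toLp,
          hac.ae_le (Lp.coeFn_add F G), Lp.coeFn_add (((Lp.memLp F).mono_measure h).toLp F)
            (((Lp.memLp G).mono_measure h).toLp G)] with x h1 h2 h3 h4 h5
        rw [h1, h4, h5, Pi.add_apply, Pi.add_apply, h2, h3]
      map_smul' := fun c F => by
        refine Lp.ext ?_
        have hac : μ ≪ ν := Measure.absolutelyContinuous_of_le h
        filter_upwards [((Lp.memLp (c • F)).mono_measure h).coeFn_toLp,
          ((Lp.memLp F).mono_measure h).coeFn_toLp,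
          hac.ae_le (Lp.coeFn_smul c F),
          Lp.coeFn_smul c (((Lp.memLp F).mono_measure h).toLp F)] with x h1 h2 h4 h5
        rw [h1, h4, RingHom.id_apply, h5, Pi.smul_apply, Pi.smul_apply, h2] } 1 fun F => by
    rw [one_mul]
    refine ENNReal.toReal_le_toReal (Lp.eLpNorm_ne_top _) (Lp.eLpNorm_ne_top _) |>.2 ?_
    refine (eLpNorm_congr_ae ((Lp.memLp F).mono_measure h).coeFn_toLp).trans_le ?_
    exact eLpNorm_mono_measure _ h

lemma coeFn_restrictL1 (h : μ ≤ ν) (F : Lp ℝ 1 ν) : restrictL1 h F =ᵐ[μ] F :=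
  ((Lp.memLp F).mono_measure h).coeFn_toLp

end Restriction

section Operators

variable {σ R : ℝ} {Φ : ℝ → ℝ} {X : Finset ℤ}

/-- A surjective linear map sends Lebesgue measure to a multiple of Lebesgue measure. The multiple
may be infinite, but preimages of null sets are null, so almost everywhere identities for a block
can be used inside functions of a larger one. -/
lemma quasiMeasurePreserving_proj {B : Finset ℤ} (h : B ⊆ X) {s : Set (Phase X)}
    {U : Set (Phase B)} (hsU : MapsTo (proj h) s U) :
    Measure.QuasiMeasurePreserving (proj h) (volume.restrict s) (volume.restrict U) := by
  let L : Phase X →ₗ[ℝ] Phase B :=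
    { toFun := proj h, map_add' := fun _ _ => rfl, map_smul' := fun _ _ => rfl }
  have hL : Function.Surjective L := by
    intro y
    refine ⟨fun i => if hi : (i : ℤ) ∈ B then y ⟨i, hi⟩ else 0, ?_⟩
    funext b
    exact dif_pos b.2
  obtain ⟨c, -, hc⟩ := LinearMap.exists_map_addHaar_eq_smul_addHaar L
    (volume : Measure (Phase X)) (volume : Measure (Phase B)) hL
  have hq : Measure.QuasiMeasurePreserving (proj h) volume volume := by
    refine ⟨measurable_proj h, ?_⟩
    change Measure.map L volume ≪ volume
    rw [hc]
    exact Measure.smul_absolutelyContinuous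
  exact hq.restrict hsU

lemma ae_proj_of_mem_parts (P : Finpartition X) (B : P.parts) {p : Phase (B : Finset ℤ) → Prop}
    (hp : ∀ᵐ y ∂phaseMeasure σ B, p y) : ∀ᵐ x ∂partsMeasure σ P, p (proj (P.le B.2) x) :=
  (quasiMeasurePreserving_proj (P.le B.2)
    fun x (hx : x ∈ allowedParts σ P) => hx B).ae hp

lemma ae_proj {B : Finset ℤ} (h : B ⊆ X) {p : Phase (B : Finset ℤ) → Prop}
    (hp : ∀ᵐ y ∂phaseMeasure σ B, p y) : ∀ᵐ x ∂phaseMeasure σ X, p (proj h x) :=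
  (quasiMeasurePreserving_proj h
    fun _ hx => proj_mem_allowed h hx).ae hp

/-- A coarser partition keeps more bonds inside its parts and so imposes more constraints. -/
lemma allowedParts_subset_of_le {P Q : Finpartition X} (h : P ≤ Q) :
    allowedParts σ Q ⊆ allowedParts σ P := by
  intro x hx B
  obtain ⟨C, hC, hBC⟩ := h B.2
  exact proj_mem_allowed hBC (hx ⟨C, hC⟩)

lemma partsMeasure_le {P Q : Finpartition X} (h : P ≤ Q) : partsMeasure σ Q ≤ partsMeasure σ P :=
  Measure.restrict_mono_set _ (allowedParts_subset_of_le h)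

lemma phaseMeasure_le (Q : Finpartition X) : phaseMeasure σ X ≤ partsMeasure σ Q :=
  Measure.restrict_mono_set _ (allowed_subset_allowedParts σ Q)

lemma ae_phaseMeasure (Q : Finpartition X) {p : Phase X → Prop}
    (hp : ∀ᵐ x ∂partsMeasure σ Q, p x) : ∀ᵐ x ∂phaseMeasure σ X, p x :=
  (Measure.absolutelyContinuous_of_le (phaseMeasure_le Q)).ae_le hp

/-- The flow of `Q` preserves the measure on the points allowed for `Q`, which are also allowed for
the finer `P`. Hence the operator is well defined on classes of functions given only on the latter
set. -/
lemma groupProduct_congr (hΦ : IsPotential σ R Φ) {P Q : Finpartition X} (h : P ≤ Q) (t : ℝ)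
    {F G : Phase X → ℝ} (hFG : F =ᵐ[partsMeasure σ P] G) :
    groupProduct σ Φ Q t F =ᵐ[partsMeasure σ Q] groupProduct σ Φ Q t G := by
  have h1 : F =ᵐ[partsMeasure σ Q] G :=
    (Measure.absolutelyContinuous_of_le (partsMeasure_le h)).ae_le hFG
  have h2 := ((isGlobalFlow_partFlow hΦ Q).measurePreserving (trace_partField hΦ Q)
    volume (-t)).quasiMeasurePreserving.ae h1
  filter_upwards [h2, ae_restrict_mem (measurableSet_allowedParts σ Q)] with x hx hx'
  rw [groupProduct_eq Q t F hx', groupProduct_eq Q t G hx', hx]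

/-- The operator `∏_{C ∈ Q} S*_C(t)` on the functions of the clusters of `P`. -/
noncomputable def partGroup (hΦ : IsPotential σ R Φ) {P Q : Finpartition X} (h : P ≤ Q) (t : ℝ) :
    L1Parts σ P →L[ℝ] L1Parts σ Q :=
  ((isGlobalFlow_partFlow hΦ Q).groupL1 (trace_partField hΦ Q)
    volume t).toContinuousLinearMap.comp (restrictL1 (partsMeasure_le h))

lemma coeFn_partGroup (hΦ : IsPotential σ R Φ) {P Q : Finpartition X} (h : P ≤ Q) (t : ℝ)
    (F : L1Parts σ P) : partGroup hΦ h t F =ᵐ[partsMeasure σ Q] groupProduct σ Φ Q t F := by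
  have h1 := (isGlobalFlow_partFlow hΦ Q).coeFn_groupL1 (trace_partField hΦ Q) (μ := volume) t
    (restrictL1 (partsMeasure_le h) F)
  have h2 := groupProduct_congr hΦ le_rfl t (coeFn_restrictL1 (partsMeasure_le (σ := σ) h) F)
  refine h1.trans ?_
  filter_upwards [h2, ae_restrict_mem (measurableSet_allowedParts σ Q)] with x hx hx'
  rw [← hx, groupProduct_eq Q t _ hx']

/-- The cumulants of the groups of operators. -/
noncomputable def cumulant (hΦ : IsPotential σ R Φ) : GeneratingOperators σ := fun t _ P =>
  ∑ Q : clusterPartitions P, (-1 : ℝ) ^ (Q.1.parts.card - 1) •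
    (restrictL1 (phaseMeasure_le Q.1)).comp (partGroup hΦ (mem_clusterPartitions.1 Q.2).2 t)

lemma coeFn_finsetSum {α ι : Type*} [MeasurableSpace α] {μ : Measure α} (s : Finset ι)
    (F : ι → Lp ℝ 1 μ) : (∑ i ∈ s, F i : Lp ℝ 1 μ) =ᵐ[μ] fun x => ∑ i ∈ s, F i x := by
  classical
  induction s using Finset.induction_on with
  | empty => simpa [Pi.zero_def] using Lp.coeFn_zero ℝ 1 μ
  | insert i s hi ih =>
    rw [Finset.sum_insert hi]
    filter_upwards [ih, Lp.coeFn_add (F i) (∑ i ∈ s, F i)] with x h1 h2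
    rw [h2, Pi.add_apply, h1, Finset.sum_insert hi]

lemma coeFn_cumulant (hΦ : IsPotential σ R Φ) (t : ℝ) (P : Finpartition X) (F : L1Parts σ P) :
    cumulant hΦ t X P F =ᵐ[phaseMeasure σ X] fun x =>
      ∑ Q ∈ clusterPartitions P, (-1 : ℝ) ^ (Q.parts.card - 1) * groupProduct σ Φ Q t F x := by
  have e : cumulant hΦ t X P F = ∑ Q : clusterPartitions P,
      (-1 : ℝ) ^ (Q.1.parts.card - 1) • restrictL1 (phaseMeasure_le Q.1)
        (partGroup hΦ (mem_clusterPartitions.1 Q.2).2 t F) := by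
    simp [cumulant]
  rw [e]
  refine (coeFn_finsetSum _ _).trans ?_
  have h1 : ∀ Q : clusterPartitions P, ∀ᵐ x ∂phaseMeasure σ X,
      ((-1 : ℝ) ^ (Q.1.parts.card - 1) • restrictL1 (phaseMeasure_le Q.1)
        (partGroup hΦ (mem_clusterPartitions.1 Q.2).2 t F) : L1 σ X) x =
      (-1 : ℝ) ^ (Q.1.parts.card - 1) * groupProduct σ Φ Q.1 t F x := by
    intro Q
    filter_upwards [Lp.coeFn_smul ((-1 : ℝ) ^ (Q.1.parts.card - 1))
      (restrictL1 (phaseMeasure_le Q.1) (partGroup hΦ (mem_clusterPartitions.1 Q.2).2 t F)),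
      coeFn_restrictL1 (phaseMeasure_le Q.1) (partGroup hΦ (mem_clusterPartitions.1 Q.2).2 t F),
      ae_phaseMeasure Q.1 (coeFn_partGroup hΦ (mem_clusterPartitions.1 Q.2).2 t F)] with x a b c
    rw [a, Pi.smul_apply, b, c, smul_eq_mul]
  filter_upwards [ae_all_iff.2 h1] with x hx
  rw [Finset.sum_congr rfl fun Q _ => hx Q]
  exact Finset.sum_coe_sort (clusterPartitions P)
    fun Q => (-1 : ℝ) ^ (Q.parts.card - 1) * groupProduct σ Φ Q t F x

/-- The families of operators which agree on the ordered partitions of blocks. -/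
def AgreeOnBlocks (A A' : GeneratingOperators σ) : Prop :=
  ∀ t X, IsBlock X → ∀ P ∈ orderedPartitions X, A t X P = A' t X P

lemma areCumulants_iff (hΦ : IsPotential σ R Φ) (A : GeneratingOperators σ) :
    AreCumulants Φ A ↔ AgreeOnBlocks A (cumulant hΦ) := by
  constructor
  · intro h t X hX P hP
    ext1 F
    exact Lp.ext ((h t X hX P hP F).trans (coeFn_cumulant hΦ t P F).symm)
  · intro h t X hX P hP F
    rw [h t X hX P hP]
    exact coeFn_cumulant hΦ t P F

lemma AgreeOnBlocks.expansion_eq {A A' : GeneratingOperators σ} (h : AgreeOnBlocks A A')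
    (g₀ : (X : Finset ℤ) → L1 σ X) (t : ℝ) (hX : IsBlock X) :
    expansion A g₀ t X = expansion A' g₀ t X :=
  Finset.sum_congr rfl fun P hP => by rw [h t X hX P hP]

end Operators

/-! ### Functions of clusters as numerical set functions at a fixed phase point. -/

section Values

variable {σ R : ℝ} {Φ : ℝ → ℝ} {X : Finset ℤ}

/-- The values `f_B(x_B)` for the subsets `B` of `X`. -/
noncomputable def valueAt (f : (B : Finset ℤ) → Phase B → ℝ) (x : Phase X) (B : Finset ℤ) : ℝ :=
  if h : B ⊆ X then f B (proj h x) else 0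

lemma valueAt_of_subset (f : (B : Finset ℤ) → Phase B → ℝ) (x : Phase X) {B : Finset ℤ}
    (h : B ⊆ X) : valueAt f x B = f B (proj h x) := dif_pos h

lemma valueAt_proj (f : (B : Finset ℤ) → Phase B → ℝ) {C B : Finset ℤ} (hC : C ⊆ X)
    (hB : B ⊆ C) (x : Phase X) : valueAt f (proj hC x) B = valueAt f x B := by
  rw [valueAt_of_subset f _ hB, valueAt_of_subset f _ (hB.trans hC)]
  rfl

lemma prodFun_eq (P : Finpartition X) (f : (B : Finset ℤ) → Phase B → ℝ) (x : Phase X) :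
    prodFun P f x = ∏ B ∈ P.parts, valueAt f x B := by
  rw [prodFun, ← Finset.prod_coe_sort P.parts]
  exact Finset.prod_congr rfl fun (B : P.parts) _ => (valueAt_of_subset f x (P.le B.2)).symm

/-- The functions `∑_P ∏_{B ∈ P} f_B(x_B)`. -/
noncomputable def clusterSum (f : (B : Finset ℤ) → Phase B → ℝ) (C : Finset ℤ) (y : Phase C) : ℝ :=
  partitionSum (valueAt f y) C

lemma clusterSum_eq (f : (B : Finset ℤ) → Phase B → ℝ) (C : Finset ℤ) (y : Phase C) :
    clusterSum f C y = ∑ P ∈ orderedPartitions C, prodFun P f y := by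
  simp only [clusterSum, partitionSum, prodFun_eq]

lemma clusterSum_proj (f : (B : Finset ℤ) → Phase B → ℝ) {C : Finset ℤ} (h : C ⊆ X)
    (x : Phase X) : clusterSum f C (proj h x) = partitionSum (valueAt f x) C :=
  partitionSum_congr fun _ _ hB => valueAt_proj f h hB x

/-- The functions `S*_C(t) ∑_P ∏_{B ∈ P} f_B(x_B)`. -/
noncomputable def evolved (σ : ℝ) (Φ : ℝ → ℝ) (f : (B : Finset ℤ) → Phase B → ℝ) (t : ℝ) (C : Finset ℤ) :
    Phase C → ℝ :=
  liouvilleGroup σ Φ C t (clusterSum f C)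

lemma evolved_of_mem {f : (B : Finset ℤ) → Phase B → ℝ} (t : ℝ) {y : Phase X}
    (hy : y ∈ allowed σ X) : evolved σ Φ f t X y = clusterSum f X (flow σ Φ X (-t) y) := by
  rw [evolved, liouvilleGroup, if_pos hy]

/-- The signed sums `∑_Q (-1)^{|Q| - 1} ∏_{C ∈ Q} f_C(x_C)`. -/
noncomputable def signedClusterSum (f : (B : Finset ℤ) → Phase B → ℝ) (X : Finset ℤ) (x : Phase X) : ℝ :=
  signedSum (valueAt f x) X

lemma signedClusterSum_proj (f : (B : Finset ℤ) → Phase B → ℝ) {C : Finset ℤ} (h : C ⊆ X)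
    (x : Phase X) : signedClusterSum f C (proj h x) = signedSum (valueAt f x) C :=
  signedSum_congr fun _ _ hB => valueAt_proj f h hB x

-- The partitions finer than `Q` are independent choices of partitions of its parts, and the parts
-- move independently, so the sum factorizes over the parts of `Q`.
open Classical in
lemma sum_groupProduct (Q : Finpartition X) (t : ℝ)
    (f : (B : Finset ℤ) → Phase B → ℝ) {x : Phase X} (hx : x ∈ allowedParts σ Q) :
    ∑ P ∈ (orderedPartitions X).filter (· ≤ Q), groupProduct σ Φ Q t (prodFun P f) x =
      ∏ C ∈ Q.parts, valueAt (evolved σ Φ f t) x C := by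
  simp only [groupProduct_eq Q t _ hx, prodFun_eq]
  rw [sum_prod_of_le, ← Finset.prod_coe_sort Q.parts]
  refine Finset.prod_congr rfl fun C _ => ?_
  rw [valueAt_of_subset _ _ (Q.le C.2), evolved_of_mem t (hx C), ← proj_partFlow Q (-t) hx C,
    clusterSum_proj]

lemma prodL1_ae_eq {g₀ : (X : Finset ℤ) → L1 σ X} {f₀ : (X : Finset ℤ) → Phase X → ℝ}
    (h : Represents g₀ f₀) {P : Finpartition X} (hP : P ∈ orderedPartitions X) :
    prodL1 P g₀ =ᵐ[partsMeasure σ P] prodFun P f₀ := by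
  refine (Integrable.coeFn_toL1 _).trans ?_
  have h1 : ∀ B : P.parts, ∀ᵐ x ∂partsMeasure σ P,
      g₀ B (proj (P.le B.2) x) = f₀ B (proj (P.le B.2) x) := fun B =>
    ae_proj_of_mem_parts P B (h B (mem_orderedPartitions.1 hP B B.2))
  filter_upwards [ae_all_iff.2 h1] with x hx
  exact Finset.prod_congr rfl fun B _ => hx B

/-- The expansion over the cumulants is the signed sum of the evolved functions. -/
theorem expansion_cumulant_ae_eq (hΦ : IsPotential σ R Φ) {g₀ : (X : Finset ℤ) → L1 σ X}
    {f₀ : (X : Finset ℤ) → Phase X → ℝ} (h : Represents g₀ f₀) (t : ℝ) (X : Finset ℤ) :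
    expansion (cumulant hΦ) g₀ t X =ᵐ[phaseMeasure σ X]
      signedClusterSum (evolved σ Φ f₀ t) X := by
  classical
  refine (coeFn_finsetSum _ _).trans ?_
  have h1 : ∀ P : orderedPartitions X, ∀ᵐ x ∂phaseMeasure σ X,
      cumulant hΦ t X P (prodL1 P.1 g₀) x = ∑ Q ∈ clusterPartitions P.1,
        (-1 : ℝ) ^ (Q.parts.card - 1) * groupProduct σ Φ Q t (prodFun P.1 f₀) x := by
    intro P
    have h2 : ∀ Q : clusterPartitions P.1, ∀ᵐ x ∂phaseMeasure σ X,
        groupProduct σ Φ Q.1 t (prodL1 P.1 g₀) x = groupProduct σ Φ Q.1 t (prodFun P.1 f₀) x :=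
      fun Q => ae_phaseMeasure Q.1
        (groupProduct_congr hΦ (mem_clusterPartitions.1 Q.2).2 t (prodL1_ae_eq h P.2))
    filter_upwards [coeFn_cumulant hΦ t P.1 (prodL1 P.1 g₀), ae_all_iff.2 h2] with x a b
    rw [a]
    exact Finset.sum_congr rfl fun Q hQ => by rw [b ⟨Q, hQ⟩]
  filter_upwards [ae_all_iff.2 h1, ae_restrict_mem (isOpen_allowed σ X).measurableSet] with x a hx
  have a' : ∀ P ∈ orderedPartitions X, cumulant hΦ t X P (prodL1 P g₀) x =
      ∑ Q ∈ clusterPartitions P,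
        (-1 : ℝ) ^ (Q.parts.card - 1) * groupProduct σ Φ Q t (prodFun P f₀) x :=
    fun P hP => a ⟨P, hP⟩
  rw [Finset.sum_congr rfl a', signedClusterSum, signedSum]
  have e : ∀ P : Finpartition X, clusterPartitions P = (orderedPartitions X).filter (P ≤ ·) := by
    intro P
    ext Q
    simp [mem_clusterPartitions]
  simp only [e, Finset.sum_filter]
  -- The sign depends only on `Q`. With the outer sum over `Q`, the inner sum over finer `P` becomes
  -- a product of evolved cluster sums.
  rw [Finset.sum_comm]
  refine Finset.sum_congr rfl fun Q _ => ?_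
  rw [← Finset.sum_filter, ← Finset.mul_sum,
    ← sum_groupProduct Q t f₀ (allowed_subset_allowedParts σ Q hx)]

end Values

end NearestNeighbour



namespace NearestNeighbour

/-! ### Weak solutions -/

lemma cutProduct_eq {X : Finset ℤ} (j : ℤ) (u : (B : Finset ℤ) → Phase B → ℝ) (x : Phase X) :
    cutProduct j u x = u (lowerPart X j) (proj (lowerPart_subset X j) x) *
      u (upperPart X j) (proj (upperPart_subset X j) x) := rfl

section Finer

variable {σ R : ℝ} {Φ : ℝ → ℝ} {X : Finset ℤ}

open Classical in
/-- The sum of the products over the partitions finer than `Q`. -/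
noncomputable def finerSum (f : (B : Finset ℤ) → Phase B → ℝ) (Q : Finpartition X) (x : Phase X) : ℝ :=
  ∑ P ∈ (orderedPartitions X).filter (· ≤ Q), prodFun P f x

lemma finerSum_partFlow (Q : Finpartition X) (t : ℝ) (f : (B : Finset ℤ) → Phase B → ℝ)
    {x : Phase X} (hx : x ∈ allowedParts σ Q) :
    finerSum f Q (partFlow σ Φ Q (-t) x) = ∏ C ∈ Q.parts, valueAt (evolved σ Φ f t) x C := by
  rw [← sum_groupProduct Q t f hx]
  exact Finset.sum_congr rfl fun P _ => (groupProduct_eq Q t _ hx).symm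

/-- Each summand is a time-independent function composed with a flow, the form in which time
derivatives are computed by transport along the field of that flow. -/
lemma signedClusterSum_evolved (t : ℝ) (f : (B : Finset ℤ) → Phase B → ℝ)
    {x : Phase X} (hx : x ∈ allowed σ X) :
    signedClusterSum (evolved σ Φ f t) X x = ∑ Q ∈ orderedPartitions X,
      (-1 : ℝ) ^ (Q.parts.card - 1) * finerSum f Q (partFlow σ Φ Q (-t) x) :=
  Finset.sum_congr rfl fun Q _ => by
    rw [finerSum_partFlow Q t f (allowed_subset_allowedParts σ Q hx)]

/-- The partitions of the two sides of the cut combine to the partitions `Q` of `X` with a cut after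
`j`. The signs (-1)^{|Q₁|-1} and (-1)^{|Q₂|-1} multiply to (-1)^{|Q|-2}, which explains the minus.
This identity matches the quadratic term with the interactions absent from the flow of `Q`. -/
lemma cutProduct_evolved (hX : IsBlock X) {j : ℤ} (hj : j ∈ cuts X) (t : ℝ)
    (f : (B : Finset ℤ) → Phase B → ℝ) {x : Phase X} (hx : x ∈ allowed σ X) :
    cutProduct j (signedClusterSum (evolved σ Φ f t)) x = -∑ Q ∈ orderedPartitions X,
      if next j ∉ Q.part j then
        (-1 : ℝ) ^ (Q.parts.card - 1) * finerSum f Q (partFlow σ Φ Q (-t) x) else 0 := by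
  rw [← Finset.sum_filter]
  have e : ∀ Q : Finpartition X,
      (-1 : ℝ) ^ (Q.parts.card - 1) * finerSum f Q (partFlow σ Φ Q (-t) x) =
      (-1 : ℝ) ^ (Q.parts.card - 1) * ∏ C ∈ Q.parts, valueAt (evolved σ Φ f t) x C := fun Q => by
    rw [finerSum_partFlow Q t f (allowed_subset_allowedParts σ Q hx)]
  simp only [e]
  rw [signedSum_cut hX hj, neg_neg, cutProduct_eq, signedClusterSum_proj, signedClusterSum_proj]

/-- At time zero the evolved functions are the plain partition sums of the data, which the signed
sum inverts. -/
lemma signedClusterSum_evolved_zero (hΦ : IsPotential σ R Φ) (hX : IsBlock X)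
    (f : (B : Finset ℤ) → Phase B → ℝ) {x : Phase X} (hx : x ∈ allowed σ X) :
    signedClusterSum (evolved σ Φ f 0) X x = f X x := by
  have h1 : ∀ B : Finset ℤ, IsBlock B → B ⊆ X →
      valueAt (evolved σ Φ f 0) x B = partitionSum (valueAt f x) B := by
    intro B _ hB
    rw [valueAt_of_subset _ _ hB, evolved_of_mem 0 (proj_mem_allowed hB hx), neg_zero,
      (isGlobalFlow_flow hΦ B).zero, clusterSum_proj]
  rw [signedClusterSum, signedSum_congr h1, signedSum_partitionSum _ hX,
    valueAt_of_subset _ _ subset_rfl]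
  rfl

end Finer

/-! ### The Liouville operators on test functions. -/

section Tests

variable {σ R : ℝ} {Φ : ℝ → ℝ} {X : Finset ℤ}

lemma IsTest.mono {E : Type*} [NormedAddCommGroup E] [NormedSpace ℝ E] {U U' : Set E} {φ : E → ℝ}
    (h : IsTest U φ) (hU : U ⊆ U') : IsTest U' φ := ⟨h.1, h.2.1, h.2.2.trans hU⟩

lemma continuous_liouvilleOp (hΦ : IsPotential σ R Φ) {φ : Phase X → ℝ}
    (hφ : IsTest (allowed σ X) φ) :
    Continuous (liouvilleOp Φ X φ) ∧ HasCompactSupport (liouvilleOp Φ X φ) := by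
  have h := isGlobalFlow_flow hΦ X
  have e : liouvilleOp Φ X φ = fun x => -along (hamiltonField Φ X) φ x := funext fun x => by
    rw [along_hamiltonField, neg_neg]
  rw [e]
  exact ⟨(hφ.continuous_along h.isOpen h.contDiffOn_field).neg,
    (hφ.hasCompactSupport_along _).neg⟩

/-- The operator is the difference of the derivatives along two bond fields, the free one and the
one with the single bond (j, k), so the facts about derivatives along fields apply. -/
lemma continuous_Lint (hΦ : IsPotential σ R Φ) {φ : Phase X → ℝ} (hφ : IsTest (allowed σ X) φ)
    {j k : X} (hjk : (k : ℤ) = next j) :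
    Continuous (Lint Φ j k φ) ∧ HasCompactSupport (Lint Φ j k φ) := by
  classical
  let r : X → X → Prop := fun a b => a = j ∧ b = k
  let r₀ : X → X → Prop := fun _ _ => False
  have e : Lint Φ j k φ = fun x => along (bondField Φ r₀) φ x - along (bondField Φ r) φ x := by
    funext x
    rw [along_bondField, along_bondField]
    have : (∑ a : X, ∑ b : X, if r a b then Lint Φ a b φ x else 0) = Lint Φ j k φ x := by
      rw [Finset.sum_eq_single_of_mem j (Finset.mem_univ _),
        Finset.sum_eq_single_of_mem k (Finset.mem_univ _)]
      · exact if_pos ⟨rfl, rfl⟩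
      · exact fun b _ hb => if_neg fun h => hb h.2
      · exact fun a _ ha => Finset.sum_eq_zero fun b _ => if_neg fun h => ha h.1
    rw [this]
    simp [r₀]
  have h0 : IsTest (bondAllowed σ r₀) φ := hφ.mono fun x _ a b h => h.elim
  have h1 : IsTest (bondAllowed σ r) φ := hφ.mono fun x hx a b h =>
    hx a b (by rw [h.1, h.2]; exact hjk)
  rw [e]
  exact ⟨(h0.continuous_along (isOpen_bondAllowed σ _) (contDiffOn_bondField hΦ _)).sub
    (h1.continuous_along (isOpen_bondAllowed σ _) (contDiffOn_bondField hΦ _)),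
    (h0.hasCompactSupport_along _).sub (h1.hasCompactSupport_along _)⟩

lemma integrable_mul_of_hasCompactSupport {α : Type*} [TopologicalSpace α] [MeasurableSpace α]
    [OpensMeasurableSpace α] {ν : Measure α} {F χ : α → ℝ} (hF : Integrable F ν)
    (hχ : Continuous χ ∧ HasCompactSupport χ) : Integrable (fun x => F x * χ x) ν := by
  obtain ⟨C, hC⟩ := hχ.2.exists_bound_of_continuous hχ.1
  exact integrable_Lp_mul hF hχ.1.aestronglyMeasurable hC

end Tests

/-! ### Weak solvability and uniqueness of the hierarchy. -/

section WeakSolutions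

variable {σ R : ℝ} {Φ : ℝ → ℝ}

lemma contDiff_proj {X B : Finset ℤ} (h : B ⊆ X) {n : WithTop ℕ∞} : ContDiff ℝ n (proj h) := by
  unfold proj
  fun_prop

lemma isCompact_partsBox {X : Finset ℤ} (P : Finpartition X) {K : (B : P.parts) → Set (Phase B)}
    (hK : ∀ B, IsCompact (K B)) : IsCompact (partsBox P K) := by
  have e : partsBox P K = glue P '' Set.pi univ K := by
    ext x
    constructor
    · intro hx
      exact ⟨fun B => proj (P.le B.2) x, fun B _ => hx B, glue_proj P x⟩
    · rintro ⟨y, hy, rfl⟩ B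
      rw [proj_glue]
      exact hy B (mem_univ _)
  rw [e]
  refine (isCompact_univ_pi hK).image ?_
  unfold glue
  fun_prop

lemma isTest_prodFun {X : Finset ℤ} {P : Finpartition X} {f : (B : Finset ℤ) → Phase B → ℝ}
    (hf : ∀ B ∈ P.parts, ContDiff ℝ ∞ (f B) ∧ HasCompactSupport (f B) ∧
      tsupport (f B) ⊆ allowed σ B) : IsTest (allowedParts σ P) (prodFun P f) := by
  have hK : IsCompact (partsBox P fun B => tsupport (f B)) :=
    isCompact_partsBox P fun B => (hf B B.2).2.1.isCompact
  have hs : tsupport (prodFun P f) ⊆ partsBox P fun B => tsupport (f B) := by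
    refine closure_minimal (fun x hx B => ?_) hK.isClosed
    by_contra h
    exact hx (Finset.prod_eq_zero (Finset.mem_univ B) (image_eq_zero_of_notMem_tsupport h))
  refine ⟨?_, hK.of_isClosed_subset (isClosed_tsupport _) hs, hs.trans fun x hx B =>
    (hf B B.2).2.2 (hx B)⟩
  unfold prodFun
  exact contDiff_prod fun B _ => ((hf B B.2).1.of_le (by norm_cast)).comp (contDiff_proj _)

/-- The functions with continuous orbits form a closed subspace that contains the products of smooth
functions over the parts of `Q`; by density it is everything. -/
lemma continuous_partGroup (hΦ : IsPotential σ R Φ) {X : Finset ℤ} {P Q : Finpartition X}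
    (h : P ≤ Q) (F : L1Parts σ P) : Continuous fun t => partGroup hΦ h t F := by
  have hf := isGlobalFlow_partFlow hΦ Q
  have htop : hf.continuousOrbit (trace_partField hΦ Q) volume = ⊤ := by
    refine eq_top_of_containsSmoothProducts (hf.isClosed_continuousOrbit (trace_partField hΦ Q))
      fun f hfs G hG => ?_
    exact hf.mem_continuousOrbit_of_isTest (trace_partField hΦ Q) (isTest_prodFun hfs) hG
  have h1 : restrictL1 (partsMeasure_le h) F ∈
      hf.continuousOrbit (trace_partField hΦ Q) volume := by rw [htop]; trivial
  exact h1

lemma continuous_expansion_cumulant (hΦ : IsPotential σ R Φ) (g₀ : (X : Finset ℤ) → L1 σ X)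
    (X : Finset ℤ) : Continuous fun t => expansion (cumulant hΦ) g₀ t X := by
  unfold expansion
  refine continuous_finsetSum _ fun P _ => ?_
  have e : ∀ t, cumulant hΦ t X P (prodL1 P g₀) = ∑ Q : clusterPartitions P,
      (-1 : ℝ) ^ (Q.1.parts.card - 1) • restrictL1 (phaseMeasure_le Q.1)
        (partGroup hΦ (mem_clusterPartitions.1 Q.2).2 t (prodL1 P g₀)) := fun t => by
    simp [cumulant]
  simp only [e]
  refine continuous_finsetSum _ fun Q _ => ?_
  have hQ : Continuous fun t => partGroup hΦ (mem_clusterPartitions.1 Q.2).2 t (prodL1 P g₀) :=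
    continuous_partGroup hΦ _ _
  exact ((restrictL1 (phaseMeasure_le Q.1)).continuous.comp hQ).const_smul
    ((-1 : ℝ) ^ (Q.1.parts.card - 1))

lemma integrable_finerSum {X : Finset ℤ} (g₀ : (X : Finset ℤ) → L1 σ X) (Q : Finpartition X) :
    Integrable (finerSum (fun B => g₀ B) Q) (partsMeasure σ Q) := by
  classical
  unfold finerSum
  refine integrable_finsetSum _ fun P hP => ?_
  exact (integrable_prodFun_L1 σ P g₀).mono_measure (partsMeasure_le (Finset.mem_filter.1 hP).2)

/-- The functions of the particles which move along the trajectories of the parts of `Q`, in the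
mean with respect to `χ`. -/
noncomputable def partMean (σ : ℝ) (Φ : ℝ → ℝ) {X : Finset ℤ} (f : (B : Finset ℤ) → Phase B → ℝ)
    (Q : Finpartition X) (t : ℝ) (χ : Phase X → ℝ) : ℝ :=
  ∫ x in allowed σ X, finerSum f Q (partFlow σ Φ Q (-t) x) * χ x

lemma integrable_finerSum_partFlow (hΦ : IsPotential σ R Φ) {X : Finset ℤ}
    (g₀ : (X : Finset ℤ) → L1 σ X) (Q : Finpartition X) (t : ℝ) :
    Integrable (fun x => finerSum (fun B => g₀ B) Q (partFlow σ Φ Q (-t) x)) (phaseMeasure σ X) :=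
  (((isGlobalFlow_partFlow hΦ Q).measurePreserving (trace_partField hΦ Q)
    volume (-t)).integrable_comp_of_integrable (integrable_finerSum g₀ Q)).mono_measure
      (phaseMeasure_le Q)

/-- This is the weak Liouville equation of the flow of `Q`, which lives on the larger set of points
allowed for `Q`. The test function vanishes off the points allowed for `X`, so all integrals reduce
to these, and its derivative along the field of `Q` is minus the Liouville operator plus the
interactions across the cuts. -/
lemma hasDerivAt_partMean (hΦ : IsPotential σ R Φ) {X : Finset ℤ} (g₀ : (X : Finset ℤ) → L1 σ X)
    (Q : Finpartition X) (t : ℝ) {φ : Phase X → ℝ} (hφ : IsTest (allowed σ X) φ) :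
    HasDerivAt (fun s => partMean σ Φ (fun B => g₀ B) Q s φ)
      (-partMean σ Φ (fun B => g₀ B) Q t (liouvilleOp Φ X φ) +
        ∑ j : X, ∑ k : X, if (k : ℤ) = next j then
          if (k : ℤ) ∉ Q.part j then partMean σ Φ (fun B => g₀ B) Q t (Lint Φ j k φ) else 0
          else 0) t := by
  have hm := measurableSet_allowedParts σ Q
  have hsub := allowed_subset_allowedParts σ Q
  have h0 : ∀ (v : Phase X → Phase X) x, x ∉ allowed σ X → along v φ x = 0 := fun v x hx =>
    image_eq_zero_of_notMem_tsupport fun h => hx (hφ.2.2 (tsupport_along_subset v h))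
  have key := (isGlobalFlow_partFlow hΦ Q).hasDerivAt_integral_comp_neg (trace_partField hΦ Q)
    (μ := volume) (integrable_finerSum g₀ Q) (hφ.mono hsub) t
  have e1 : ∀ s, ∫ x in allowedParts σ Q, finerSum (fun B => g₀ B) Q (partFlow σ Φ Q (-s) x) * φ x
      = partMean σ Φ (fun B => g₀ B) Q s φ := fun s =>
    setIntegral_eq_of_subset_of_forall_sdiff_eq_zero hm hsub fun x hx => by
      rw [image_eq_zero_of_notMem_tsupport fun h => hx.2 (hφ.2.2 h), mul_zero]
  have e2 : ∫ x in allowedParts σ Q, finerSum (fun B => g₀ B) Q (partFlow σ Φ Q (-t) x) *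
      along (bondField Φ (bondIn Q)) φ x =
      ∫ x in allowed σ X, finerSum (fun B => g₀ B) Q (partFlow σ Φ Q (-t) x) *
        along (bondField Φ (bondIn Q)) φ x :=
    setIntegral_eq_of_subset_of_forall_sdiff_eq_zero hm hsub fun x hx => by
      rw [h0 _ x hx.2, mul_zero]
  simp only [e1] at key
  refine key.congr_deriv ?_
  rw [e2]
  have hi := integrable_finerSum_partFlow hΦ g₀ Q t
  simp only [along_partField, mul_add, mul_neg, Finset.mul_sum, mul_ite, mul_zero]
  have hI : ∀ j k : X, Integrable (fun x => if (k : ℤ) = next j then if (k : ℤ) ∉ Q.part j then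
      finerSum (fun B => g₀ B) Q (partFlow σ Φ Q (-t) x) * Lint Φ j k φ x else 0 else 0)
      (phaseMeasure σ X) := by
    intro j k
    split_ifs with h1 h2
    · exact integrable_zero _ _ _
    · exact integrable_mul_of_hasCompactSupport hi (continuous_Lint hΦ hφ h1)
    · exact integrable_zero _ _ _
  have hL : Integrable (fun x => -(finerSum (fun B => g₀ B) Q (partFlow σ Φ Q (-t) x) *
      liouvilleOp Φ X φ x)) (phaseMeasure σ X) :=
    (integrable_mul_of_hasCompactSupport hi (continuous_liouvilleOp hΦ hφ)).neg
  rw [integral_add hL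
    (integrable_finsetSum _ fun j _ => integrable_finsetSum _ fun k _ => hI j k), integral_neg,
    integral_finsetSum _ fun j _ => integrable_finsetSum _ fun k _ => hI j k]
  refine congrArg₂ _ rfl (Finset.sum_congr rfl fun j _ => ?_)
  rw [integral_finsetSum _ fun k _ => hI j k]
  refine Finset.sum_congr rfl fun k _ => ?_
  split_ifs <;> first | rfl | simp

lemma represents_self (g₀ : (X : Finset ℤ) → L1 σ X) : Represents g₀ fun B => g₀ B :=
  fun _ _ => EventuallyEq.rfl

lemma integral_expansion_mul (hΦ : IsPotential σ R Φ) (g₀ : (X : Finset ℤ) → L1 σ X) (t : ℝ)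
    {X : Finset ℤ} {χ : Phase X → ℝ} (hχ : Continuous χ ∧ HasCompactSupport χ) :
    ∫ x in allowed σ X, expansion (cumulant hΦ) g₀ t X x * χ x = ∑ Q ∈ orderedPartitions X,
      (-1 : ℝ) ^ (Q.parts.card - 1) * partMean σ Φ (fun B => g₀ B) Q t χ := by
  simp only [partMean, ← integral_const_mul]
  rw [← integral_finsetSum _ fun Q _ =>
    (integrable_mul_of_hasCompactSupport (integrable_finerSum_partFlow hΦ g₀ Q t) hχ).const_mul _]
  refine integral_congr_ae ?_
  filter_upwards [expansion_cumulant_ae_eq hΦ (represents_self g₀) t X,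
    ae_restrict_mem (isOpen_allowed σ X).measurableSet] with x h1 hx
  rw [h1, signedClusterSum_evolved t _ hx, Finset.sum_mul]
  exact Finset.sum_congr rfl fun Q _ => by ring

lemma integral_cutProduct_mul (hΦ : IsPotential σ R Φ) (g₀ : (X : Finset ℤ) → L1 σ X) (t : ℝ)
    {X : Finset ℤ} (hX : IsBlock X) {j : ℤ} (hj : j ∈ cuts X) {χ : Phase X → ℝ}
    (hχ : Continuous χ ∧ HasCompactSupport χ) :
    ∫ x in allowed σ X, cutProduct j (fun B => expansion (cumulant hΦ) g₀ t B) x * χ x =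
      -∑ Q ∈ orderedPartitions X, if next j ∉ Q.part j then
        (-1 : ℝ) ^ (Q.parts.card - 1) * partMean σ Φ (fun B => g₀ B) Q t χ else 0 := by
  have hI : ∀ Q : Finpartition X, Integrable (fun x => if next j ∉ Q.part j then
      (-1 : ℝ) ^ (Q.parts.card - 1) * (finerSum (fun B => g₀ B) Q (partFlow σ Φ Q (-t) x) * χ x)
      else 0) (phaseMeasure σ X) := by
    intro Q
    split_ifs
    · exact integrable_zero _ _ _
    · exact (integrable_mul_of_hasCompactSupport
        (integrable_finerSum_partFlow hΦ g₀ Q t) hχ).const_mul _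
  have e : ∀ Q : Finpartition X, (if next j ∉ Q.part j then
        (-1 : ℝ) ^ (Q.parts.card - 1) * partMean σ Φ (fun B => g₀ B) Q t χ else 0) =
      ∫ x in allowed σ X, if next j ∉ Q.part j then (-1 : ℝ) ^ (Q.parts.card - 1) *
        (finerSum (fun B => g₀ B) Q (partFlow σ Φ Q (-t) x) * χ x) else 0 := by
    intro Q
    split_ifs
    · simp
    · rw [integral_const_mul]; rfl
  simp only [e]
  rw [← integral_finsetSum _ fun Q _ => hI Q, ← integral_neg]
  refine integral_congr_ae ?_
  filter_upwards [ae_proj (lowerPart_subset X j)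
      (expansion_cumulant_ae_eq hΦ (represents_self g₀) t (lowerPart X j)),
    ae_proj (upperPart_subset X j)
      (expansion_cumulant_ae_eq hΦ (represents_self g₀) t (upperPart X j)),
    ae_restrict_mem (isOpen_allowed σ X).measurableSet] with x h1 h2 hx
  have : cutProduct j (fun B => expansion (cumulant hΦ) g₀ t B) x =
      cutProduct j (signedClusterSum (evolved σ Φ (fun B => g₀ B) t)) x := by
    simp only [cutProduct_eq]
    rw [h1, h2]
  rw [this, cutProduct_evolved hX hj t _ hx, neg_mul, Finset.sum_mul]
  congr 1
  exact Finset.sum_congr rfl fun Q _ => by split_ifs <;> ring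

/-- The expansion over the cumulants is a weak solution. -/
theorem isWeakSolution_expansion_cumulant (hΦ : IsPotential σ R Φ)
    (g₀ : (X : Finset ℤ) → L1 σ X) : IsWeakSolution σ Φ g₀ (expansion (cumulant hΦ) g₀) := by
  intro X hX
  refine ⟨?_, continuous_expansion_cumulant hΦ g₀ X, fun φ hφ t => ?_⟩
  · refine Lp.ext ?_
    filter_upwards [expansion_cumulant_ae_eq hΦ (represents_self g₀) 0 X,
      ae_restrict_mem (isOpen_allowed σ X).measurableSet] with x h1 hx
    rw [h1, signedClusterSum_evolved_zero hΦ hX _ hx]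
  · have hφ' : IsTest (allowed σ X) φ := hφ
    have e : ∀ s, ∫ x in allowed σ X, expansion (cumulant hΦ) g₀ s X x * φ x = _ := fun s =>
      integral_expansion_mul hΦ g₀ s ⟨hφ.1.continuous, hφ.2.1⟩
    simp only [e]
    refine (HasDerivAt.fun_sum fun Q _ =>
      (hasDerivAt_partMean hΦ g₀ Q t hφ').const_mul _).congr_deriv ?_
    rw [integral_expansion_mul hΦ g₀ t (continuous_liouvilleOp hΦ hφ')]
    -- The quadratic term for the bond (j, k) equals minus the sum over those `Q` whose flow lacks
    -- this bond, which is what the derivatives of the terms of `Q` contribute.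
    have e2 : ∀ j k : X, (if (k : ℤ) = next j then ∫ x in allowed σ X,
        cutProduct j (fun B => expansion (cumulant hΦ) g₀ t B) x * Lint Φ j k φ x else 0) =
        -∑ Q ∈ orderedPartitions X, (-1 : ℝ) ^ (Q.parts.card - 1) * if (k : ℤ) = next j then
          if (k : ℤ) ∉ Q.part j then partMean σ Φ (fun B => g₀ B) Q t (Lint Φ j k φ) else 0
          else 0 := by
      intro j k
      by_cases h : (k : ℤ) = next j
      · simp only [if_pos h]
        rw [integral_cutProduct_mul hΦ g₀ t hX (mem_cuts.2 ⟨j.2, h ▸ k.2⟩)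
          (continuous_Lint hΦ hφ' h)]
        congr 1
        refine Finset.sum_congr rfl fun Q _ => ?_
        rw [h]
        split_ifs <;> simp
      · simp [h]
    simp only [e2, Finset.sum_neg_distrib, sub_neg_eq_add, mul_add, Finset.sum_add_distrib,
      mul_neg, Finset.mul_sum]
    congr 1
    rw [Finset.sum_comm]
    exact Finset.sum_congr rfl fun j _ => Finset.sum_comm

/-- Both sides of a cut of a block are blocks, so the hierarchy on blocks never refers to the family
at other index sets. -/
lemma IsWeakSolution.congr {g₀ : (X : Finset ℤ) → L1 σ X} {g g' : ℝ → (X : Finset ℤ) → L1 σ X}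
    (hg : IsWeakSolution σ Φ g₀ g) (h : ∀ t X, IsBlock X → g t X = g' t X) :
    IsWeakSolution σ Φ g₀ g' := by
  intro X hX
  obtain ⟨h0, hc, hd⟩ := hg X hX
  refine ⟨by rw [← h 0 X hX, h0], by simpa only [h _ X hX] using hc, fun φ hφ t => ?_⟩
  have h1 := hd φ hφ t
  simp only [h _ X hX] at h1
  refine h1.congr_deriv (congrArg₂ _ rfl ?_)
  refine Finset.sum_congr rfl fun j _ => Finset.sum_congr rfl fun k _ => ?_
  split_ifs with hjk
  · have hj : (j : ℤ) ∈ cuts X := mem_cuts.2 ⟨j.2, hjk ▸ k.2⟩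
    simp only [cutProduct_eq]
    rw [h t _ (hX.lowerPart j.2), h t _ (hX.upperPart hj)]
  · rfl

/-- Weak solutions are determined by the initial data. -/
theorem weakSolution_unique (hΦ : IsPotential σ R Φ) {g₀ : (X : Finset ℤ) → L1 σ X}
    {g g' : ℝ → (X : Finset ℤ) → L1 σ X} (hg : IsWeakSolution σ Φ g₀ g)
    (hg' : IsWeakSolution σ Φ g₀ g') (t : ℝ) {X : Finset ℤ} (hX : IsBlock X) :
    g t X = g' t X := by
  induction hn : X.card using Nat.strong_induction_on generalizing X t with
  | _ n ih =>
  obtain ⟨h0, hc, hd⟩ := hg X hX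
  obtain ⟨h0', hc', hd'⟩ := hg' X hX
  -- The quadratic terms involve strictly smaller blocks, on which the two solutions already agree.
  -- They cancel, and the difference solves the linear equation.
  have hcut : ∀ (s : ℝ) (j k : X), (k : ℤ) = next j → ∀ x : Phase X,
      cutProduct j (fun B => g s B) x = cutProduct j (fun B => g' s B) x := by
    intro s j k h x
    have hj : (j : ℤ) ∈ cuts X := mem_cuts.2 ⟨j.2, h ▸ k.2⟩
    simp only [cutProduct_eq]
    rw [ih _ (hn ▸ lowerPart_card_lt hj) s (hX.lowerPart j.2) rfl,
      ih _ (hn ▸ upperPart_card_lt hj) s (hX.upperPart hj) rfl]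
  have hI : ∀ (F : L1 σ X) {χ : Phase X → ℝ}, Continuous χ ∧ HasCompactSupport χ →
      Integrable (fun x => F x * χ x) (phaseMeasure σ X) := fun F χ hχ =>
    integrable_mul_of_hasCompactSupport (L1.integrable_coeFn F) hχ
  have hsub : ∀ (F G : L1 σ X) {χ : Phase X → ℝ}, Continuous χ ∧ HasCompactSupport χ →
      ∫ x in allowed σ X, (F - G : L1 σ X) x * χ x =
        (∫ x in allowed σ X, F x * χ x) - ∫ x in allowed σ X, G x * χ x := by
    intro F G χ hχ
    refine Eq.trans ?_ (integral_sub (hI F hχ) (hI G hχ))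
    refine integral_congr_ae ?_
    filter_upwards [Lp.coeFn_sub F G] with x hx
    rw [hx, Pi.sub_apply, sub_mul]
  refine sub_eq_zero.1 ((isGlobalFlow_flow hΦ X).eq_zero_of_weak (μ := volume)
    (H := fun t => g t X - g' t X) (hc.sub hc') (by simp only [h0, h0', sub_self])
    (fun φ hφ s => ?_) t)
  have hφc : Continuous φ ∧ HasCompactSupport φ := ⟨hφ.1.continuous, hφ.2.1⟩
  simp only [hsub _ _ hφc]
  refine ((hd φ hφ s).fun_sub (hd' φ hφ s)).congr_deriv ?_
  have e : (fun x => (g s X - g' s X : L1 σ X) x * along (hamiltonField Φ X) φ x) =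
      fun x => -((g s X - g' s X : L1 σ X) x * liouvilleOp Φ X φ x) := funext fun x => by
    rw [along_hamiltonField, mul_neg]
  rw [e, integral_neg, hsub _ _ (continuous_liouvilleOp hΦ hφ)]
  have e3 : (∑ j : X, ∑ k : X, if (k : ℤ) = next j then ∫ x in allowed σ X,
      cutProduct j (fun B => g s B) x * Lint Φ j k φ x else 0) =
      ∑ j : X, ∑ k : X, if (k : ℤ) = next j then ∫ x in allowed σ X,
        cutProduct j (fun B => g' s B) x * Lint Φ j k φ x else 0 := by
    refine Finset.sum_congr rfl fun j _ => Finset.sum_congr rfl fun k _ => ?_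
    split_ifs with h
    · simp only [hcut s j k h]
    · rfl
  rw [e3]
  ring

end WeakSolutions

end NearestNeighbour



namespace NearestNeighbour

/-! ### Classical solutions -/

section ClassicalSolutions

variable {σ R : ℝ} {Φ : ℝ → ℝ} {X : Finset ℤ}

lemma liouvilleOp_eq_fderiv (f : Phase X → ℝ) (x : Phase X) :
    liouvilleOp Φ X f x = -fderiv ℝ f x (hamiltonField Φ X x) := by
  rw [← neg_neg (liouvilleOp Φ X f x), ← along_hamiltonField]
  rfl

lemma Lint_eq_fderiv (j k : X) (f : Phase X → ℝ) (x : Phase X) :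
    Lint Φ j k f x = fderiv ℝ f x (deriv Φ ((x j).1 - (x k).1) •
      (Pi.single j (0, 1) - Pi.single k (0, 1))) := by
  rw [map_smul, map_sub, smul_eq_mul]
  rfl

lemma fderiv_eq_sum_smul {E ι : Type*} [NormedAddCommGroup E] [NormedSpace ℝ E] {s : Finset ι}
    {f : E → ℝ} {c : ι → ℝ} {G : ι → E → ℝ} {x : E} (hG : ∀ i ∈ s, DifferentiableAt ℝ (G i) x)
    (hf : f =ᶠ[𝓝 x] fun y => ∑ i ∈ s, c i * G i y) :
    fderiv ℝ f x = ∑ i ∈ s, c i • fderiv ℝ (G i) x := by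
  rw [hf.fderiv_eq]
  exact (HasFDerivAt.fun_sum fun i hi => (hG i hi).hasFDerivAt.const_mul (c i)).fderiv

lemma contDiff_prodFun {P : Finpartition X} {f : (B : Finset ℤ) → Phase B → ℝ}
    (hf : ∀ B ∈ P.parts, ContDiff ℝ ∞ (f B)) : ContDiff ℝ 1 (prodFun P f) := by
  unfold prodFun
  exact contDiff_prod fun B _ => ((hf B B.2).of_le (by norm_cast)).comp (contDiff_proj _)

lemma IsSmoothData.contDiff_finerSum {f : (B : Finset ℤ) → Phase B → ℝ} (hf : IsSmoothData σ f)
    (Q : Finpartition X) : ContDiff ℝ 1 (finerSum f Q) := by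
  classical
  unfold finerSum
  exact ContDiff.sum fun P hP => contDiff_prodFun fun B hB =>
    (hf B (mem_orderedPartitions.1 (Finset.mem_filter.1 hP).1 B hB)).1

lemma contDiffOn_finerSum_partFlow (hΦ : IsPotential σ R Φ) {f : (B : Finset ℤ) → Phase B → ℝ}
    (hf : IsSmoothData σ f) (Q : Finpartition X) :
    ContDiffOn ℝ 1 (fun z : ℝ × Phase X => finerSum f Q (partFlow σ Φ Q (-z.1) z.2))
      (univ ×ˢ allowed σ X) := by
  have h1 : ContDiffOn ℝ 1 (fun z : ℝ × Phase X => partFlow σ Φ Q (-z.1) z.2)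
      (univ ×ˢ allowed σ X) :=
    (isGlobalFlow_partFlow hΦ Q).contDiffOn.comp
      (f := fun z : ℝ × Phase X => (-z.1, z.2)) (by fun_prop)
      fun z hz => ⟨mem_univ _, allowed_subset_allowedParts σ Q hz.2⟩
  exact (hf.contDiff_finerSum Q).comp_contDiffOn h1

lemma differentiableAt_finerSum_partFlow (hΦ : IsPotential σ R Φ)
    {f : (B : Finset ℤ) → Phase B → ℝ} (hf : IsSmoothData σ f) (Q : Finpartition X) (t : ℝ)
    {x : Phase X} (hx : x ∈ allowed σ X) :
    DifferentiableAt ℝ (fun y => finerSum f Q (partFlow σ Φ Q (-t) y)) x := by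
  have ho : IsOpen ((univ : Set ℝ) ×ˢ allowed σ X) := isOpen_univ.prod (isOpen_allowed σ X)
  have h1 := ((contDiffOn_finerSum_partFlow hΦ hf Q).contDiffAt
    (ho.mem_nhds (mk_mem_prod (mem_univ t) hx))).differentiableAt one_ne_zero
  exact h1.comp (f := fun y => (t, y)) x (by fun_prop)

/-- The signed sum of the evolved functions is a classical solution. -/
theorem isClassicalSolution_signedClusterSum (hΦ : IsPotential σ R Φ)
    {f : (B : Finset ℤ) → Phase B → ℝ} (hf : IsSmoothData σ f) :
    IsClassicalSolution σ Φ f fun t => signedClusterSum (evolved σ Φ f t) := by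
  intro X hX
  refine ⟨fun x hx => signedClusterSum_evolved_zero hΦ hX f hx, ?_, fun t x hx => ?_⟩
  · refine ContDiffOn.congr (f := fun z : ℝ × Phase X => ∑ Q ∈ orderedPartitions X,
      (-1 : ℝ) ^ (Q.parts.card - 1) * finerSum f Q (partFlow σ Φ Q (-z.1) z.2)) ?_
      fun z hz => signedClusterSum_evolved z.1 f hz.2
    exact ContDiffOn.sum fun Q _ =>
      contDiffOn_const.mul (contDiffOn_finerSum_partFlow hΦ hf Q)
  · have hnear : ∀ᶠ y in 𝓝 x, y ∈ allowed σ X := (isOpen_allowed σ X).mem_nhds hx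
    have hG : ∀ Q ∈ orderedPartitions X,
        DifferentiableAt ℝ (fun y => finerSum f Q (partFlow σ Φ Q (-t) y)) x := fun Q _ =>
      differentiableAt_finerSum_partFlow hΦ hf Q t hx
    have hL : liouvilleOp Φ X (signedClusterSum (evolved σ Φ f t) X) x =
        ∑ Q ∈ orderedPartitions X, (-1 : ℝ) ^ (Q.parts.card - 1) *
          liouvilleOp Φ X (fun y => finerSum f Q (partFlow σ Φ Q (-t) y)) x := by
      simp only [liouvilleOp_eq_fderiv]
      rw [fderiv_eq_sum_smul hG (hnear.mono fun y hy => signedClusterSum_evolved t f hy)]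
      simp [Finset.sum_neg_distrib]
    -- The identity for the product across a cut holds at all points of the open allowed set, hence
    -- may be differentiated there.
    have hI : ∀ j k : X, (if (k : ℤ) = next j then
        Lint Φ j k (cutProduct j (signedClusterSum (evolved σ Φ f t))) x else 0) =
        -∑ Q ∈ orderedPartitions X, (-1 : ℝ) ^ (Q.parts.card - 1) * if (k : ℤ) = next j then
          if (k : ℤ) ∉ Q.part j then
            Lint Φ j k (fun y => finerSum f Q (partFlow σ Φ Q (-t) y)) x else 0 else 0 := by
      intro j k
      by_cases h : (k : ℤ) = next j
      · simp only [if_pos h, Lint_eq_fderiv]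
        have hj : (j : ℤ) ∈ cuts X := mem_cuts.2 ⟨j.2, h ▸ k.2⟩
        rw [fderiv_eq_sum_smul (c := fun Q => -if next j ∉ Q.part j then
          (-1 : ℝ) ^ (Q.parts.card - 1) else 0) hG (hnear.mono fun y hy => ?_),
          FunLike.coe_sum, Finset.sum_apply, ← Finset.sum_neg_distrib]
        · refine Finset.sum_congr rfl fun Q _ => ?_
          rw [h]
          split_ifs
          · simp
          · simp; ring
        · rw [cutProduct_evolved hX hj t f hy, ← Finset.sum_neg_distrib]
          refine Finset.sum_congr rfl fun Q _ => ?_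
          split_ifs <;> ring
      · simp [h]
    have hd : HasDerivAt (fun s => ∑ Q ∈ orderedPartitions X,
        (-1 : ℝ) ^ (Q.parts.card - 1) * finerSum f Q (partFlow σ Φ Q (-s) x))
        (∑ Q ∈ orderedPartitions X, (-1 : ℝ) ^ (Q.parts.card - 1) *
          -along (bondField Φ (bondIn Q)) (fun y => finerSum f Q (partFlow σ Φ Q (-t) y)) x) t :=
      HasDerivAt.fun_sum fun Q _ => ((isGlobalFlow_partFlow hΦ Q).hasDerivAt_comp_neg t
        (allowed_subset_allowedParts σ Q hx)
        ((hf.contDiff_finerSum Q).differentiable one_ne_zero _)).const_mul _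
    simp only [signedClusterSum_evolved _ f hx]
    refine hd.congr_deriv ?_
    rw [hL]
    simp only [hI, along_partField, Finset.sum_neg_distrib, neg_add, neg_neg, mul_add,
      Finset.sum_add_distrib, mul_neg, Finset.mul_sum]
    congr 2
    rw [Finset.sum_comm]
    exact Finset.sum_congr rfl fun j _ => Finset.sum_comm

/-- The derivative of a classical solution along the trajectories. -/
lemma IsClassicalSolution.hasDerivAt_flow (hΦ : IsPotential σ R Φ)
    {f : (B : Finset ℤ) → Phase B → ℝ} {u : ℝ → (X : Finset ℤ) → Phase X → ℝ}
    (hu : IsClassicalSolution σ Φ f u) (hX : IsBlock X) (s : ℝ) {x : Phase X}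
    (hx : x ∈ allowed σ X) :
    HasDerivAt (fun s => u s X (flow σ Φ X s x))
      (∑ j : X, ∑ k : X, if (k : ℤ) = next j then
        Lint Φ j k (cutProduct j (u s)) (flow σ Φ X s x) else 0) s := by
  obtain ⟨-, hc, hd⟩ := hu X hX
  have hfl := isGlobalFlow_flow hΦ X
  set y := flow σ Φ X s x with hy
  have hym : y ∈ allowed σ X := hfl.mem s x hx
  have ho : IsOpen ((univ : Set ℝ) ×ˢ allowed σ X) := isOpen_univ.prod (isOpen_allowed σ X)
  have hW := ((hc.contDiffAt (ho.mem_nhds (mk_mem_prod (mem_univ s) hym))).differentiableAt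
    one_ne_zero).hasFDerivAt
  set D := fderiv ℝ (fun z : ℝ × Phase X => u z.1 X z.2) (s, y)
  -- The joint differential splits into the time derivative and the derivative along the Hamilton
  -- field. The latter cancels the Liouville operator of the equation, and only the quadratic term
  -- remains.
  have h1 : HasDerivAt (fun r => u r X (flow σ Φ X r x)) (D (1, hamiltonField Φ X y)) s :=
    HasFDerivAt.comp_hasDerivAt (l := fun z : ℝ × Phase X => u z.1 X z.2)
      (f := fun r => (r, flow σ Φ X r x)) s hW ((hasDerivAt_id s).prodMk (hfl.deriv s x hx))
  have h2 : HasDerivAt (fun r => u r X y) (D (1, 0)) s :=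
    HasFDerivAt.comp_hasDerivAt (l := fun z : ℝ × Phase X => u z.1 X z.2)
      (f := fun r => (r, y)) s hW ((hasDerivAt_id s).prodMk (hasDerivAt_const s y))
  have h3 : HasFDerivAt (u s X) (D.comp (ContinuousLinearMap.inr ℝ ℝ (Phase X))) y :=
    HasFDerivAt.comp (g := fun z : ℝ × Phase X => u z.1 X z.2) (f := fun w => (s, w)) y hW
      (hasFDerivAt_prodMk_right s y)
  refine h1.congr_deriv ?_
  have e2 := h2.unique (hd s y hym)
  rw [liouvilleOp_eq_fderiv, h3.fderiv] at e2
  have e : ((1 : ℝ), hamiltonField Φ X y) = (1, 0) + (0, hamiltonField Φ X y) := by simp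
  rw [e, map_add, e2]
  simp

/-- Classical solutions are determined by the initial data. -/
theorem classicalSolution_unique (hΦ : IsPotential σ R Φ)
    {f : (B : Finset ℤ) → Phase B → ℝ} {u u' : ℝ → (X : Finset ℤ) → Phase X → ℝ}
    (hu : IsClassicalSolution σ Φ f u) (hu' : IsClassicalSolution σ Φ f u') (t : ℝ)
    (hX : IsBlock X) {x : Phase X} (hx : x ∈ allowed σ X) : u t X x = u' t X x := by
  induction hn : X.card using Nat.strong_induction_on generalizing X t with
  | _ n ih =>
  have hfl := isGlobalFlow_flow hΦ X
  have hcut : ∀ (s : ℝ) (j k : X), (k : ℤ) = next j → ∀ y ∈ allowed σ X,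
      Lint Φ j k (cutProduct j (u s)) y = Lint Φ j k (cutProduct j (u' s)) y := by
    intro s j k h y hy
    have hj : (j : ℤ) ∈ cuts X := mem_cuts.2 ⟨j.2, h ▸ k.2⟩
    -- `Lint` differentiates, so agreement is needed in a neighbourhood; it holds because the
    -- allowed set is open.
    have : (cutProduct j (u s) : Phase X → ℝ) =ᶠ[𝓝 y] cutProduct j (u' s) := by
      filter_upwards [(isOpen_allowed σ X).mem_nhds hy] with z hz
      simp only [cutProduct_eq]
      rw [ih _ (hn ▸ lowerPart_card_lt hj) s (hX.lowerPart j.2) (proj_mem_allowed _ hz) rfl,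
        ih _ (hn ▸ upperPart_card_lt hj) s (hX.upperPart hj) (proj_mem_allowed _ hz) rfl]
    rw [Lint_eq_fderiv, Lint_eq_fderiv, this.fderiv_eq]
  -- The difference of the solutions is constant along the trajectory through `x`, and `x₀` is its
  -- point at time zero, where the data coincide.
  set x₀ := flow σ Φ X (-t) x with hx₀
  have hx₀m : x₀ ∈ allowed σ X := hfl.mem _ x hx
  have hd : ∀ s, HasDerivAt (fun s => u s X (flow σ Φ X s x₀) - u' s X (flow σ Φ X s x₀)) 0 s := by
    intro s
    refine ((hu.hasDerivAt_flow hΦ hX s hx₀m).fun_sub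
      (hu'.hasDerivAt_flow hΦ hX s hx₀m)).congr_deriv ?_
    rw [sub_eq_zero]
    refine Finset.sum_congr rfl fun j _ => Finset.sum_congr rfl fun k _ => ?_
    split_ifs with h
    · exact hcut s j k h _ (hfl.mem s _ hx₀m)
    · rfl
  have hconst := is_const_of_deriv_eq_zero (fun s => (hd s).differentiableAt)
    (fun s => (hd s).deriv) t 0
  have hxt : flow σ Φ X t x₀ = x := hfl.apply_neg t x
  simp only [hxt, hfl.zero] at hconst
  rw [(hu X hX).1 _ hx₀m, (hu' X hX).1 _ hx₀m, sub_self] at hconst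
  exact sub_eq_zero.1 hconst

end ClassicalSolutions

end NearestNeighbour



namespace NearestNeighbour

/-! ### The generating operators are determined by the expansions -/

section Isolation

variable {σ R : ℝ} {Φ : ℝ → ℝ} {X : Finset ℤ}

lemma eq_of_parts_subset {P P' : Finpartition X} (h : P'.parts ⊆ P.parts) : P' = P := by
  refine Finpartition.ext (h.antisymm fun B hB => ?_)
  obtain ⟨b, hb⟩ := P.nonempty_of_mem_parts hB
  have hbX := P.le hB hb
  have h1 := P'.part_mem.2 hbX
  rwa [P.eq_of_mem_parts hB (h h1) hb (P'.mem_part_self.2 hbX)]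

lemma prodL1_eq_zero {g₀ : (X : Finset ℤ) → L1 σ X} {P : Finpartition X} {B : Finset ℤ}
    (hB : B ∈ P.parts) (h : g₀ B = 0) : prodL1 P g₀ = 0 := by
  refine Lp.ext ((Integrable.coeFn_toL1 _).trans (EventuallyEq.trans ?_ (Lp.coeFn_zero _ _ _).symm))
  have h0 : g₀ B =ᵐ[phaseMeasure σ B] fun _ => (0 : ℝ) := by
    rw [h]; exact Lp.coeFn_zero _ _ _
  filter_upwards [ae_proj_of_mem_parts P ⟨B, hB⟩ h0] with x hx
  exact Finset.prod_eq_zero (Finset.mem_univ (⟨B, hB⟩ : P.parts)) hx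

lemma prodL1_congr {f g : (X : Finset ℤ) → L1 σ X} {P : Finpartition X}
    (h : ∀ B ∈ P.parts, f B = g B) : prodL1 P f = prodL1 P g := by
  refine Lp.ext ((Integrable.coeFn_toL1 _).trans
    (EventuallyEq.trans (Eventually.of_forall fun x => ?_) (Integrable.coeFn_toL1 _).symm))
  exact Finset.prod_congr rfl fun B _ => by simp only [h B B.2]

/-- A partition all of whose parts are parts of `P` is `P` itself. Every other one has a part on
which the data vanish, and its term drops out. -/
lemma exists_mem_parts_eq_zero {g₀ : (X : Finset ℤ) → L1 σ X} {P P' : Finpartition X}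
    (h : ∀ B ⊆ X, B ∉ P.parts → g₀ B = 0) (hne : P' ≠ P) : ∃ B ∈ P'.parts, g₀ B = 0 := by
  by_contra! hcon
  refine hne (eq_of_parts_subset fun B hB => ?_)
  by_contra hBP
  exact hcon B hB (h B (P'.le hB) hBP)

/-- Only one partition contributes to the expansion of data concentrated on its parts. -/
lemma expansion_eq_of_concentrated (A : GeneratingOperators σ) {g₀ : (X : Finset ℤ) → L1 σ X}
    {P : Finpartition X} (hP : P ∈ orderedPartitions X)
    (h : ∀ B ⊆ X, B ∉ P.parts → g₀ B = 0) (t : ℝ) :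
    expansion A g₀ t X = A t X P (prodL1 P g₀) := by
  refine Finset.sum_eq_single_of_mem P hP fun P' _ hne => ?_
  obtain ⟨B, hB, hB0⟩ := exists_mem_parts_eq_zero h hne
  rw [prodL1_eq_zero hB hB0, map_zero]

/-- Operators on `L1Parts σ P` are determined by their values on products of smooth functions. -/
lemma clm_ext_of_prodL1 {P : Finpartition X} {T T' : L1Parts σ P →L[ℝ] L1 σ X}
    (h : ∀ (g₀ : (X : Finset ℤ) → L1 σ X) (f₀ : (X : Finset ℤ) → Phase X → ℝ),
      IsSmoothData σ f₀ → Represents g₀ f₀ → (∀ B ∉ P.parts, g₀ B = 0) →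
        T (prodL1 P g₀) = T' (prodL1 P g₀)) : T = T' := by
  classical
  -- The kernel of the difference is closed, so the density theorem applies. Data on the parts of
  -- `P` are extended by zero to all other index sets, which makes them concentrated on `P`.
  have htop : LinearMap.ker (T - T' : L1Parts σ P →L[ℝ] L1 σ X).toLinearMap = ⊤ := by
    refine eq_top_of_containsSmoothProducts (ContinuousLinearMap.isClosed_ker _) fun f hf F hF => ?_
    have hi : ∀ B ∈ P.parts, Integrable (f B) (phaseMeasure σ B) := fun B hB =>
      ((hf B hB).1.continuous.integrable_of_hasCompactSupport (hf B hB).2.1).restrict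
    let f₀ : (X : Finset ℤ) → Phase X → ℝ := fun B => if B ∈ P.parts then f B else fun _ => 0
    let g₀ : (X : Finset ℤ) → L1 σ X := fun B =>
      if hB : B ∈ P.parts then (hi B hB).toL1 (f B) else 0
    have hf₀ : IsSmoothData σ f₀ := by
      intro B _
      by_cases hB : B ∈ P.parts
      · simp only [f₀, if_pos hB]
        exact hf B hB
      · simp only [f₀, if_neg hB]
        refine ⟨contDiff_const, HasCompactSupport.zero, ?_⟩
        have : tsupport (fun _ : Phase B => (0 : ℝ)) = ∅ := tsupport_eq_empty_iff.2 rfl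
        rw [this]
        exact empty_subset _
    have hg₀ : ∀ B : Finset ℤ, g₀ B =ᵐ[phaseMeasure σ B] f₀ B := by
      intro B
      by_cases hB : B ∈ P.parts
      · simp only [f₀, g₀, if_pos hB, dif_pos hB]
        exact (hi B hB).coeFn_toL1
      · simp only [f₀, g₀, if_neg hB, dif_neg hB]
        exact Lp.coeFn_zero _ _ _
    have hFg : F = prodL1 P g₀ := by
      refine Lp.ext (hF.trans (EventuallyEq.trans ?_ (Integrable.coeFn_toL1 _).symm))
      filter_upwards [ae_all_iff.2 fun B : P.parts => ae_proj_of_mem_parts P B (hg₀ B)] with x hx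
      refine Finset.prod_congr rfl fun B _ => ?_
      beta_reduce
      rw [hx B]
      simp only [f₀, if_pos B.2]
    have := h g₀ f₀ hf₀ (fun B _ => hg₀ B) fun B hB => dif_neg hB
    rw [LinearMap.mem_ker, hFg]
    change T (prodL1 P g₀) - T' (prodL1 P g₀) = 0
    rw [this, sub_self]
  ext1 F
  have hF : F ∈ LinearMap.ker (T - T' : L1Parts σ P →L[ℝ] L1 σ X).toLinearMap := by
    rw [htop]; trivial
  exact sub_eq_zero.1 hF

/-- Operators with the same expansions of smooth data agree. -/
theorem agreeOnBlocks_of_expansion_eq {A A' : GeneratingOperators σ}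
    (h : ∀ (g₀ : (X : Finset ℤ) → L1 σ X) (f₀ : (X : Finset ℤ) → Phase X → ℝ),
      IsSmoothData σ f₀ → Represents g₀ f₀ → ∀ t X, IsBlock X →
        expansion A g₀ t X = expansion A' g₀ t X) : AgreeOnBlocks A A' := by
  intro t X hX P hP
  refine clm_ext_of_prodL1 fun g₀ f₀ hf₀ hg₀ h0 => ?_
  rw [← expansion_eq_of_concentrated A hP (fun B _ hB => h0 B hB) t,
    ← expansion_eq_of_concentrated A' hP (fun B _ hB => h0 B hB) t]
  exact h g₀ f₀ hf₀ hg₀ t X hX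

end Isolation

/-! ### Cluster expansions -/

section ClusterExpansions

variable {σ R : ℝ} {Φ : ℝ → ℝ} {X : Finset ℤ}

lemma liouvilleGroup_congr (hΦ : IsPotential σ R Φ) (t : ℝ) {F G : Phase X → ℝ}
    (h : F =ᵐ[phaseMeasure σ X] G) :
    liouvilleGroup σ Φ X t F =ᵐ[phaseMeasure σ X] liouvilleGroup σ Φ X t G := by
  have h1 := ((isGlobalFlow_flow hΦ X).measurePreserving (trace_fderiv_bondField hΦ _)
    volume (-t)).quasiMeasurePreserving.ae h
  filter_upwards [h1] with x hx
  simp only [liouvilleGroup, hx]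

/-- The contribution of `Q` to the cluster expansion. -/
noncomputable def clusterTerm (A : GeneratingOperators σ) (t : ℝ) (f : (B : Finset ℤ) → L1 σ B)
    (P Q : Finpartition X) (x : Phase X) : ℝ :=
  ∏ C : Q.parts, A t C (P.restrict (Q.le C.2)) (prodL1 (P.restrict (Q.le C.2)) f)
    (proj (Q.le C.2) x)

lemma clusterTerm_congr {A A' : GeneratingOperators σ} {t : ℝ} {f : (B : Finset ℤ) → L1 σ B}
    {P Q : Finpartition X} (hPQ : P ≤ Q) (hP : P ∈ orderedPartitions X)
    (h : ∀ C ∈ Q.parts, ∀ P' ∈ orderedPartitions C, A t C P' = A' t C P') (x : Phase X) :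
    clusterTerm A t f P Q x = clusterTerm A' t f P Q x :=
  Finset.prod_congr rfl fun C _ => by
    rw [h C C.2 _ (restrict_mem_orderedPartitions hPQ hP C.2)]

/-- The coarsest partition contributes the unknown operator itself; this makes the cluster
expansions solvable by recursion. -/
lemma clusterTerm_indiscrete (A : GeneratingOperators σ) (t : ℝ) (f : (B : Finset ℤ) → L1 σ B)
    (P : Finpartition X) (hX : X ≠ ∅) (x : Phase X) :
    clusterTerm A t f P (Finpartition.indiscrete hX) x = A t X P (prodL1 P f) x := by
  have hmem : ∀ C : (Finpartition.indiscrete hX).parts, (C : Finset ℤ) = X := fun C =>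
    Finset.mem_singleton.1 C.2
  have hXm : X ∈ (Finpartition.indiscrete hX).parts := Finset.mem_singleton_self X
  rw [clusterTerm, Fintype.prod_eq_single ⟨X, hXm⟩ fun C hC => absurd (Subtype.ext (hmem C)) hC]
  have key : ∀ P' : Finpartition X, P' = P →
      A t X P' (prodL1 P' f) (proj subset_rfl x) = A t X P (prodL1 P f) x := by
    rintro _ rfl
    rfl
  refine key _ (Finpartition.ext ?_)
  rw [parts_restrict_of_le (R := Finpartition.indiscrete hX) (fun B hB => ⟨X, hXm, P.le hB⟩) hXm]
  exact Finset.filter_true_of_mem fun B hB => P.le hB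

/-- The cumulants solve the cluster expansions. -/
theorem solveClusterExpansions_cumulant (hΦ : IsPotential σ R Φ) :
    SolveClusterExpansions Φ (cumulant hΦ) := by
  classical
  intro t X hX P hP f
  change _ =ᵐ[phaseMeasure σ X] fun x =>
    ∑ Q ∈ clusterPartitions P, clusterTerm (cumulant hΦ) t f P Q x
  -- With data concentrated on the parts of `P`, the sum over all partitions of `X` reduces to the
  -- single product ∏ f, and the inversion formula for all partitions becomes the cluster expansion
  -- of `P`.
  let g₀ : (B : Finset ℤ) → L1 σ B := fun B => if B ∈ P.parts then f B else 0
  have hg : ∀ B ∈ P.parts, g₀ B = f B := fun B hB => if_pos hB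
  have hg0 : ∀ B ∉ P.parts, g₀ B = 0 := fun B hB => if_neg hB
  have hsum : clusterSum (fun B => g₀ B) X =ᵐ[phaseMeasure σ X] prodFun P fun B => f B := by
    have h1 : ∀ P' : Finpartition X, P' ≠ P →
        ∀ᵐ x ∂phaseMeasure σ X, prodFun P' (fun B => g₀ B) x = 0 := by
      intro P' hne
      obtain ⟨B, hB, hB0⟩ := exists_mem_parts_eq_zero (fun B _ hB => hg0 B hB) hne
      have h2 : prodL1 P' g₀ =ᵐ[partsMeasure σ P'] prodFun P' fun B => g₀ B :=
        Integrable.coeFn_toL1 _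
      rw [prodL1_eq_zero hB hB0] at h2
      exact ae_phaseMeasure P' (h2.symm.trans (Lp.coeFn_zero _ _ _))
    filter_upwards [ae_all_iff.2 fun P' => ae_all_iff.2 (h1 P')] with x hx
    rw [clusterSum_eq, Finset.sum_eq_single_of_mem P hP fun P' _ hne => hx P' hne]
    exact Finset.prod_congr rfl fun B _ => by simp only [hg B B.2]
  have hterm : ∀ Q ∈ orderedPartitions X, P ≤ Q → ∀ C : Q.parts,
      expansion (cumulant hΦ) g₀ t C = cumulant hΦ t C (P.restrict (Q.le C.2))
        (prodL1 (P.restrict (Q.le C.2)) f) := by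
    intro Q _ hPQ C
    have hparts := parts_restrict_of_le hPQ C.2
    rw [expansion_eq_of_concentrated _ (restrict_mem_orderedPartitions hPQ hP C.2)
      (fun B hB hBn => hg0 B fun hBP => hBn (by
        rw [hparts]; exact Finset.mem_filter.2 ⟨hBP, hB⟩)) t]
    congr 1
    exact prodL1_congr fun B hB => hg B (Finset.mem_filter.1 (hparts ▸ hB)).1
  -- If all factors of `Q` are nonzero, then around every point of a part `B` of `P` some partition
  -- of the part of `Q` uses only parts of `P` there, hence uses `B`. So `B` lies in a part of `Q`,
  -- and `Q` is coarser than `P`.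
  have hzero : ∀ Q ∈ orderedPartitions X, ¬P ≤ Q →
      ∃ C : Q.parts, expansion (cumulant hΦ) g₀ t C = 0 := by
    intro Q _ hPQ
    by_contra! hcon
    refine hPQ fun B hB => ?_
    obtain ⟨b, hb⟩ := P.nonempty_of_mem_parts hB
    have hbX := P.le hB hb
    have hC := Q.part_mem.2 hbX
    have hbC := Q.mem_part_self.2 hbX
    obtain ⟨P', hP', hne⟩ : ∃ P' ∈ orderedPartitions (Q.part b),
        cumulant hΦ t (Q.part b) P' (prodL1 P' g₀) ≠ 0 := by
      by_contra! h0
      exact hcon ⟨_, hC⟩ (Finset.sum_eq_zero h0)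
    have hsub : P'.part b ∈ P.parts := by
      by_contra hn
      exact hne (by rw [prodL1_eq_zero (P'.part_mem.2 hbC) (hg0 _ hn), map_zero])
    have e := P.eq_of_mem_parts hB hsub hb (P'.mem_part_self.2 hbC)
    exact ⟨Q.part b, hC, e ▸ P'.le (P'.part_mem.2 hbC)⟩
  have hrep : ∀ C : X.powerset, ∀ᵐ x ∂phaseMeasure σ X,
      expansion (cumulant hΦ) g₀ t C (proj (Finset.mem_powerset.1 C.2) x) =
        signedClusterSum (evolved σ Φ (fun B => g₀ B) t) C (proj (Finset.mem_powerset.1 C.2) x) :=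
    fun C => ae_proj _ (expansion_cumulant_ae_eq hΦ (represents_self g₀) t C)
  have hz : ∀ C : X.powerset, expansion (cumulant hΦ) g₀ t C = 0 → ∀ᵐ x ∂phaseMeasure σ X,
      expansion (cumulant hΦ) g₀ t C (proj (Finset.mem_powerset.1 C.2) x) = 0 := by
    intro C hC
    rw [hC]
    exact ae_proj _ (Lp.coeFn_zero _ _ _)
  refine (liouvilleGroup_congr hΦ t hsum.symm).trans ?_
  filter_upwards [ae_all_iff.2 hrep, ae_all_iff.2 fun C => ae_all_iff.2 (hz C)] with x h1 h2
  -- The partitions not coarser than `P` contribute zero, so the sum extends to all ordered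
  -- partitions, over which signed sums are inverted.
  have h3 : ∑ Q ∈ clusterPartitions P, clusterTerm (cumulant hΦ) t f P Q x =
      ∑ Q ∈ orderedPartitions X, ∏ C : Q.parts,
        expansion (cumulant hΦ) g₀ t C (proj (Q.le C.2) x) := by
    have hsubset : clusterPartitions P ⊆ orderedPartitions X := fun Q hQ =>
      (mem_clusterPartitions.1 hQ).1
    rw [← Finset.sum_subset hsubset fun Q hQ hQn => ?_]
    · refine Finset.sum_congr rfl fun Q hQ => Finset.prod_congr rfl fun C _ => ?_
      rw [hterm Q (mem_clusterPartitions.1 hQ).1 (mem_clusterPartitions.1 hQ).2 C]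
    · obtain ⟨C, hC⟩ := hzero Q hQ fun h => hQn (mem_clusterPartitions.2 ⟨hQ, h⟩)
      exact Finset.prod_eq_zero (Finset.mem_univ C)
        (h2 ⟨C, Finset.mem_powerset.2 (Q.le C.2)⟩ hC)
  rw [h3]
  have h4 : ∀ Q : Finpartition X, ∏ C : Q.parts,
      expansion (cumulant hΦ) g₀ t C (proj (Q.le C.2) x) =
      ∏ C ∈ Q.parts, signedSum (valueAt (evolved σ Φ (fun B => g₀ B) t) x) C := by
    intro Q
    rw [← Finset.prod_coe_sort Q.parts]
    refine Finset.prod_congr rfl fun C _ => ?_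
    rw [← signedClusterSum_proj _ (Q.le C.2)]
    exact h1 ⟨C, Finset.mem_powerset.2 (Q.le C.2)⟩
  simp only [h4]
  have h5 := partitionSum_signedSum (valueAt (evolved σ Φ (fun B => g₀ B) t) x) hX
  rw [partitionSum] at h5
  rw [h5, valueAt_of_subset _ _ subset_rfl]
  rfl

lemma AgreeOnBlocks.solveClusterExpansions {A A' : GeneratingOperators σ}
    (h : AgreeOnBlocks A A') (hA : SolveClusterExpansions Φ A') : SolveClusterExpansions Φ A := by
  intro t X hX P hP f
  refine (hA t X hX P hP f).trans (Eventually.of_forall fun x => ?_)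
  refine Finset.sum_congr rfl fun Q hQ => ?_
  exact (clusterTerm_congr (mem_clusterPartitions.1 hQ).2 hP (fun C hC P' hP' =>
    h t C (mem_orderedPartitions.1 (mem_clusterPartitions.1 hQ).1 C hC) P' hP') x).symm

/-- The cluster expansions determine the generating operators. -/
theorem agreeOnBlocks_of_solveClusterExpansions {A A' : GeneratingOperators σ}
    (hA : SolveClusterExpansions Φ A) (hA' : SolveClusterExpansions Φ A') :
    AgreeOnBlocks A A' := by
  classical
  intro t X hX
  induction hn : X.card using Nat.strong_induction_on generalizing X with
  | _ n ih =>
  intro P hP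
  refine clm_ext_of_prodL1 fun f _ _ _ _ => Lp.ext ?_
  have hXne : X ≠ ∅ := hX.1.ne_empty
  -- All terms other than that of the coarsest partition involve proper subblocks, where the
  -- operators agree by induction; cancelling them leaves the two operators for `X`.
  have htop : Finpartition.indiscrete hXne ∈ clusterPartitions P :=
    mem_clusterPartitions.2 ⟨indiscrete_mem_orderedPartitions hX, fun B hB =>
      ⟨X, Finset.mem_singleton_self X, P.le hB⟩⟩
  have h1 : (fun x => ∑ Q ∈ clusterPartitions P, clusterTerm A t f P Q x) =ᵐ[phaseMeasure σ X]
      fun x => ∑ Q ∈ clusterPartitions P, clusterTerm A' t f P Q x :=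
    (hA t X hX P hP f).symm.trans (hA' t X hX P hP f)
  filter_upwards [h1] with x hx
  rw [← Finset.add_sum_erase _ _ htop, ← Finset.add_sum_erase _ _ htop, clusterTerm_indiscrete,
    clusterTerm_indiscrete] at hx
  have h2 : ∑ Q ∈ (clusterPartitions P).erase (Finpartition.indiscrete hXne),
      clusterTerm A t f P Q x = ∑ Q ∈ (clusterPartitions P).erase (Finpartition.indiscrete hXne),
      clusterTerm A' t f P Q x := by
    refine Finset.sum_congr rfl fun Q hQ => ?_
    obtain ⟨hne, hQ⟩ := Finset.mem_erase.1 hQ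
    obtain ⟨hQo, hPQ⟩ := mem_clusterPartitions.1 hQ
    refine clusterTerm_congr hPQ hP (fun C hC P' hP' => ?_) x
    have hCX : C ≠ X := fun e => hne (eq_indiscrete_of_mem hXne (e ▸ hC))
    exact ih _ (hn ▸ Finset.card_lt_card ((Q.le hC).ssubset_of_ne hCX)) C
      (mem_orderedPartitions.1 hQo C hC) rfl P' hP'
  rw [h2] at hx
  exact add_right_cancel hx

end ClusterExpansions

end NearestNeighbour



namespace NearestNeighbour

/-! ### Relabelling -/

section Relabelling

variable {σ R : ℝ} {Φ : ℝ → ℝ} {X Y : Finset ℤ}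

/-- Relabelling of the particles. -/
def relabel (e : X ≃o Y) (x : Phase X) : Phase Y := fun i => x (e.symm i)

/-- Order isomorphisms which preserve the signs of the labels. -/
def PreservesSign (e : X ≃o Y) : Prop := ∀ i : X, 0 < (i : ℤ) ↔ 0 < (e i : ℤ)

/-- Blocks have no gaps except at 0, which is not a label. So the right neighbour is the least
larger element of the block, a notion preserved by order isomorphisms. -/
lemma next_apply (hY : IsBlock Y) (hX : IsBlock X) (e : X ≃o Y) {i : X} (hi : next i ∈ X) :
    (e ⟨next i, hi⟩ : ℤ) = next (e i) := by
  have h0 : ∀ k : Y, (k : ℤ) ≠ 0 := fun k h => hY.2.1 (h ▸ k.2)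
  have hlt : (e i : ℤ) < e ⟨next i, hi⟩ :=
    e.lt_iff_lt.2 (show i < ⟨next i, hi⟩ from lt_next i)
  have hle : next (e i) ≤ (e ⟨next i, hi⟩ : ℤ) := next_le hlt (h0 _)
  have hmem : next (e i) ∈ Y := by
    rcases hle.eq_or_lt with h | h
    · rw [h]; exact (e _).2
    · exact hY.2.2 _ (e i).2 _ (e ⟨next i, hi⟩).2 _ (lt_next _) h (next_ne_zero _)
  refine le_antisymm ?_ hle
  have h1 : i < e.symm ⟨next (e i), hmem⟩ :=
    e.lt_symm_apply.2 (show e i < ⟨next (e i), hmem⟩ from lt_next _)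
  have h2 : next i ≤ (e.symm ⟨next (e i), hmem⟩ : ℤ) :=
    next_le h1 fun h => hX.2.1 (h ▸ (e.symm ⟨next (e i), hmem⟩).2)
  have h3 : (⟨next i, hi⟩ : X) ≤ e.symm ⟨next (e i), hmem⟩ := h2
  exact e.le_symm_apply.1 h3

lemma eq_next_iff (hX : IsBlock X) (hY : IsBlock Y) (e : X ≃o Y) (i k : X) :
    (e k : ℤ) = next (e i) ↔ (k : ℤ) = next i := by
  constructor
  · intro h
    have h1 : next (e i) ∈ Y := h ▸ (e k).2
    have h2 := next_apply hX hY e.symm h1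
    have h3 : (⟨next (e i), h1⟩ : Y) = e k := Subtype.ext h.symm
    rw [h3, e.symm_apply_apply, e.symm_apply_apply] at h2
    exact h2
  · intro h
    have h1 : next i ∈ X := h ▸ k.2
    have h3 : (⟨next i, h1⟩ : X) = k := Subtype.ext h.symm
    rw [← next_apply hY hX e h1, h3]

lemma relabel_mem_allowed (hX : IsBlock X) (hY : IsBlock Y) (e : X ≃o Y) {x : Phase X}
    (hx : x ∈ allowed σ X) : relabel e x ∈ allowed σ Y := fun j k h =>
  hx _ _ ((eq_next_iff hY hX e.symm j k).2 h)

lemma quasiMeasurePreserving_relabel (hX : IsBlock X) (hY : IsBlock Y) (e : X ≃o Y) :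
    Measure.QuasiMeasurePreserving (relabel e) (phaseMeasure σ X) (phaseMeasure σ Y) := by
  have h : MeasurePreserving (relabel e) (volume : Measure (Phase X)) volume :=
    volume_preserving_arrowCongr' e.toEquiv (MeasurableEquiv.refl (ℝ × ℝ))
      (MeasurePreserving.id _)
  exact h.quasiMeasurePreserving.restrict fun x hx => relabel_mem_allowed hX hY e hx

lemma hamiltonField_relabel (hX : IsBlock X) (hY : IsBlock Y) (e : X ≃o Y) (x : Phase X) :
    hamiltonField Φ Y (relabel e x) = relabel e (hamiltonField Φ X x) := by
  funext j
  simp only [hamiltonField, relabel]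
  refine Prod.ext rfl (congrArg₂ (· + ·) (congrArg Neg.neg ?_) ?_)
  · refine Fintype.sum_equiv e.symm.toEquiv _ _ fun k => ?_
    simp only [RelIso.coe_fn_toEquiv, eq_next_iff hY hX e.symm]
  · refine Fintype.sum_equiv e.symm.toEquiv _ _ fun k => ?_
    simp only [RelIso.coe_fn_toEquiv, eq_next_iff hY hX e.symm]

/-- Relabelling intertwines the Hamilton fields, since neighbours correspond to neighbours;
uniqueness of trajectories then gives the flows. -/
lemma flow_relabel (hΦ : IsPotential σ R Φ) (hX : IsBlock X) (hY : IsBlock Y) (e : X ≃o Y)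
    {x : Phase X} (hx : x ∈ allowed σ X) (t : ℝ) :
    flow σ Φ Y t (relabel e x) = relabel e (flow σ Φ X t x) := by
  have hfX := isGlobalFlow_flow hΦ X
  have hfY := isGlobalFlow_flow hΦ Y
  have hx' : relabel e x ∈ allowed σ Y := relabel_mem_allowed hX hY e hx
  refine congrFun (trajectory_unique_global hfY.isOpen hfY.contDiffOn_field
    (f := fun t => flow σ Φ Y t (relabel e x)) (g := fun t => relabel e (flow σ Φ X t x))
    (fun s => ⟨hfY.mem s _ hx', hfY.deriv s _ hx'⟩)
    (fun s => ⟨relabel_mem_allowed hX hY e (hfX.mem s x hx), ?_⟩) ?_) t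
  · rw [hamiltonField_relabel hX hY]
    exact hasDerivAt_pi.2 fun i => hasDerivAt_pi.1 (hfX.deriv s x hx) (e.symm i)
  · simp only [hfX.zero, hfY.zero]

/-- The restriction of an order isomorphism to corresponding subsets. -/
def restrictIso (e : X ≃o Y) {A B : Finset ℤ} (hA : A ⊆ X) (hB : B ⊆ Y)
    (h : ∀ i : X, (i : ℤ) ∈ A ↔ (e i : ℤ) ∈ B) : A ≃o B where
  toFun i := ⟨e ⟨i, hA i.2⟩, (h _).1 i.2⟩
  invFun k := ⟨e.symm ⟨k, hB k.2⟩, (h _).2 (by rw [e.apply_symm_apply]; exact k.2)⟩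
  left_inv i := Subtype.ext (by simp)
  right_inv k := Subtype.ext (by simp)
  map_rel_iff' {i k} := e.le_iff_le (x := ⟨i, hA i.2⟩) (y := ⟨k, hA k.2⟩)

lemma PreservesSign.restrictIso {e : X ≃o Y} (he : PreservesSign e) {A B : Finset ℤ} (hA : A ⊆ X)
    (hB : B ⊆ Y) (h : ∀ i : X, (i : ℤ) ∈ A ↔ (e i : ℤ) ∈ B) :
    PreservesSign (restrictIso e hA hB h) := fun i => he ⟨i, hA i.2⟩

/-- Families of functions which are invariant under relabelling. -/
def RelabelInvariant (σ : ℝ) (f : (B : Finset ℤ) → Phase B → ℝ) : Prop :=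
  ∀ X Y, IsBlock X → IsBlock Y → ∀ e : X ≃o Y, PreservesSign e →
    f X =ᵐ[phaseMeasure σ X] fun x => f Y (relabel e x)

lemma clusterSum_first (f : (B : Finset ℤ) → Phase B → ℝ) (hX : IsBlock X) (x : Phase X) :
    clusterSum f X x = f X x + ∑ j ∈ cuts X,
      f (lowerPart X j) (proj (lowerPart_subset X j) x) *
        clusterSum f (upperPart X j) (proj (upperPart_subset X j) x) := by
  simp only [clusterSum_proj]
  rw [clusterSum, partitionSum_first hX, valueAt_of_subset f x subset_rfl]
  simp only [valueAt_of_subset f x (lowerPart_subset X _)]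
  rfl

/-- Induction through the recursion by first part: only the cuts and the two sides of each cut have
to be matched under the relabelling, not the partitions. -/
lemma RelabelInvariant.clusterSum {f : (B : Finset ℤ) → Phase B → ℝ}
    (hf : RelabelInvariant σ f) : RelabelInvariant σ (clusterSum f) := by
  intro X Y hX hY e he
  induction hn : X.card using Nat.strong_induction_on generalizing X Y with
  | _ n ih =>
  have hlow : ∀ (j i : X), (i : ℤ) ∈ lowerPart X j ↔ (e i : ℤ) ∈ lowerPart Y (e j) := fun j i => by
    rw [mem_lowerPart, mem_lowerPart]
    exact and_congr (iff_of_true i.2 (e i).2) (e.le_iff_le (x := i) (y := j)).symm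
  have hup : ∀ (j i : X), (i : ℤ) ∈ upperPart X j ↔ (e i : ℤ) ∈ upperPart Y (e j) := fun j i => by
    rw [mem_upperPart, mem_upperPart]
    exact and_congr (iff_of_true i.2 (e i).2) (e.lt_iff_lt (x := j) (y := i)).symm
  have hcut : ∀ j : X, (j : ℤ) ∈ cuts X → (e j : ℤ) ∈ cuts Y := fun j hj =>
    mem_cuts.2 ⟨(e j).2, next_apply hY hX e (mem_cuts.1 hj).2 ▸ (e _).2⟩
  have hcut' : ∀ k : Y, (k : ℤ) ∈ cuts Y → (e.symm k : ℤ) ∈ cuts X := fun k hk =>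
    mem_cuts.2 ⟨(e.symm k).2, next_apply hX hY e.symm (mem_cuts.1 hk).2 ▸ (e.symm _).2⟩
  have h1 : ∀ j : X, (j : ℤ) ∈ cuts X → ∀ᵐ x ∂phaseMeasure σ X,
      f (lowerPart X j) (proj (lowerPart_subset X j) x) = f (lowerPart Y (e j))
        (proj (lowerPart_subset Y (e j)) (relabel e x)) := fun j hj =>
    ae_proj (lowerPart_subset X j) (hf _ _ (hX.lowerPart j.2) (hY.lowerPart (e j).2)
      (restrictIso e (lowerPart_subset X j) (lowerPart_subset Y (e j)) (hlow j))
      (he.restrictIso _ _ _))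
  have h2 : ∀ j : X, (j : ℤ) ∈ cuts X → ∀ᵐ x ∂phaseMeasure σ X,
      NearestNeighbour.clusterSum f (upperPart X j) (proj (upperPart_subset X j) x) =
        NearestNeighbour.clusterSum f (upperPart Y (e j))
          (proj (upperPart_subset Y (e j)) (relabel e x)) := fun j hj =>
    ae_proj (upperPart_subset X j) (ih _ (hn ▸ upperPart_card_lt hj) _ _ (hX.upperPart hj)
      (hY.upperPart (hcut j hj))
      (restrictIso e (upperPart_subset X j) (upperPart_subset Y (e j)) (hup j))
      (he.restrictIso _ _ _) rfl)
  filter_upwards [hf X Y hX hY e he, ae_all_iff.2 fun j => ae_all_iff.2 (h1 j),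
    ae_all_iff.2 fun j => ae_all_iff.2 (h2 j)] with x a b c
  rw [clusterSum_first f hX, clusterSum_first f hY, a]
  congr 1
  refine Finset.sum_bij' (fun j hj => (e ⟨j, (mem_cuts.1 hj).1⟩ : ℤ))
    (fun k hk => (e.symm ⟨k, (mem_cuts.1 hk).1⟩ : ℤ)) (fun j hj => hcut _ hj)
    (fun k hk => hcut' _ hk) (fun j hj => by simp) (fun k hk => by simp) fun j hj => ?_
  rw [b ⟨j, (mem_cuts.1 hj).1⟩ hj, c ⟨j, (mem_cuts.1 hj).1⟩ hj]

lemma RelabelInvariant.evolved (hΦ : IsPotential σ R Φ) {f : (B : Finset ℤ) → Phase B → ℝ}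
    (hf : RelabelInvariant σ f) (t : ℝ) : RelabelInvariant σ (evolved σ Φ f t) := by
  intro X Y hX hY e he
  have h1 := ((isGlobalFlow_flow hΦ X).measurePreserving (trace_fderiv_bondField hΦ _)
    volume (-t)).quasiMeasurePreserving.ae (hf.clusterSum X Y hX hY e he)
  filter_upwards [h1, ae_restrict_mem (isOpen_allowed σ X).measurableSet] with x hx hxm
  rw [evolved_of_mem t hxm, evolved_of_mem t (relabel_mem_allowed hX hY e hxm),
    flow_relabel hΦ hX hY e hxm]
  exact hx

/-- Reduces the invariance of signed sums to that of the plain sums of the negated family. -/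
lemma signedClusterSum_eq_neg (f : (B : Finset ℤ) → Phase B → ℝ) (hX : X.Nonempty) (x : Phase X) :
    signedClusterSum f X x = -clusterSum (fun B y => -f B y) X x := by
  rw [signedClusterSum, signedSum_eq hX, clusterSum]
  congr 2
  funext B
  by_cases h : B ⊆ X
  · rw [valueAt_of_subset _ _ h, valueAt_of_subset _ _ h]
  · simp [valueAt, h]

lemma RelabelInvariant.signedClusterSum {f : (B : Finset ℤ) → Phase B → ℝ}
    (hf : RelabelInvariant σ f) : RelabelInvariant σ (signedClusterSum f) := by
  intro X Y hX hY e he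
  have hneg : RelabelInvariant σ fun B y => -f B y := fun X Y hX hY e he =>
    (hf X Y hX hY e he).mono fun x hx => by simp only [hx]
  filter_upwards [hneg.clusterSum X Y hX hY e he] with x hx
  rw [signedClusterSum_eq_neg f hX.1, signedClusterSum_eq_neg f hY.1, hx]

/-- The expansion over the cumulants of a double sequence is a double sequence. -/
theorem isDoubleSequence_expansion_cumulant (hΦ : IsPotential σ R Φ)
    {g₀ : (X : Finset ℤ) → L1 σ X} (hg₀ : IsDoubleSequence g₀) (t : ℝ) :
    IsDoubleSequence (expansion (cumulant hΦ) g₀ t) := by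
  intro X Y hX hY e he
  have hinv : RelabelInvariant σ fun B => g₀ B := hg₀
  have h1 := (hinv.evolved hΦ t).signedClusterSum X Y hX hY e he
  have h2 := (quasiMeasurePreserving_relabel hX hY e).ae
    (expansion_cumulant_ae_eq hΦ (represents_self g₀) t Y)
  filter_upwards [expansion_cumulant_ae_eq hΦ (represents_self g₀) t X, h1, h2] with x a b c
  rw [a, b]
  exact c.symm

end Relabelling

end NearestNeighbour

/-! ### Proof of the equivalences and of the statement on double sequences. -/

open NearestNeighbour

theorem mainTheorem2 (σ R : ℝ) (Φ : ℝ → ℝ) (hΦ : IsPotential σ R Φ) (A : GeneratingOperators σ) :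
    List.TFAE
      [SolveClusterExpansions Φ A,
       AreCumulants Φ A,
       ∀ g₀ : (X : Finset ℤ) → L1 σ X, IsWeakSolution σ Φ g₀ (expansion A g₀),
       ∀ (g₀ : (X : Finset ℤ) → L1 σ X) (g : ℝ → (X : Finset ℤ) → L1 σ X),
         IsWeakSolution σ Φ g₀ g → ∀ t X, IsBlock X → g t X = expansion A g₀ t X,
       ∀ (g₀ : (X : Finset ℤ) → L1 σ X) (f₀ : (X : Finset ℤ) → Phase X → ℝ),
         IsSmoothData σ f₀ → Represents g₀ f₀ →
           ∃ u, IsClassicalSolution σ Φ f₀ u ∧ ∀ t, Represents (expansion A g₀ t) (u t),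
       ∀ (g₀ : (X : Finset ℤ) → L1 σ X) (f₀ : (X : Finset ℤ) → Phase X → ℝ),
         IsSmoothData σ f₀ → Represents g₀ f₀ →
           ∀ u, IsClassicalSolution σ Φ f₀ u → ∀ t, Represents (expansion A g₀ t) (u t)] ∧
    (SolveClusterExpansions Φ A → ∀ g₀ : (X : Finset ℤ) → L1 σ X, IsDoubleSequence g₀ →
      ∀ t, IsDoubleSequence (expansion A g₀ t)) := by
  have hwc := isWeakSolution_expansion_cumulant hΦ
  have hsolve : SolveClusterExpansions Φ A ↔ AgreeOnBlocks A (cumulant hΦ) :=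
    ⟨fun h => agreeOnBlocks_of_solveClusterExpansions h (solveClusterExpansions_cumulant hΦ),
      fun h => h.solveClusterExpansions (solveClusterExpansions_cumulant hΦ)⟩
  have hrep : AgreeOnBlocks A (cumulant hΦ) → ∀ (g₀ : (X : Finset ℤ) → L1 σ X)
      (f₀ : (X : Finset ℤ) → Phase X → ℝ), Represents g₀ f₀ → ∀ t,
      Represents (expansion A g₀ t) (signedClusterSum (evolved σ Φ f₀ t)) := by
    intro h g₀ f₀ hg t X hX
    rw [h.expansion_eq g₀ t hX]
    exact expansion_cumulant_ae_eq hΦ hg t X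
  constructor
  · tfae_have 1 ↔ 2 := hsolve.trans (areCumulants_iff hΦ A).symm
    tfae_have 2 → 4 := by
      intro h g₀ g hg t X hX
      rw [((areCumulants_iff hΦ A).1 h).expansion_eq g₀ t hX]
      exact weakSolution_unique hΦ hg (hwc g₀) t hX
    -- The cumulant expansion is a weak solution, so by hypothesis it is represented by the
    -- expansion over `A`; equal expansions of smooth data force equal operators.
    tfae_have 4 → 2 := by
      intro h
      refine (areCumulants_iff hΦ A).2 (agreeOnBlocks_of_expansion_eq fun g₀ _ _ _ t X hX => ?_)
      exact (h g₀ _ (hwc g₀) t X hX).symm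
    tfae_have 2 → 3 := fun h g₀ => (hwc g₀).congr fun t X hX =>
      (((areCumulants_iff hΦ A).1 h).expansion_eq g₀ t hX).symm
    tfae_have 3 → 2 := by
      intro h
      refine (areCumulants_iff hΦ A).2 (agreeOnBlocks_of_expansion_eq fun g₀ _ _ _ t X hX => ?_)
      exact weakSolution_unique hΦ (h g₀) (hwc g₀) t hX
    tfae_have 2 → 5 := fun h g₀ f₀ hf hg =>
      ⟨_, isClassicalSolution_signedClusterSum hΦ hf,
        hrep ((areCumulants_iff hΦ A).1 h) g₀ f₀ hg⟩
    tfae_have 5 → 6 := by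
      intro h g₀ f₀ hf hg u hu t X hX
      obtain ⟨u', hu', hr⟩ := h g₀ f₀ hf hg
      filter_upwards [hr t X hX, ae_restrict_mem (isOpen_allowed σ X).measurableSet] with x hx hxm
      rw [hx]
      exact classicalSolution_unique hΦ hu' hu t hX hxm
    -- The known classical solution given by the cumulants serves as the comparison, and smooth data
    -- suffice to determine the operators.
    tfae_have 6 → 2 := by
      intro h
      refine (areCumulants_iff hΦ A).2 (agreeOnBlocks_of_expansion_eq fun g₀ f₀ hf hg t X hX => ?_)
      exact Lp.ext ((h g₀ f₀ hf hg _ (isClassicalSolution_signedClusterSum hΦ hf) t X hX).trans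
        (expansion_cumulant_ae_eq hΦ hg t X).symm)
    tfae_finish
  · intro h g₀ hg₀ t X Y hX hY e he
    rw [(hsolve.1 h).expansion_eq g₀ t hX, (hsolve.1 h).expansion_eq g₀ t hY]
    exact isDoubleSequence_expansion_cumulant hΦ hg₀ t X Y hX hY e he
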